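/- Let $n\ge 3$ and let $V\in L^\infty(\mathbb R^n)$ be real-valued, of the form $V=V_L+V_S$ with $V_L,V_S$ real-valued and measurable. Assume that there are constants $r_0,C_1,C_2>0$, real numbers $\delta>3$ and $\beta\ge 3$, and a decreasing (that is, non-increasing) function $p:[r_0,\infty)\to(0,\infty)$ with $p(r)\to0$ as $r\to\infty$, such that - $|V_S(x)|\le C_1(|x|+1)^{-\delta}$ for almost every $x\in\mathbb R^n$; - for almost every direction $\omega\in\mathbb S^{n-1}$ the function $r\mapsto V_L(r\omega)$ is $C^1$ on $[r_0,\infty)$, and for all $r\ge r_0$ $$V_L(r\omega)\le p(r),\qquad \partial_rV_L(r\omega)\le C_2(r+1)^{-\beta}.$$ For $h>0$ let $P(h)=-h^2\Delta+V$ on $L^2(\mathbb R^n)$ with domain $H^2(\mathbb R^n)$, where $\Delta=\sum_j\partial_{x_j}^2$. Let $s>1/2$ and $E>0$. Then there exist constants $C>0$ and $h_0>0$ (which may depend on $n$, $V_L$, $V_S$, $r_0,C_1,C_2,\delta,\beta,p$, $s$ and $E$, but not on $h$ or $\theta$) such that for all $0<h\le h_0$, all $0<\theta<1$ and both choices of the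 sign $\pm$, the resolvent $(P(h)-E\pm i\theta)^{-1}$ exists as a bounded operator on $L^2(\mathbb R^n)$ and $$\log\left\|(|x|+1)^{-s}(P(h)-E\pm i\theta)^{-1}(|x|+1)^{-s}\right\|_{L^2\to L^2}\le C\,h^{-4/3}\log(h^{-1})$$ (the operator inside the norm being non-zero). -/

import Mathlib

open MeasureTheory Set Filter Topology
open scoped ENNReal SchwartzMap Laplacian

noncomputable section

namespace SemiclassicalResolvent

/-- `ℝⁿ` with the Euclidean norm. -/
abbrev Rn (n : ℕ) : Type := EuclideanSpace ℝ (Fin n)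

/-- `L²(ℝⁿ)`, complex-valued, with respect to Lebesgue measure. -/
abbrev L2 (n : ℕ) : Type := Lp ℂ 2 (volume : Measure (Rn n))

/-- The embedding of `L²(ℝⁿ)` into tempered distributions. -/
abbrev toDist (n : ℕ) : L2 n →L[ℂ] 𝓢'(Rn n, ℂ) :=
  Lp.toTemperedDistributionCLM ℂ (volume : Measure (Rn n)) 2

/-- The Sobolev space `H²(ℝⁿ)`, as a subspace of `L²(ℝⁿ)`. -/
def sobolevH2 (n : ℕ) : Submodule ℂ (L2 n) where
  carrier := {u | TemperedDistribution.MemSobolev 2 2 (toDist n u)}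
  add_mem' := by
    intro u v hu hv
    simp only [mem_ofPred_eq, map_add] at *
    exact hu.add hv
  zero_mem' := by
    simp only [mem_ofPred_eq, map_zero]
    exact TemperedDistribution.memSobolev_fun_zero _ _ _ _
  smul_mem' := by
    intro c u hu
    simp only [mem_ofPred_eq, map_smul] at *
    exact hu.smul c

lemma toDist_injective (n : ℕ) : Function.Injective (toDist n) :=
  LinearMap.ker_eq_bot.mp
    (Lp.ker_toTemperedDistributionCLM_eq_bot (F := ℂ) (μ := (volume : Measure (Rn n))) (p := 2))

/-- The distributional Laplacian of an `H²` function is (represented by) an `L²` function. -/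
lemma exists_laplacian {n : ℕ} (u : sobolevH2 n) :
    ∃ w : L2 n, Δ (toDist n (u : L2 n)) = toDist n w := by
  have hu : TemperedDistribution.MemSobolev 2 2 (toDist n (u : L2 n)) := u.2
  have h := hu.laplacian
  rw [sub_self] at h
  exact TemperedDistribution.memSobolev_zero_iff.mp h

/-- The Laplacian `Δ = ∑ ∂ⱼ²` (in the sense of distributions) as a linear map
`H²(ℝⁿ) → L²(ℝⁿ)`. -/
def laplacian (n : ℕ) : sobolevH2 n →ₗ[ℂ] L2 n where
  toFun u := (exists_laplacian u).choose
  map_add' u v := by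
    apply toDist_injective n
    rw [map_add, ← (exists_laplacian (u + v)).choose_spec, ← (exists_laplacian u).choose_spec,
      ← (exists_laplacian v).choose_spec, Submodule.coe_add, map_add]
    simp only [← TemperedDistribution.laplacianCLM_apply, map_add]
  map_smul' c u := by
    apply toDist_injective n
    rw [RingHom.id_apply, map_smul, ← (exists_laplacian (c • u)).choose_spec,
      ← (exists_laplacian u).choose_spec, Submodule.coe_smul, map_smul]
    simp only [← TemperedDistribution.laplacianCLM_apply, map_smul]

lemma toDist_laplacian {n : ℕ} (u : sobolevH2 n) :
    toDist n (laplacian n u) = Δ (toDist n (u : L2 n)) :=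
  (exists_laplacian u).choose_spec.symm

/-- Multiplication by a real-valued function `φ ∈ L^∞(ℝⁿ)`, as a bounded operator on `L²(ℝⁿ)`. -/
def mulOp {n : ℕ} (φ : Rn n → ℝ) (hφ : MemLp φ ∞ (volume : Measure (Rn n))) : L2 n →L[ℂ] L2 n :=
  (ContinuousLinearMap.mul ℂ ℂ).holderL volume ∞ 2 2 hφ.ofReal.toLp

lemma mulOp_ae {n : ℕ} (φ : Rn n → ℝ) (hφ : MemLp φ ∞ (volume : Measure (Rn n))) (u : L2 n) :
    ∀ᵐ x, mulOp φ hφ u x = (φ x : ℂ) * u x := by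
  have h1 := (ContinuousLinearMap.mul ℂ ℂ).coeFn_holder (r := 2) (hφ.ofReal (K := ℂ)).toLp u
  have h2 := (hφ.ofReal (K := ℂ)).coeFn_toLp
  filter_upwards [h1, h2] with x hx1 hx2
  refine hx1.trans ?_
  rw [hx2]
  rfl

/-- The semiclassical Schrödinger operator `P(h) = -h²Δ + V` on `L²(ℝⁿ)`, with domain `H²(ℝⁿ)`. -/
def schrodinger {n : ℕ} (h : ℝ) (V : Rn n → ℝ) (hV : MemLp V ∞ (volume : Measure (Rn n))) :
    L2 n →ₗ.[ℂ] L2 n where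
  domain := sobolevH2 n
  toFun := (-(h : ℂ) ^ 2) • laplacian n + (mulOp V hV).toLinearMap ∘ₗ (sobolevH2 n).subtype

/-- `R = (P - z)⁻¹`: the bounded operator `R` is a two-sided inverse of
`P - z : domain P → L²(ℝⁿ)`. There is at most one such `R`. -/
structure IsResolvent {n : ℕ} (P : L2 n →ₗ.[ℂ] L2 n) (z : ℂ) (R : L2 n →L[ℂ] L2 n) : Prop where
  mem_domain : ∀ f, R f ∈ P.domain
  right_inv : ∀ f, P ⟨R f, mem_domain f⟩ - z • R f = f
  left_inv : ∀ u : P.domain, R (P u - z • (u : L2 n)) = u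

lemma memLp_weight (n : ℕ) {s : ℝ} (hs : 0 ≤ s) :
    MemLp (fun x : Rn n => (‖x‖ + 1) ^ (-s)) ∞ (volume : Measure (Rn n)) := by
  refine memLp_top_of_bound (C := 1) ?_ (Eventually.of_forall fun x => ?_)
  · refine Continuous.aestronglyMeasurable ?_
    exact Continuous.rpow_const (by fun_prop) fun x => Or.inl (by positivity)
  · rw [Real.norm_of_nonneg (by positivity)]
    exact Real.rpow_le_one_of_one_le_of_nonpos (by simp) (by simpa using hs)

/-- Multiplication by the weight `(|x| + 1)^{-s}`, `s ≥ 0`, as a bounded operator on `L²(ℝⁿ)`. -/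
def weight (n : ℕ) (s : ℝ) (hs : 0 ≤ s) : L2 n →L[ℂ] L2 n :=
  mulOp (fun x => (‖x‖ + 1) ^ (-s)) (memLp_weight n hs)

end SemiclassicalResolvent

end

open SemiclassicalResolvent

/-!
The resolvent exists because `-h²Δ + V` is symmetric on `H²` and `H²` is the range of a Bessel
potential, so that a Neumann series followed by a continuation argument along the half-planes
`Im z ≠ 0` inverts `P - z` (`exists_resolvent`).

The bound is a Carleman estimate with a radial phase `φ` and a radial weight `μ`. Write `r = |x|`,
`q = 1 + r`, and split `V = W + U`, where `W` equals `V_L` cut off near the ball of radius `r₀`, so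
that `∂ᵣ W ≤ C₃ / q³` on almost every ray, and `U = O(q⁻³)` (`exists_splitPotential`). For a test
function `f` the equation is paired with the multiplier `2 e M (x·∇f) + c f`, where `e = exp(2φ/h)`,
`M = μ/r` and `c` is chosen so that the multiplier equals `2 e μ t`, with `t` the radial derivative
of the conjugated function `exp(φ/h) r^{(n-1)/2} f`, up to the conjugating factors. The kinetic part
is a Rellich–Morawetz identity (`multiplier_identity`). The potential and the remaining zeroth order
terms are integrated by parts along rays (`radial_flux_nonpos`), which only needs an upper bound
for the one-sided radial derivative of `W`, and no regularity of `W` across rays. Together they leave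
the pointwise quantity of `carleman_identity`, dominated by

  `(h² μ' + 4 h μ φ') t² + ((μ φ'²)' + (E - W) μ' - μ ∂ᵣ W) f²`.

With `φ' = κ (1/q - 1/(q + A))` and `μ` growing like `q² - 1` up to `q = A` and bounded afterwards,
the coefficient of `f²` is at least `(E/4) μ'` plus what is needed to absorb the cross terms
(`carleman_positivity`): near the origin the term `μ' φ'² / q²` beats `W` since `κ` is large, at
infinity `W ≤ E/4`. Absorbing the short-range cross term `U μ f t` for `q ≤ A` into `4 h μ φ' t²`
requires `h κ³` to be bounded below. Hence `κ ∼ h^{-1/3}`, while `A` can be a power of `1/h`; the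
weight `e` is then at most `exp(C h^{-4/3} log (1/h))`, which is the bound of the theorem.

The estimate passes to `H²` because test functions are dense for the graph norm of the Laplacian
(`closed_induction_test`). Applied to `u = (P - E ± iθ)⁻¹ w g`, its residual is `θ u`, and
`θ ‖u‖² ≤ ‖w u‖ ‖g‖` by symmetry, which turns it into the bound for `‖w u‖`
(`norm_weighted_resolvent_le`).
-/

/-! ### Resolvents of symmetric operators -/

namespace SemiclassicalResolvent

/-- A Neumann series argument: the resolvent survives a perturbation `B` of the operator `P - z`
with `‖B‖ ‖R‖ < 1`. The same statement covers a change of the potential and a change of the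
spectral parameter. -/
lemma IsResolvent.exists_of_perturb {n : ℕ} {P P' : L2 n →ₗ.[ℂ] L2 n} {z z' : ℂ}
    {R : L2 n →L[ℂ] L2 n} (hR : IsResolvent P z R) (B : L2 n →L[ℂ] L2 n)
    (hd : P'.domain = P.domain)
    (hP : ∀ (u : L2 n) (hu : u ∈ P.domain) (hu' : u ∈ P'.domain),
      P' ⟨u, hu'⟩ - z' • u = P ⟨u, hu⟩ - z • u + B u)
    (hB : ‖B‖ * ‖R‖ < 1) : ∃ R', IsResolvent P' z' R' := by
  have hsmall : ‖-(B ∘L R)‖ < 1 := by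
    rw [norm_neg]
    exact lt_of_le_of_lt (ContinuousLinearMap.opNorm_comp_le _ _) hB
  obtain ⟨U, hU⟩ := isUnit_one_sub_of_norm_lt_one hsmall
  have hUv : ∀ f : L2 n, (U : L2 n →L[ℂ] L2 n) f = f + B (R f) := by
    intro f
    rw [hU]
    simp
  have hmul : ∀ f : L2 n, (U : L2 n →L[ℂ] L2 n) ((↑U⁻¹ : L2 n →L[ℂ] L2 n) f) = f := by
    intro f
    rw [← _root_.mul_apply_eq_comp, U.mul_inv]
    rfl
  have hmul' : ∀ f : L2 n, (↑U⁻¹ : L2 n →L[ℂ] L2 n) ((U : L2 n →L[ℂ] L2 n) f) = f := by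
    intro f
    rw [← _root_.mul_apply_eq_comp, U.inv_mul]
    rfl
  refine ⟨R ∘L (↑U⁻¹ : L2 n →L[ℂ] L2 n), ⟨fun f => ?_, fun f => ?_, fun u => ?_⟩⟩
  · rw [hd]
    exact hR.mem_domain _
  · have := hP _ (hR.mem_domain ((↑U⁻¹ : L2 n →L[ℂ] L2 n) f)) (by rw [hd]; exact hR.mem_domain _)
    simp only [ContinuousLinearMap.comp_apply]
    rw [this, hR.right_inv, ← hUv, hmul]
  · have hu : (u : L2 n) ∈ P.domain := hd ▸ u.2
    have h1 := hR.left_inv ⟨u, hu⟩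
    have h2 := hP u hu u.2
    simp only at h1
    rw [ContinuousLinearMap.comp_apply]
    have h4 : P' u - z' • (u : L2 n)
        = (U : L2 n →L[ℂ] L2 n) (P ⟨u, hu⟩ - z • (u : L2 n)) := by
      rw [hUv, h1]
      exact h2
    rw [h4, hmul', h1]

/-- The quadratic form of `P` is real. -/
def IsSymm {n : ℕ} (P : L2 n →ₗ.[ℂ] L2 n) : Prop :=
  ∀ u : P.domain, (inner ℂ (u : L2 n) (P u)).im = 0

/-- Pairing `(P - z) u = f` with `u` and taking imaginary parts. -/
lemma IsResolvent.im_inner {n : ℕ} {P : L2 n →ₗ.[ℂ] L2 n} (hP : IsSymm P) {z : ℂ}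
    {R : L2 n →L[ℂ] L2 n} (hR : IsResolvent P z R) (f : L2 n) :
    |z.im| * ‖R f‖ ^ 2 = |(inner ℂ (R f) f).im| := by
  have h1 := hR.right_inv f
  have h2 : inner ℂ (R f) f = inner ℂ (R f) (P ⟨R f, hR.mem_domain f⟩)
      - z * (‖R f‖ : ℂ) ^ 2 := by
    have h3 : inner ℂ (R f) (z • R f) = z * (‖R f‖ : ℂ) ^ 2 := by
      rw [inner_smul_right, inner_self_eq_norm_sq_to_K]
      rfl
    rw [← h3, ← inner_sub_right, h1]
  have h3 := hP ⟨R f, hR.mem_domain f⟩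
  simp only at h3
  have h4 : (z * (‖R f‖ : ℂ) ^ 2).im = z.im * ‖R f‖ ^ 2 := by
    rw [← Complex.ofReal_pow, Complex.im_mul_ofReal]
  rw [h2, Complex.sub_im, h3, h4, zero_sub, abs_neg, abs_mul, abs_of_nonneg (sq_nonneg ‖R f‖)]

lemma IsResolvent.norm_le {n : ℕ} {P : L2 n →ₗ.[ℂ] L2 n} (hP : IsSymm P) {z : ℂ}
    (hz : z.im ≠ 0) {R : L2 n →L[ℂ] L2 n} (hR : IsResolvent P z R) :
    ‖R‖ ≤ |z.im|⁻¹ := by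
  have hpos : 0 < |z.im| := abs_pos.mpr hz
  refine ContinuousLinearMap.opNorm_le_bound _ (by positivity) fun f => ?_
  have h := hR.im_inner hP f
  have h1 : |(inner ℂ (R f) f).im| ≤ ‖R f‖ * ‖f‖ :=
    (Complex.abs_im_le_norm _).trans (norm_inner_le_norm _ _)
  rw [← h] at h1
  rw [inv_mul_eq_div, le_div_iff₀ hpos]
  by_cases h0 : ‖R f‖ = 0
  · rw [h0, zero_mul]; positivity
  · have h0' : 0 < ‖R f‖ := lt_of_le_of_ne (norm_nonneg _) (Ne.symm h0)
    nlinarith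

lemma IsResolvent.exists_of_close {n : ℕ} {P : L2 n →ₗ.[ℂ] L2 n} {z z' : ℂ}
    {R : L2 n →L[ℂ] L2 n} (hR : IsResolvent P z R) (h : ‖z' - z‖ * ‖R‖ < 1) :
    ∃ R', IsResolvent P z' R' := by
  refine hR.exists_of_perturb (-(z' - z) • ContinuousLinearMap.id ℂ (L2 n)) rfl ?_ ?_
  · intro u hu hu'
    simp only [_root_.smul_apply, ContinuousLinearMap.id_apply]
    module
  · refine lt_of_le_of_lt ?_ h
    gcongr
    refine ContinuousLinearMap.opNorm_le_bound _ (norm_nonneg _) fun f => ?_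
    rw [_root_.smul_apply, norm_smul, norm_neg, ContinuousLinearMap.id_apply]

/-- For a symmetric operator, the set of `z` with `0 < s Im z` at which the resolvent exists is
empty or the whole half-plane: by the bound `‖R‖ ≤ |Im z|⁻¹` one can follow a segment with steps of
constant length. -/
lemma IsResolvent.exists_of_halfPlane {n : ℕ} {P : L2 n →ₗ.[ℂ] L2 n} (hP : IsSymm P)
    {s : ℝ} (hs : |s| = 1) {z z' : ℂ} (hz : 0 < s * z.im) (hz' : 0 < s * z'.im)
    (hR : ∃ R, IsResolvent P z R) : ∃ R', IsResolvent P z' R' := by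
  obtain ⟨m, hm0, hmz, hmz'⟩ : ∃ m : ℝ, 0 < m ∧ m ≤ s * z.im ∧ m ≤ s * z'.im :=
    ⟨min (s * z.im) (s * z'.im), lt_min hz hz', min_le_left _ _, min_le_right _ _⟩
  obtain ⟨N, hN⟩ := exists_nat_gt (‖z' - z‖ / m)
  have hN0 : (0 : ℝ) < N := lt_of_le_of_lt (by positivity) hN
  have key : ∀ j : ℕ, j ≤ N → ∃ R', IsResolvent P (z + ((j / N : ℝ) : ℂ) * (z' - z)) R' := by
    intro j
    induction j with
    | zero => intro _; simpa using hR
    | succ j ih =>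
      intro hj
      obtain ⟨R', hR'⟩ := ih (by omega)
      refine hR'.exists_of_close ?_
      have hj1 : (j : ℝ) / N ≤ 1 := by
        rw [div_le_one hN0]; exact_mod_cast (by omega : j ≤ N)
      have hj0 : 0 ≤ (j : ℝ) / N := by positivity
      have him : m ≤ |(z + ((j / N : ℝ) : ℂ) * (z' - z)).im| := by
        have h1 : s * (z + ((j / N : ℝ) : ℂ) * (z' - z)).im
            = (1 - j / N) * (s * z.im) + j / N * (s * z'.im) := by
          rw [Complex.add_im, Complex.im_ofReal_mul, Complex.sub_im]
          ring
        have h2 : m ≤ s * (z + ((j / N : ℝ) : ℂ) * (z' - z)).im := by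
          rw [h1]
          nlinarith
        refine h2.trans ((le_abs_self _).trans ?_)
        rw [abs_mul, hs, one_mul]
      have hne : (z + ((j / N : ℝ) : ℂ) * (z' - z)).im ≠ 0 := by
        intro h0; rw [h0, abs_zero] at him; linarith
      have hb := hR'.norm_le hP hne
      have hdiff : ‖z + (((j + 1 : ℕ) / N : ℝ) : ℂ) * (z' - z)
          - (z + ((j / N : ℝ) : ℂ) * (z' - z))‖ = ‖z' - z‖ / N := by
        have : z + (((j + 1 : ℕ) / N : ℝ) : ℂ) * (z' - z)
          - (z + ((j / N : ℝ) : ℂ) * (z' - z)) = ((1 / N : ℝ) : ℂ) * (z' - z) := by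
          push_cast; ring
        rw [this, norm_mul, Complex.norm_real, Real.norm_of_nonneg (by positivity)]
        ring
      rw [hdiff]
      calc ‖z' - z‖ / N * ‖R'‖ ≤ ‖z' - z‖ / N * m⁻¹ := by
            gcongr
            exact hb.trans (inv_anti₀ hm0 him)
        _ = ‖z' - z‖ / m / N := by field_simp
        _ < 1 := by rw [div_lt_one hN0]; exact hN
  have := key N le_rfl
  rwa [div_self hN0.ne', Complex.ofReal_one, one_mul, add_sub_cancel] at this

end SemiclassicalResolvent

/-! ### The Sobolev space and its approximation by test functions -/

namespace SemiclassicalResolvent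

/-- The `i`-th partial derivative. -/
noncomputable def pd {n : ℕ} {G : Type*} [NormedAddCommGroup G] [NormedSpace ℝ G] (i : Fin n)
    (f : Rn n → G) (x : Rn n) : G :=
  fderiv ℝ f x (EuclideanSpace.basisFun (Fin n) ℝ i)

/-- The classical Laplacian `∑ ∂ᵢ²` of a function on `ℝⁿ`. -/
noncomputable def lap {n : ℕ} {G : Type*} [NormedAddCommGroup G] [NormedSpace ℝ G]
    (f : Rn n → G) (x : Rn n) : G :=
  ∑ i, pd i (pd i f) x

open LineDeriv in
lemma schwartz_lineDeriv_eq_pd {n : ℕ} (F : 𝓢(Rn n, ℂ)) (i : Fin n) :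
    ((∂_{EuclideanSpace.basisFun (Fin n) ℝ i} F : 𝓢(Rn n, ℂ)) : Rn n → ℂ) = pd i F := by
  ext x
  rw [SchwartzMap.lineDerivOp_apply_eq_fderiv]
  rfl

lemma schwartz_laplacian_eq_lap {n : ℕ} (F : 𝓢(Rn n, ℂ)) : ((Δ F : 𝓢(Rn n, ℂ)) : Rn n → ℂ) = lap F := by
  ext x
  rw [SchwartzMap.laplacian_eq_sum (EuclideanSpace.basisFun (Fin n) ℝ)]
  rw [_root_.sum_apply]
  refine Finset.sum_congr rfl fun i _ => ?_
  rw [schwartz_lineDeriv_eq_pd, schwartz_lineDeriv_eq_pd]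

section Bessel

open TemperedDistribution

lemma toDist_toLp {n : ℕ} (F : 𝓢(Rn n, ℂ)) :
    toDist n (F.toLp 2 volume) = SchwartzMap.toTemperedDistributionCLM (Rn n) ℂ volume F := by
  rw [Lp.toTemperedDistributionCLM_apply, Lp.toTemperedDistribution_toLp_eq]

lemma besselPotential_two_eq {n : ℕ} (T : 𝓢'(Rn n, ℂ)) :
    besselPotential (Rn n) ℂ 2 T = T - (((2 * Real.pi) ^ 2)⁻¹ : ℝ) • Δ T := by
  have hsplit : besselPotential (Rn n) ℂ 2 T
      = fourierMultiplierCLM ℂ (fun _ : Rn n => (1 : ℂ)) T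
        + fourierMultiplierCLM ℂ (fun x : Rn n => Complex.ofReal (‖x‖ ^ 2)) T := by
    have h := fourierMultiplierCLM_sum (E := Rn n) ℂ (s := (Finset.univ : Finset (Fin 2)))
      (g := ![fun _ : Rn n => (1 : ℂ), fun x : Rn n => Complex.ofReal (‖x‖ ^ 2)]) (by
        intro i _
        fin_cases i
        · exact Function.HasTemperateGrowth.const 1
        · change Function.HasTemperateGrowth (fun x : Rn n => Complex.ofReal (‖x‖ ^ 2))
          fun_prop)
    simp only [Fin.sum_univ_two, Matrix.cons_val_zero, Matrix.cons_val_one] at h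
    rw [besselPotential, ← _root_.add_apply, ← h]
    congr 1
    congr 1
    ext x
    norm_num
  rw [hsplit, fourierMultiplierCLM_const, laplacian_eq_fourierMultiplierCLM]
  rw [one_smul, smul_smul, show ((2 * Real.pi) ^ 2)⁻¹ * -(2 * Real.pi) ^ 2 = -1 by field_simp,
    neg_smul, one_smul, sub_neg_eq_add]
  rfl

lemma exists_bessel {n : ℕ} (g : L2 n) :
    ∃ u : L2 n, besselPotential (Rn n) ℂ (-2) (toDist n g) = toDist n u := by
  have h0 : MemSobolev 0 2 (toDist n g) := memSobolev_zero_iff.mpr ⟨g, rfl⟩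
  have h1 : MemSobolev 2 2 (besselPotential (Rn n) ℂ (-2) (toDist n g)) := by
    rw [memSobolev_besselPotential_iff]
    norm_num
    exact h0
  exact memSobolev_zero_iff.mp (h1.mono (by norm_num))

/-- `(1 - (2π)⁻² Δ)⁻¹` on `L²(ℝⁿ)`, as a linear map. -/
noncomputable def besselLM (n : ℕ) : L2 n →ₗ[ℂ] L2 n where
  toFun g := (exists_bessel g).choose
  map_add' g g' := by
    apply toDist_injective n
    refine (exists_bessel (g + g')).choose_spec.symm.trans ?_
    rw [map_add, map_add, map_add]
    exact congrArg₂ _ (exists_bessel g).choose_spec (exists_bessel g').choose_spec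
  map_smul' c g := by
    apply toDist_injective n
    refine (exists_bessel (c • g)).choose_spec.symm.trans ?_
    rw [map_smul, map_smul, RingHom.id_apply, map_smul]
    exact congrArg _ (exists_bessel g).choose_spec

lemma toDist_besselLM {n : ℕ} (g : L2 n) :
    toDist n (besselLM n g) = besselPotential (Rn n) ℂ (-2) (toDist n g) :=
  (exists_bessel g).choose_spec.symm

/-- `(1 - (2π)⁻² Δ)⁻¹` as a bounded operator on `L²(ℝⁿ)`. Continuity comes from the closed graph
theorem, since the Bessel potential is continuous on tempered distributions. -/
noncomputable def bessel (n : ℕ) : L2 n →L[ℂ] L2 n where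
  toLinearMap := besselLM n
  cont := by
    refine (besselLM n).continuous_of_seq_closed_graph fun u x y hu hy => ?_
    apply toDist_injective n
    have h1 : Tendsto (fun j => toDist n (besselLM n (u j))) atTop (𝓝 (toDist n y)) :=
      ((toDist n).continuous.tendsto y).comp hy
    have h2 : Tendsto (fun j => toDist n (besselLM n (u j))) atTop
        (𝓝 (besselPotential (Rn n) ℂ (-2) (toDist n x))) := by
      simp only [toDist_besselLM]
      exact (((besselPotential (Rn n) ℂ (-2)).continuous.comp
        (toDist n).continuous).tendsto x).comp hu
    rw [toDist_besselLM]
    exact tendsto_nhds_unique h1 h2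

lemma toDist_bessel {n : ℕ} (g : L2 n) :
    toDist n (bessel n g) = besselPotential (Rn n) ℂ (-2) (toDist n g) :=
  toDist_besselLM g

lemma bessel_mem {n : ℕ} (g : L2 n) : bessel n g ∈ sobolevH2 n := by
  refine ⟨g, ?_⟩
  rw [toDist_bessel]
  simp

lemma bessel_sub_laplacian {n : ℕ} (u : sobolevH2 n) :
    bessel n ((u : L2 n) - (((2 * Real.pi) ^ 2)⁻¹ : ℝ) • laplacian n u) = u := by
  apply toDist_injective n
  rw [toDist_bessel, map_sub]
  have : toDist n ((((2 * Real.pi) ^ 2)⁻¹ : ℝ) • laplacian n u)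
      = (((2 * Real.pi) ^ 2)⁻¹ : ℝ) • Δ (toDist n (u : L2 n)) := by
    rw [← toDist_laplacian]
    exact (toDist n).map_smul_of_tower _ _
  rw [this, ← besselPotential_two_eq]
  simp

lemma sub_laplacian_bessel {n : ℕ} (g : L2 n) :
    bessel n g - (((2 * Real.pi) ^ 2)⁻¹ : ℝ) • laplacian n ⟨bessel n g, bessel_mem g⟩ = g := by
  apply toDist_injective n
  rw [map_sub]
  have : toDist n ((((2 * Real.pi) ^ 2)⁻¹ : ℝ) • laplacian n ⟨bessel n g, bessel_mem g⟩)
      = (((2 * Real.pi) ^ 2)⁻¹ : ℝ) • Δ (toDist n (bessel n g)) := by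
    rw [show Δ (toDist n (bessel n g)) = Δ (toDist n ((⟨bessel n g, bessel_mem g⟩ : sobolevH2 n) :
      L2 n)) from rfl, ← toDist_laplacian]
    exact (toDist n).map_smul_of_tower _ _
  rw [this, ← besselPotential_two_eq, toDist_bessel]
  simp

lemma laplacian_bessel {n : ℕ} (g : L2 n) :
    laplacian n ⟨bessel n g, bessel_mem g⟩ = ((2 * Real.pi) ^ 2 : ℝ) • (bessel n g - g) := by
  have h := sub_laplacian_bessel g
  have h2 : bessel n g - g = (((2 * Real.pi) ^ 2)⁻¹ : ℝ) •
      laplacian n ⟨bessel n g, bessel_mem g⟩ := by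
    exact sub_eq_of_eq_add (by rw [← sub_eq_iff_eq_add'.mp h])
  rw [h2, smul_smul, mul_inv_cancel₀ (by positivity), one_smul]

lemma toLp_mem_sobolevH2 {n : ℕ} (F : 𝓢(Rn n, ℂ)) : F.toLp 2 volume ∈ sobolevH2 n := by
  change MemSobolev 2 2 (toDist n (F.toLp 2 volume))
  rw [toDist_toLp]
  exact F.memSobolev

lemma laplacian_toLp {n : ℕ} (F : 𝓢(Rn n, ℂ)) :
    laplacian n ⟨F.toLp 2 volume, toLp_mem_sobolevH2 F⟩ = (Δ F : 𝓢(Rn n, ℂ)).toLp 2 volume := by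
  apply toDist_injective n
  rw [toDist_laplacian, toDist_toLp, toDist_toLp, laplacian_toTemperedDistributionCLM_eq]

/-- The Bessel potential of a Schwartz function is a Schwartz function. -/
lemma exists_schwartz_bessel {n : ℕ} (K : 𝓢(Rn n, ℂ)) :
    ∃ F : 𝓢(Rn n, ℂ), bessel n (K.toLp 2 volume) = F.toLp 2 volume := by
  refine ⟨SchwartzMap.fourierMultiplierCLM ℂ
    (fun x : Rn n => (((1 + ‖x‖ ^ 2) ^ ((-2 : ℝ) / 2) : ℝ) : ℂ)) K, ?_⟩
  apply toDist_injective n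
  rw [toDist_bessel, toDist_toLp, toDist_toLp, besselPotential,
    fourierMultiplierCLM_toTemperedDistributionCLM_eq (by fun_prop)]

/-- Schwartz functions are dense in `H²`, in the graph norm of the Laplacian. -/
lemma mem_closure_schwartz {n : ℕ} (u : sobolevH2 n) :
    ((u : L2 n), laplacian n u) ∈
      closure (range fun F : 𝓢(Rn n, ℂ) => ((F.toLp 2 volume : L2 n), ((Δ F : 𝓢(Rn n, ℂ)).toLp 2 volume : L2 n))) := by
  set g : L2 n := (u : L2 n) - (((2 * Real.pi) ^ 2)⁻¹ : ℝ) • laplacian n u with hg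
  have hu : bessel n g = u := bessel_sub_laplacian u
  let Φ : L2 n → L2 n × L2 n := fun g => (bessel n g, ((2 * Real.pi) ^ 2 : ℝ) • (bessel n g - g))
  have hΦ : Continuous Φ := by
    refine Continuous.prodMk (bessel n).continuous ?_
    exact ((bessel n).continuous.sub continuous_id).const_smul ((2 * Real.pi) ^ 2 : ℝ)
  have h1 : ((u : L2 n), laplacian n u) = Φ g := by
    simp only [Φ, ← laplacian_bessel]
    ext1
    · exact hu.symm
    · simp only
      congr 1
      exact Subtype.ext hu.symm
  have hdense : DenseRange (fun K : 𝓢(Rn n, ℂ) => (K.toLp 2 volume : L2 n)) :=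
    SchwartzMap.denseRange_toLpCLM (F := ℂ) (μ := (volume : Measure (Rn n))) (p := 2) (by norm_num)
  rw [h1]
  have h2 : Φ g ∈ closure (Φ '' range (fun K : 𝓢(Rn n, ℂ) => (K.toLp 2 volume : L2 n))) :=
    image_closure_subset_closure_image hΦ ⟨g, hdense g, rfl⟩
  refine closure_mono ?_ h2
  rintro _ ⟨_, ⟨K, rfl⟩, rfl⟩
  obtain ⟨F, hF⟩ := exists_schwartz_bessel K
  refine ⟨F, ?_⟩
  simp only [Φ, ← laplacian_bessel]
  ext1
  · exact hF.symm
  · simp only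
    rw [← laplacian_toLp]
    congr 1
    exact Subtype.ext hF.symm

end Bessel


section FreeResolvent

lemma schrodinger_apply {n : ℕ} (h : ℝ) (V : Rn n → ℝ)
    (hV : MemLp V ∞ (volume : Measure (Rn n))) (u : sobolevH2 n) :
    schrodinger h V hV u = (-(h : ℂ) ^ 2) • laplacian n u + mulOp V hV u := rfl

/-- The graph norm closure of the Schwartz functions is contained in any closed set containing
them. -/
lemma closed_induction_schwartz {n : ℕ} {p : L2 n × L2 n → Prop} (hp : IsClosed {x | p x})
    (h : ∀ F : 𝓢(Rn n, ℂ), p (F.toLp 2 volume, (Δ F : 𝓢(Rn n, ℂ)).toLp 2 volume))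
    (u : sobolevH2 n) : p ((u : L2 n), laplacian n u) := by
  refine closure_minimal ?_ hp (mem_closure_schwartz u)
  rintro _ ⟨F, rfl⟩
  exact h F

lemma im_inner_laplacian {n : ℕ} (u : sobolevH2 n) :
    (inner ℂ (u : L2 n) (laplacian n u)).im = 0 := by
  refine closed_induction_schwartz (p := fun x : L2 n × L2 n => (inner ℂ x.1 x.2).im = 0)
    ?_ (fun F => ?_) u
  · exact isClosed_eq (Complex.continuous_im.comp (continuous_fst.inner continuous_snd))
      continuous_const
  · let B : ℂ →L[ℝ] ℂ →L[ℝ] ℝ :=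
      (ContinuousLinearMap.compL ℝ ℂ ℂ ℝ Complex.imCLM) ∘L
        ((ContinuousLinearMap.mul ℝ ℂ) ∘L (Complex.conjCLE : ℂ →L[ℝ] ℂ))
    have hB : ∀ a b, B a b = (starRingEnd ℂ a * b).im := fun a b => rfl
    have hanti : ∀ a b, B a b = - B b a := by
      intro a b
      simp only [hB, Complex.mul_im, Complex.conj_re, Complex.conj_im]
      ring
    have h1 := SchwartzMap.integral_bilinear_laplacian_right_eq_left (μ := volume) F F B
    have h2 : ∫ x, B (F x) ((Δ F : 𝓢(Rn n, ℂ)) x) = 0 := by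
      have h3 : ∫ x, B ((Δ F : 𝓢(Rn n, ℂ)) x) (F x) = - ∫ x, B (F x) ((Δ F : 𝓢(Rn n, ℂ)) x) := by
        rw [← integral_neg]
        exact integral_congr_ae (Eventually.of_forall fun x => hanti _ _)
      linarith
    have h4 : inner ℂ (F.toLp 2 volume : L2 n) ((Δ F : 𝓢(Rn n, ℂ)).toLp 2 volume)
        = ∫ x, starRingEnd ℂ (F x) * (Δ F : 𝓢(Rn n, ℂ)) x := by
      rw [L2.inner_def]
      refine integral_congr_ae ?_
      filter_upwards [F.coeFn_toLp 2 volume, (Δ F : 𝓢(Rn n, ℂ)).coeFn_toLp 2 volume] with x h1 h2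
      rw [h1, h2, RCLike.inner_apply, mul_comm]
    have hint : Integrable (fun x => starRingEnd ℂ (F x) * (Δ F : 𝓢(Rn n, ℂ)) x) volume := by
      have := L2.integrable_inner (𝕜 := ℂ) (F.toLp 2 volume : L2 n)
        ((Δ F : 𝓢(Rn n, ℂ)).toLp 2 volume)
      refine this.congr ?_
      filter_upwards [F.coeFn_toLp 2 volume, (Δ F : 𝓢(Rn n, ℂ)).coeFn_toLp 2 volume] with x h1 h2
      rw [h1, h2, RCLike.inner_apply, mul_comm]
    simp only
    rw [h4]
    have h5 := Complex.imCLM.integral_comp_comm hint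
    rw [Complex.imCLM_apply] at h5
    rw [← h5]
    exact h2

lemma im_inner_mulOp {n : ℕ} (V : Rn n → ℝ) (hV : MemLp V ∞ (volume : Measure (Rn n)))
    (u : L2 n) : (inner ℂ u (mulOp V hV u)).im = 0 := by
  rw [L2.inner_def]
  have h5 := Complex.imCLM.integral_comp_comm (L2.integrable_inner (𝕜 := ℂ) u (mulOp V hV u))
  rw [Complex.imCLM_apply] at h5
  rw [← h5]
  refine integral_eq_zero_of_ae ?_
  filter_upwards [mulOp_ae V hV u] with x hx
  rw [hx]
  simp [RCLike.inner_apply]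
  ring

lemma mulOp_zero {n : ℕ} (h0 : MemLp (fun _ : Rn n => (0 : ℝ)) ∞ (volume : Measure (Rn n)))
    (u : L2 n) : mulOp (fun _ => 0) h0 u = 0 := by
  refine Lp.ext ?_
  filter_upwards [mulOp_ae (fun _ => 0) h0 u, Lp.coeFn_zero ℂ 2 volume] with x h1 h2
  rw [h1, h2]
  simp

lemma isSymm_schrodinger {n : ℕ} (h : ℝ) (V : Rn n → ℝ)
    (hV : MemLp V ∞ (volume : Measure (Rn n))) : IsSymm (schrodinger h V hV) := by
  intro (u : sobolevH2 n)
  have h1 : inner ℂ (u : L2 n) ((-(h : ℂ) ^ 2) • laplacian n u)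
      = ((-h ^ 2 : ℝ) : ℂ) * inner ℂ (u : L2 n) (laplacian n u) := by
    rw [inner_smul_right]
    push_cast
    ring
  have h2 : (inner ℂ (u : L2 n) ((-(h : ℂ) ^ 2) • laplacian n u + mulOp V hV u)).im = 0 := by
    rw [inner_add_right, Complex.add_im, im_inner_mulOp, h1, Complex.im_ofReal_mul,
      im_inner_laplacian]
    simp
  exact h2

/-- At the spectral parameter `-(2πh)²` the resolvent of `-h²Δ` is a multiple of the Bessel
potential. -/
lemma isResolvent_free {n : ℕ} {h : ℝ} (hh : 0 < h)
    (h0 : MemLp (fun _ : Rn n => (0 : ℝ)) ∞ (volume : Measure (Rn n))) :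
    IsResolvent (schrodinger h (fun _ => 0) h0) ((-(2 * Real.pi * h) ^ 2 : ℝ) : ℂ)
      (((((2 * Real.pi * h) ^ 2)⁻¹ : ℝ) : ℂ) • bessel n) := by
  have hm : ∀ u : L2 n, mulOp (fun _ => 0) h0 u = 0 := mulOp_zero h0
  set c : ℂ := ((((2 * Real.pi * h) ^ 2)⁻¹ : ℝ) : ℂ) with hc
  set d : ℂ := ((((2 * Real.pi) ^ 2)⁻¹ : ℝ) : ℂ) with hd
  have hc0 : c ≠ 0 := by
    rw [hc]
    exact_mod_cast (by positivity : ((2 * Real.pi * h) ^ 2)⁻¹ ≠ 0)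
  have hcd : c⁻¹ * d = (h : ℂ) ^ 2 := by
    rw [hc, hd, ← Complex.ofReal_inv, ← Complex.ofReal_mul, ← Complex.ofReal_pow]
    congr 1
    field_simp
  have hz : ((-(2 * Real.pi * h) ^ 2 : ℝ) : ℂ) = - c⁻¹ := by
    rw [hc, ← Complex.ofReal_inv, ← Complex.ofReal_neg, inv_inv]
  have hmem : ∀ f : L2 n, (c • bessel n) f ∈ sobolevH2 n := fun f =>
    (sobolevH2 n).smul_mem c (bessel_mem f)
  have key : ∀ u : sobolevH2 n, ((-(h : ℂ) ^ 2) • laplacian n u + mulOp (fun _ => 0) h0 u)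
      - ((-(2 * Real.pi * h) ^ 2 : ℝ) : ℂ) • (u : L2 n)
      = c⁻¹ • ((u : L2 n) - d • laplacian n u) := by
    intro u
    rw [hm, add_zero, smul_sub, smul_smul, hcd, hz]
    module
  have hb1 : ∀ f : L2 n, bessel n f - d • laplacian n ⟨bessel n f, bessel_mem f⟩ = f := fun f => by
    rw [hd, Complex.coe_smul]
    exact sub_laplacian_bessel f
  have hb2 : ∀ u : sobolevH2 n, bessel n ((u : L2 n) - d • laplacian n u) = u := fun u => by
    rw [hd, Complex.coe_smul]
    exact bessel_sub_laplacian u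
  refine ⟨hmem, fun f => ?_, fun (u : sobolevH2 n) => ?_⟩
  · refine (key ⟨_, hmem f⟩).trans ?_
    have h2 : (⟨_, hmem f⟩ : sobolevH2 n) = c • (⟨bessel n f, bessel_mem f⟩ : sobolevH2 n) := rfl
    have h3 : laplacian n ⟨_, hmem f⟩ = c • laplacian n ⟨bessel n f, bessel_mem f⟩ := by
      rw [h2, map_smul]
    have h4 : c⁻¹ • (c • bessel n f - d • (c • laplacian n ⟨bessel n f, bessel_mem f⟩)) = f := by
      rw [smul_comm d c, ← smul_sub, smul_smul, inv_mul_cancel₀ hc0, one_smul, hb1]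
    rw [← h3] at h4
    exact h4
  · refine (congrArg (c • bessel n) (key u)).trans ?_
    have h4 : c • bessel n (c⁻¹ • ((u : L2 n) - d • laplacian n u)) = u := by
      rw [map_smul, hb2, smul_smul, mul_inv_cancel₀ hc0, one_smul]
    exact h4

/-- `P(h)` has a resolvent at every non-real point. -/
lemma exists_resolvent {n : ℕ} {h : ℝ} (hh : 0 < h) (V : Rn n → ℝ)
    (hV : MemLp V ∞ (volume : Measure (Rn n))) {z : ℂ} (hz : z.im ≠ 0) :
    ∃ R, IsResolvent (schrodinger h V hV) z R := by
  have h0 : MemLp (fun _ : Rn n => (0 : ℝ)) ∞ (volume : Measure (Rn n)) := MemLp.zero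
  obtain ⟨s, hs, hsz⟩ : ∃ s : ℝ, |s| = 1 ∧ 0 < s * z.im := by
    rcases lt_or_gt_of_ne hz with h | h
    · exact ⟨-1, by simp, by linarith⟩
    · exact ⟨1, by simp, by linarith⟩
  have hs2 : s * s = 1 := by rw [← abs_mul_abs_self, hs, one_mul]
  have hfree := isResolvent_free (n := n) hh h0
  set R₀ := ((((2 * Real.pi * h) ^ 2)⁻¹ : ℝ) : ℂ) • bessel n
  obtain ⟨t, ht, htR⟩ : ∃ t : ℝ, 0 < t ∧ t * ‖R₀‖ < 1 := by
    refine ⟨(‖R₀‖ + 1)⁻¹, by positivity, ?_⟩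
    rw [inv_mul_lt_iff₀ (by positivity)]
    linarith
  have h1 : ∃ R, IsResolvent (schrodinger h (fun _ => 0) h0)
      (((-(2 * Real.pi * h) ^ 2 : ℝ) : ℂ) + (s * t : ℝ) * Complex.I) R := by
    refine hfree.exists_of_close ?_
    rw [add_sub_cancel_left, norm_mul, Complex.norm_I, mul_one, Complex.norm_real, norm_mul,
      Real.norm_eq_abs, hs, one_mul, Real.norm_of_nonneg ht.le]
    exact htR
  set T : ℝ := ‖mulOp V hV‖ + 1
  have hT : 0 < T := by positivity
  obtain ⟨R, hR⟩ : ∃ R, IsResolvent (schrodinger h (fun _ => 0) h0) ((s * T : ℝ) * Complex.I) R :=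
    IsResolvent.exists_of_halfPlane (isSymm_schrodinger h _ h0) hs
      (by
        rw [Complex.add_im, Complex.ofReal_im, zero_add, Complex.mul_I_im, Complex.ofReal_re,
          ← mul_assoc, hs2, one_mul]
        exact ht) (by simp [← mul_assoc, hs2, hT]) h1
  have him : (((s * T : ℝ) : ℂ) * Complex.I).im = s * T := by simp
  have hne : (((s * T : ℝ) : ℂ) * Complex.I).im ≠ 0 := by
    rw [him]
    intro h
    have : s * (s * T) = 0 := by rw [h, mul_zero]
    rw [← mul_assoc, hs2, one_mul] at this
    exact hT.ne' this
  have hnorm := hR.norm_le (isSymm_schrodinger h _ h0) hne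
  rw [him, abs_mul, hs, one_mul, abs_of_pos hT] at hnorm
  refine IsResolvent.exists_of_halfPlane (isSymm_schrodinger h V hV) hs
    (z := ((s * T : ℝ) : ℂ) * Complex.I) (by simp [← mul_assoc, hs2, hT]) hsz ?_
  refine hR.exists_of_perturb (mulOp V hV) rfl ?_ ?_
  · intro u hu hu'
    have e1 := schrodinger_apply h V hV ⟨u, hu'⟩
    have e2 := schrodinger_apply h (fun _ => 0) h0 ⟨u, hu⟩
    refine (congrArg (· - _) e1).trans (Eq.trans ?_ (congrArg (· - _ + _) e2).symm)
    simp only [mulOp_zero]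
    abel
  · calc ‖mulOp V hV‖ * ‖R‖ ≤ ‖mulOp V hV‖ * T⁻¹ := by gcongr
      _ < 1 := by
        rw [mul_inv_lt_iff₀ hT]
        simp [T]

end FreeResolvent

end SemiclassicalResolvent

/-! ### Test functions are dense in the graph norm -/

namespace SemiclassicalResolvent

section PartialDerivatives

variable {n : ℕ} {G : Type*} [NormedAddCommGroup G] [NormedSpace ℝ G]

lemma contDiff_pd {f : Rn n → G} (hf : ContDiff ℝ (⊤ : ℕ∞) f) (i : Fin n) : ContDiff ℝ (⊤ : ℕ∞) (pd i f) :=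
  (hf.fderiv_right (by simp)).clm_apply contDiff_const

lemma contDiff_lap {f : Rn n → G} (hf : ContDiff ℝ (⊤ : ℕ∞) f) : ContDiff ℝ (⊤ : ℕ∞) (lap f) :=
  ContDiff.sum fun i _ => contDiff_pd (contDiff_pd hf i) i

lemma hasCompactSupport_pd {f : Rn n → G} (hf : HasCompactSupport f) (i : Fin n) :
    HasCompactSupport (pd i f) :=
  hf.fderiv_apply ℝ _

lemma hasCompactSupport_lap {f : Rn n → G} (hf : HasCompactSupport f) :
    HasCompactSupport (lap f) := by
  have h : tsupport (lap f) ⊆ tsupport f := by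
    refine closure_minimal (fun x hx => ?_) (isClosed_tsupport f)
    by_contra hxf
    apply hx
    refine Finset.sum_eq_zero fun i _ => image_eq_zero_of_notMem_tsupport fun h => hxf ?_
    have h1 : tsupport (pd i (pd i f)) ⊆ tsupport (pd i f) := tsupport_fderiv_apply_subset ℝ _
    have h2 : tsupport (pd i f) ⊆ tsupport f := tsupport_fderiv_apply_subset ℝ _
    exact h2 (h1 h)
  exact hf.of_isClosed_subset (isClosed_tsupport _) h

lemma pd_smul {χ : Rn n → ℝ} {f : Rn n → G} {x : Rn n} (hχ : DifferentiableAt ℝ χ x)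
    (hf : DifferentiableAt ℝ f x) (i : Fin n) :
    pd i (fun x => χ x • f x) x = χ x • pd i f x + pd i χ x • f x := by
  rw [pd, fderiv_fun_smul hχ hf]
  simp [pd]

lemma pd_add {f g : Rn n → G} {x : Rn n} (hf : DifferentiableAt ℝ f x)
    (hg : DifferentiableAt ℝ g x) (i : Fin n) :
    pd i (fun x => f x + g x) x = pd i f x + pd i g x := by
  rw [pd, fderiv_fun_add hf hg]
  rfl

lemma lap_smul {χ : Rn n → ℝ} {f : Rn n → G} (hχ : ContDiff ℝ (⊤ : ℕ∞) χ) (hf : ContDiff ℝ (⊤ : ℕ∞) f)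
    (x : Rn n) :
    lap (fun x => χ x • f x) x
      = χ x • lap f x + (2 : ℝ) • ∑ i, pd i χ x • pd i f x + lap χ x • f x := by
  have h1 : ∀ i : Fin n, pd i (fun x => χ x • f x) = fun x => χ x • pd i f x + pd i χ x • f x :=
    fun i => funext fun y =>
      pd_smul (hχ.differentiable (by simp) y) (hf.differentiable (by simp) y) i
  have h2 : ∀ i : Fin n, pd i (pd i (fun x => χ x • f x)) x
      = χ x • pd i (pd i f) x + (2 : ℝ) • (pd i χ x • pd i f x) + pd i (pd i χ) x • f x := by
    intro i
    have a1 := (contDiff_pd hχ i).differentiable (by simp) x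
    have a2 := (contDiff_pd hf i).differentiable (by simp) x
    have a3 := hχ.differentiable (by simp) x
    have a4 := hf.differentiable (by simp) x
    rw [h1, pd_add (a3.fun_smul a2) (a1.fun_smul a4), pd_smul a3 a2, pd_smul a1 a4]
    module
  simp only [lap, h2, Finset.sum_add_distrib, Finset.smul_sum, Finset.sum_smul]

lemma pd_comp_smul (f : Rn n → G) (c : ℝ) (i : Fin n) (x : Rn n) :
    pd i (fun x => f (c • x)) x = c • pd i f (c • x) := by
  rw [pd, fderiv_comp_smul]
  rfl

lemma pd_const_smul {f : Rn n → G} {x : Rn n} (hf : DifferentiableAt ℝ f x) (c : ℝ) (i : Fin n) :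
    pd i (fun x => c • f x) x = c • pd i f x := by
  rw [pd, fderiv_fun_const_smul hf]
  rfl

lemma lap_comp_smul {f : Rn n → G} (hf : ContDiff ℝ (⊤ : ℕ∞) f) (c : ℝ) (x : Rn n) :
    lap (fun x => f (c • x)) x = c ^ 2 • lap f (c • x) := by
  simp only [lap, Finset.smul_sum]
  refine Finset.sum_congr rfl fun i _ => ?_
  rw [show pd i (fun x => f (c • x)) = fun x => c • pd i f (c • x) from
    funext fun y => pd_comp_smul f c i y, pd_const_smul, pd_comp_smul, smul_smul, sq]
  exact ((contDiff_pd hf i).comp (contDiff_const_smul c)).differentiable (by simp) x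

end PartialDerivatives

/-- A smooth compactly supported function equal to `1` near the origin, with the bounds that the
rescaled cut-offs `χ (x / k)` need. -/
lemma exists_cutoff (n : ℕ) : ∃ (χ : Rn n → ℝ) (C : ℝ), ContDiff ℝ (⊤ : ℕ∞) χ ∧ HasCompactSupport χ ∧
    0 ≤ C ∧ (∀ x, |1 - χ x| ≤ ‖x‖) ∧ (∀ i x, |pd i χ x| ≤ C) ∧ ∀ x, |lap χ x| ≤ C := by
  let b : ContDiffBump (0 : Rn n) := ⟨1, 2, by norm_num, by norm_num⟩
  have hb : ContDiff ℝ (⊤ : ℕ∞) b := b.contDiff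
  have hc : HasCompactSupport b := b.hasCompactSupport
  have h1 : ∀ i : Fin n, ∃ C, ∀ x, ‖pd i b x‖ ≤ C := fun i =>
    (hasCompactSupport_pd hc i).exists_bound_of_continuous (contDiff_pd hb i).continuous
  choose C1 hC1 using h1
  obtain ⟨C2, hC2⟩ :=
    (hasCompactSupport_lap hc).exists_bound_of_continuous (contDiff_lap hb).continuous
  refine ⟨b, ∑ i, |C1 i| + |C2|, hb, hc, by positivity, fun x => ?_, fun i x => ?_, fun x => ?_⟩
  · by_cases hx : ‖x‖ ≤ 1
    · rw [b.one_of_mem_closedBall (by simpa [Metric.mem_closedBall] using hx)]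
      simp
    · have h0 : 0 ≤ b x := b.nonneg
      have h1 : b x ≤ 1 := b.le_one
      rw [abs_of_nonneg (by linarith)]
      linarith
  · have h2 : |C1 i| ≤ ∑ i, |C1 i| :=
      Finset.single_le_sum (f := fun i => |C1 i|) (fun _ _ => abs_nonneg _) (Finset.mem_univ i)
    have h3 := hC1 i x
    rw [Real.norm_eq_abs] at h3
    linarith [le_abs_self (C1 i), abs_nonneg C2]
  · have h3 := hC2 x
    rw [Real.norm_eq_abs] at h3
    have : 0 ≤ ∑ i, |C1 i| := Finset.sum_nonneg fun _ _ => abs_nonneg _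
    linarith [le_abs_self C2]

lemma norm_toLp_sub_le {n : ℕ} {F F' : 𝓢(Rn n, ℂ)} {H : Rn n → ℝ} (hH : MemLp H 2 volume)
    {c : ℝ} (h : ∀ x, ‖F x - F' x‖ ≤ c * ‖H x‖) :
    ‖(F.toLp 2 volume : L2 n) - F'.toLp 2 volume‖ ≤ c * ‖hH.toLp‖ := by
  refine Lp.norm_le_mul_norm_of_ae_le_mul ?_
  filter_upwards [F.coeFn_toLp 2 volume, F'.coeFn_toLp 2 volume, hH.coeFn_toLp,
    Lp.coeFn_sub (F.toLp 2 volume : L2 n) (F'.toLp 2 volume)] with x h1 h2 h3 h4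
  rw [h4, Pi.sub_apply, h1, h2, h3]
  exact h x

open LineDeriv in
/-- A Schwartz function is approximated by its products with the cut-offs `χ (x / k)`: the errors,
and those of the Laplacians, are `1 / k` times a fixed square-integrable function. -/
lemma schwartz_mem_closure_test {n : ℕ} (F : 𝓢(Rn n, ℂ)) :
    ((F.toLp 2 volume : L2 n), ((Δ F : 𝓢(Rn n, ℂ)).toLp 2 volume : L2 n)) ∈
      closure ((fun F : 𝓢(Rn n, ℂ) => ((F.toLp 2 volume : L2 n),
        ((Δ F : 𝓢(Rn n, ℂ)).toLp 2 volume : L2 n))) '' {F | HasCompactSupport F}) := by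
  obtain ⟨χ, C, hχ, hχc, hC, hχ1, hχ2, hχ3⟩ := exists_cutoff n
  have hgrow : (fun x : Rn n => (1 + ‖x‖ ^ 2 : ℝ)).HasTemperateGrowth := by fun_prop
  let S₁ : 𝓢(Rn n, ℂ) := SchwartzMap.smulLeftCLM ℂ (fun x : Rn n => (1 + ‖x‖ ^ 2 : ℝ)) F
  let S₂ : 𝓢(Rn n, ℂ) := SchwartzMap.smulLeftCLM ℂ (fun x : Rn n => (1 + ‖x‖ ^ 2 : ℝ)) (Δ F)
  have hweight : ∀ (T : 𝓢(Rn n, ℂ)) (x : Rn n), ‖x‖ * ‖T x‖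
      ≤ ‖(SchwartzMap.smulLeftCLM ℂ (fun x : Rn n => (1 + ‖x‖ ^ 2 : ℝ)) T) x‖ := by
    intro T x
    rw [SchwartzMap.smulLeftCLM_apply_apply hgrow, norm_smul]
    gcongr
    rw [Real.norm_of_nonneg (by positivity)]
    nlinarith [sq_nonneg (‖x‖ - 1)]
  let H : Rn n → ℝ := fun x => ‖S₁ x‖ + ‖S₂ x‖ + (2 * C) * ∑ i, ‖pd i F x‖ + C * ‖F x‖
  have hH0 : ∀ x, 0 ≤ H x := fun x => by positivity
  have hH : MemLp H 2 volume := by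
    have hS : ∀ S : 𝓢(Rn n, ℂ), MemLp (fun x => ‖S x‖) 2 volume := fun S => (S.memLp 2 volume).norm
    refine (((hS S₁).add (hS S₂)).add (MemLp.const_mul ?_ _)).add ((hS F).const_mul _)
    refine memLp_finsetSum _ fun i _ => ?_
    rw [← schwartz_lineDeriv_eq_pd]
    exact hS _
  have hsmall : ∀ k : ℕ, 1 ≤ k → ∃ F' : 𝓢(Rn n, ℂ), HasCompactSupport F' ∧
      (∀ x, ‖F x - F' x‖ ≤ (1 / k : ℝ) * ‖H x‖) ∧
      (∀ x, ‖(Δ F : 𝓢(Rn n, ℂ)) x - (Δ F' : 𝓢(Rn n, ℂ)) x‖ ≤ (1 / k : ℝ) * ‖H x‖) := by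
    intro k hk
    have hk1 : (1 : ℝ) ≤ k := by exact_mod_cast hk
    have hk0 : (0 : ℝ) < k := by linarith
    set c : ℝ := 1 / k with hc
    have hc0 : 0 < c := by positivity
    have hc1 : c ≤ 1 := by rw [hc, div_le_one hk0]; exact hk1
    have hχk : ContDiff ℝ (⊤ : ℕ∞) (fun x : Rn n => χ (c • x)) := hχ.comp (contDiff_const_smul c)
    have hχkc : HasCompactSupport (fun x : Rn n => χ (c • x)) :=
      hχc.comp_homeomorph (Homeomorph.smulOfNeZero c hc0.ne')
    have hsm : ContDiff ℝ (⊤ : ℕ∞) (fun x : Rn n => χ (c • x) • F x) := hχk.smul (F.smooth _)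
    have hcs : HasCompactSupport (fun x : Rn n => χ (c • x) • F x) := hχkc.smul_right
    have hdist : ∀ x : Rn n, |1 - χ (c • x)| ≤ c * ‖x‖ := by
      intro x
      have := hχ1 (c • x)
      rwa [norm_smul, Real.norm_of_nonneg hc0.le] at this
    refine ⟨hcs.toSchwartzMap hsm, hcs, fun x => ?_, fun x => ?_⟩
    · have h1 : F x - (hcs.toSchwartzMap hsm) x = (1 - χ (c • x)) • F x := by
        change F x - χ (c • x) • F x = _
        rw [sub_smul, one_smul]
      rw [h1, norm_smul, Real.norm_eq_abs, Real.norm_of_nonneg (hH0 x)]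
      calc |1 - χ (c • x)| * ‖F x‖ ≤ c * ‖x‖ * ‖F x‖ := by gcongr; exact hdist x
        _ = c * (‖x‖ * ‖F x‖) := by ring
        _ ≤ c * H x := by
          gcongr
          refine (hweight F x).trans ?_
          have : 0 ≤ ‖S₂ x‖ + (2 * C) * ∑ i, ‖pd i F x‖ + C * ‖F x‖ := by positivity
          simp only [H]
          change ‖S₁ x‖ ≤ _
          linarith
    · have e1 : (Δ (hcs.toSchwartzMap hsm) : 𝓢(Rn n, ℂ)) x
          = lap (fun x : Rn n => χ (c • x) • F x) x := by
        rw [schwartz_laplacian_eq_lap]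
        rfl
      have h1 : (Δ F : 𝓢(Rn n, ℂ)) x - (Δ (hcs.toSchwartzMap hsm) : 𝓢(Rn n, ℂ)) x
          = (1 - χ (c • x)) • (Δ F : 𝓢(Rn n, ℂ)) x
            - (2 * c) • ∑ i, pd i χ (c • x) • pd i F x - (c ^ 2 * lap χ (c • x)) • F x := by
        rw [e1, lap_smul hχk (F.smooth _), lap_comp_smul hχ, schwartz_laplacian_eq_lap]
        simp only [pd_comp_smul, smul_assoc, ← Finset.smul_sum]
        module
      rw [h1, Real.norm_of_nonneg (hH0 x)]
      have b1 : ‖(1 - χ (c • x)) • (Δ F : 𝓢(Rn n, ℂ)) x‖ ≤ c * ‖S₂ x‖ := by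
        rw [norm_smul, Real.norm_eq_abs]
        calc _ ≤ c * ‖x‖ * ‖(Δ F : 𝓢(Rn n, ℂ)) x‖ := by gcongr; exact hdist x
          _ = c * (‖x‖ * ‖(Δ F : 𝓢(Rn n, ℂ)) x‖) := by ring
          _ ≤ _ := by gcongr; exact hweight _ x
      have b2 : ‖(2 * c) • ∑ i, pd i χ (c • x) • pd i F x‖ ≤ c * ((2 * C) * ∑ i, ‖pd i F x‖) := by
        rw [norm_smul, Real.norm_of_nonneg (by positivity)]
        have : ‖∑ i, pd i χ (c • x) • pd i F x‖ ≤ C * ∑ i, ‖pd i F x‖ := by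
          rw [Finset.mul_sum]
          refine norm_sum_le_of_le _ fun i _ => ?_
          rw [norm_smul, Real.norm_eq_abs]
          gcongr
          exact hχ2 i _
        calc _ ≤ 2 * c * (C * ∑ i, ‖pd i F x‖) := by gcongr
          _ = _ := by ring
      have b3 : ‖(c ^ 2 * lap χ (c • x)) • F x‖ ≤ c * (C * ‖F x‖) := by
        rw [norm_smul, norm_mul, Real.norm_of_nonneg (by positivity : 0 ≤ c ^ 2), Real.norm_eq_abs]
        calc c ^ 2 * |lap χ (c • x)| * ‖F x‖ ≤ c * C * ‖F x‖ := by
              gcongr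
              · nlinarith
              · exact hχ3 _
          _ = _ := by ring
      refine (norm_sub_le _ _).trans ((add_le_add (norm_sub_le _ _) le_rfl).trans ?_)
      have : 0 ≤ c * ‖S₁ x‖ := by positivity
      simp only [H]
      linarith
  rw [Metric.mem_closure_iff]
  intro ε hε
  obtain ⟨k, hk⟩ := exists_nat_gt (‖hH.toLp‖ / ε)
  have hk0 : (0 : ℝ) < k := lt_of_le_of_lt (by positivity) hk
  obtain ⟨F', hF', h1, h2⟩ := hsmall k (by exact_mod_cast hk0)
  refine ⟨_, ⟨F', hF', rfl⟩, ?_⟩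
  have hlt : (1 / k : ℝ) * ‖hH.toLp‖ < ε := by
    rw [div_lt_iff₀ hε] at hk
    rw [div_mul_eq_mul_div, one_mul, div_lt_iff₀ hk0]
    linarith
  rw [Prod.dist_eq, max_lt_iff, dist_eq_norm, dist_eq_norm]
  exact ⟨(norm_toLp_sub_le hH h1).trans_lt hlt, (norm_toLp_sub_le hH h2).trans_lt hlt⟩

/-- A closed condition on `(u, Δu)` holds for all `u ∈ H²` once it holds for test functions. -/
lemma closed_induction_test {n : ℕ} {p : L2 n × L2 n → Prop} (hp : IsClosed {x | p x})
    (h : ∀ F : 𝓢(Rn n, ℂ), HasCompactSupport F →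
      p (F.toLp 2 volume, (Δ F : 𝓢(Rn n, ℂ)).toLp 2 volume))
    (u : sobolevH2 n) : p ((u : L2 n), laplacian n u) := by
  refine closed_induction_schwartz hp (fun F => ?_) u
  refine closure_minimal ?_ hp (schwartz_mem_closure_test F)
  rintro _ ⟨F, hF, rfl⟩
  exact h F hF

end SemiclassicalResolvent

/-! ### The radial multiplier identity -/

namespace SemiclassicalResolvent

section RadialIBP

variable {n : ℕ}

lemma continuous_comp_norm {B : ℝ → ℝ} (hB : ContinuousOn B (Ici 0)) :
    Continuous fun x : Rn n => B ‖x‖ :=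
  hB.comp_continuous continuous_norm fun x => norm_nonneg x

lemma norm_basisFun (i : Fin n) : ‖EuclideanSpace.basisFun (Fin n) ℝ i‖ = 1 :=
  (EuclideanSpace.basisFun (Fin n) ℝ).norm_eq_one i

lemma abs_coord_div_norm_le (x : Rn n) (i : Fin n) : |x i / ‖x‖| ≤ 1 := by
  rw [abs_div, abs_norm]
  refine div_le_one_of_le₀ ?_ (norm_nonneg x)
  have := EuclideanSpace.norm_sq_eq x
  have h2 : ‖x i‖ ^ 2 ≤ ∑ j, ‖x j‖ ^ 2 :=
    Finset.single_le_sum (f := fun j => ‖x j‖ ^ 2) (fun _ _ => sq_nonneg _) (Finset.mem_univ i)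
  rw [← this] at h2
  exact (sq_le_sq₀ (abs_nonneg _) (norm_nonneg _)).mp h2

lemma measurable_coord_div_norm (i : Fin n) : Measurable fun x : Rn n => x i / ‖x‖ := by
  have : Measurable fun x : Rn n => x i := by
    have : Continuous fun x : Rn n => x i := by fun_prop
    exact this.measurable
  exact this.div measurable_norm

lemma integrable_radial_mul {B : ℝ → ℝ} (hB : ContinuousOn B (Ici 0)) {g : Rn n → ℝ}
    (hg : Continuous g) (hgc : HasCompactSupport g) : Integrable fun x => B ‖x‖ * g x :=
  ((continuous_comp_norm hB).mul hg).integrable_of_hasCompactSupport hgc.mul_left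

lemma integrable_radial_coord_mul {B : ℝ → ℝ} (hB : ContinuousOn B (Ici 0)) {g : Rn n → ℝ}
    (hg : Continuous g) (hgc : HasCompactSupport g) (i : Fin n) :
    Integrable fun x => B ‖x‖ * (x i / ‖x‖) * g x := by
  have h := (integrable_radial_mul hB hg hgc).bdd_mul (f := fun x : Rn n => x i / ‖x‖) (c := 1)
    (measurable_coord_div_norm i).aestronglyMeasurable
    (Eventually.of_forall fun x => abs_coord_div_norm_le x i)
  refine h.congr (Eventually.of_forall fun x => ?_)
  simp only
  ring

lemma hasDerivAt_norm_line {x : Rn n} (hx : x ≠ 0) (i : Fin n) :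
    HasDerivAt (fun t : ℝ => ‖x + t • EuclideanSpace.basisFun (Fin n) ℝ i‖) (x i / ‖x‖) 0 := by
  have hx' : 0 < ‖x‖ := norm_pos_iff.mpr hx
  have h1 : ∀ t : ℝ, ‖x + t • EuclideanSpace.basisFun (Fin n) ℝ i‖
      = Real.sqrt (‖x‖ ^ 2 + 2 * t * x i + t ^ 2) := by
    intro t
    rw [← Real.sqrt_sq (norm_nonneg (x + _)), norm_add_sq_real, norm_smul, norm_basisFun,
      inner_smul_right, EuclideanSpace.basisFun_apply, EuclideanSpace.inner_single_right]
    simp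
    ring_nf
  have h2 : HasDerivAt (fun t : ℝ => ‖x‖ ^ 2 + 2 * t * x i + t ^ 2) (2 * x i) 0 := by
    have := (((hasDerivAt_id (0 : ℝ)).const_mul 2).mul_const (x i)).const_add (‖x‖ ^ 2)
    have h3 := this.add ((hasDerivAt_id (0 : ℝ)).pow 2)
    convert! h3 using 1
    simp
  have h3 := h2.sqrt (by simp [hx])
  simp only [h1]
  convert h3 using 1
  simp [Real.sqrt_sq hx'.le]
  field_simp

/-- Integration by parts against a radial function: `B (|x|)` may have a conical singularity at the
origin, so it is only Lipschitz there. -/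
lemma integral_radial_deriv_mul (hn : 0 < n) {B B' : ℝ → ℝ}
    (hB : ∀ r, 0 ≤ r → HasDerivAt B (B' r) r) (hB' : ContinuousOn B' (Ici 0)) {g : Rn n → ℝ}
    (hg : ContDiff ℝ (⊤ : ℕ∞) g) (hgc : HasCompactSupport g) (i : Fin n) :
    ∫ x, B' ‖x‖ * (x i / ‖x‖) * g x = - ∫ x, B ‖x‖ * pd i g x := by
  have : Nonempty (Fin n) := ⟨⟨0, hn⟩⟩
  obtain ⟨R, hR0, hR⟩ : ∃ R : ℝ, 0 < R ∧ ∀ x : Rn n, R ≤ ‖x‖ → x ∉ tsupport g := by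
    obtain ⟨R, hR⟩ := hgc.isBounded.subset_closedBall (0 : Rn n)
    refine ⟨|R| + 1, by positivity, fun x hx hx' => ?_⟩
    have := hR hx'
    rw [mem_closedBall_zero_iff] at this
    linarith [le_abs_self R]
  obtain ⟨C, hC⟩ := isCompact_Icc.exists_bound_of_continuousOn
    (hB'.mono (Icc_subset_Ici_self : Icc 0 R ⊆ Ici 0))
  have hlip : LipschitzOnWith C.toNNReal B (Icc 0 R) := by
    refine (convex_Icc 0 R).lipschitzOnWith_of_nnnorm_hasDerivWithin_le
      (f' := B') (fun r hr => (hB r hr.1).hasDerivWithinAt) fun r hr => ?_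
    rw [← NNReal.coe_le_coe, coe_nnnorm]
    exact (hC r hr).trans (Real.le_coe_toNNReal C)
  -- clamping the argument to `[0, R]` makes the radial function globally Lipschitz
  have hlip2 : LipschitzWith C.toNNReal fun x : Rn n => B (projIcc 0 R hR0.le ‖x‖) := by
    have h1 : LipschitzWith C.toNNReal fun r : ℝ => B (projIcc 0 R hR0.le r) := by
      have := hlip.to_restrict.comp (LipschitzWith.projIcc hR0.le)
      rwa [mul_one] at this
    simpa [Function.comp_def] using h1.comp (lipschitzWith_one_norm (E := Rn n))
  obtain ⟨D, hD⟩ := hg.lipschitzWith_of_hasCompactSupport hgc (by simp)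
  have key := hlip2.integral_lineDeriv_mul_eq (μ := volume) hD hgc
    (EuclideanSpace.basisFun (Fin n) ℝ i)
  have hball : ∀ x : Rn n, ‖x‖ ≤ R → ((projIcc 0 R hR0.le ‖x‖ : Icc 0 R) : ℝ) = ‖x‖ := by
    intro x hx
    rw [projIcc_of_mem hR0.le ⟨norm_nonneg x, hx⟩]
  have hL : ∫ x, lineDeriv ℝ (fun x : Rn n => B (projIcc 0 R hR0.le ‖x‖)) x
      (EuclideanSpace.basisFun (Fin n) ℝ i) * g x = ∫ x, B' ‖x‖ * (x i / ‖x‖) * g x := by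
    refine integral_congr_ae ?_
    have h0 : ∀ᵐ x : Rn n, x ≠ 0 := by
      simp [ae_iff]
    filter_upwards [h0] with x hx
    by_cases hxR : ‖x‖ < R
    · congr 1
      have hx' : 0 < ‖x‖ := norm_pos_iff.mpr hx
      have h1 := hasDerivAt_norm_line hx i
      have h2 : HasDerivAt (fun t : ℝ => B ‖x + t • EuclideanSpace.basisFun (Fin n) ℝ i‖)
          (B' ‖x‖ * (x i / ‖x‖)) 0 := by
        have h3 := hB ‖x‖ (norm_nonneg x)
        refine HasDerivAt.comp (h₂ := B) (0 : ℝ) ?_ h1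
        simpa using h3
      refine HasLineDerivAt.lineDeriv (h2.congr_of_eventuallyEq ?_)
      have h4 : ∀ᶠ t : ℝ in 𝓝 0, ‖x + t • EuclideanSpace.basisFun (Fin n) ℝ i‖ < R := by
        refine h1.continuousAt.eventually_lt continuousAt_const ?_
        simpa using hxR
      filter_upwards [h4] with t ht
      rw [hball _ ht.le]
    · rw [image_eq_zero_of_notMem_tsupport (hR x (not_lt.mp hxR)), mul_zero, mul_zero]
  have hRt : ∫ x, lineDeriv ℝ g x (-EuclideanSpace.basisFun (Fin n) ℝ i)
      * B (projIcc 0 R hR0.le ‖x‖) = - ∫ x, B ‖x‖ * pd i g x := by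
    rw [← integral_neg]
    congr 1
    ext x
    rw [lineDeriv_neg, (hg.differentiable (by simp) x).lineDeriv_eq_fderiv]
    by_cases hxR : ‖x‖ ≤ R
    · rw [hball x hxR, pd]
      ring
    · have hx : x ∉ tsupport (fderiv ℝ g) := fun h =>
        hR x (not_le.mp hxR).le (tsupport_fderiv_subset ℝ h)
      rw [pd, image_eq_zero_of_notMem_tsupport hx]
      simp
  rw [← hL, key, hRt]

end RadialIBP

section Multiplier

variable {n : ℕ}

/-- The radial (Euler) derivative `x · ∇f = r ∂ᵣ f`. -/
noncomputable def euler (f : Rn n → ℝ) (x : Rn n) : ℝ := ∑ j, x j * pd j f x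

/-- `|∇f|²`. -/
noncomputable def gradSq (f : Rn n → ℝ) (x : Rn n) : ℝ := ∑ j, pd j f x ^ 2

lemma euler_eq_fderiv (f : Rn n → ℝ) (x : Rn n) : euler f x = fderiv ℝ f x x := by
  conv_rhs => rw [← (EuclideanSpace.basisFun (Fin n) ℝ).sum_repr x, map_sum]
  rw [euler]
  refine Finset.sum_congr rfl fun j _ => ?_
  rw [map_smul, EuclideanSpace.basisFun_repr, smul_eq_mul]
  congr 2
  exact ((EuclideanSpace.basisFun (Fin n) ℝ).sum_repr x).symm

lemma gradSq_nonneg (f : Rn n → ℝ) (x : Rn n) : 0 ≤ gradSq f x :=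
  Finset.sum_nonneg fun _ _ => sq_nonneg _

lemma euler_sq_le (f : Rn n → ℝ) (x : Rn n) : euler f x ^ 2 ≤ ‖x‖ ^ 2 * gradSq f x := by
  have h := Finset.sum_mul_sq_le_sq_mul_sq Finset.univ (fun j => x j) (fun j => pd j f x)
  rw [EuclideanSpace.norm_sq_eq]
  simpa [euler, gradSq] using h

lemma contDiff_coord (j : Fin n) : ContDiff ℝ (⊤ : ℕ∞) fun x : Rn n => x j := by fun_prop

lemma contDiff_euler {f : Rn n → ℝ} (hf : ContDiff ℝ (⊤ : ℕ∞) f) :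
    ContDiff ℝ (⊤ : ℕ∞) (euler f) :=
  ContDiff.sum fun j _ => (contDiff_coord j).mul (contDiff_pd hf j)

lemma contDiff_gradSq {f : Rn n → ℝ} (hf : ContDiff ℝ (⊤ : ℕ∞) f) :
    ContDiff ℝ (⊤ : ℕ∞) (gradSq f) :=
  ContDiff.sum fun j _ => (contDiff_pd hf j).pow 2

lemma tsupport_pd_subset (f : Rn n → ℝ) (i : Fin n) : tsupport (pd i f) ⊆ tsupport f :=
  tsupport_fderiv_apply_subset ℝ _

lemma hasCompactSupport_of_zero {f g : Rn n → ℝ} (hf : HasCompactSupport f)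
    (h : ∀ x, x ∉ tsupport f → g x = 0) : HasCompactSupport g := by
  refine hf.of_isClosed_subset (isClosed_tsupport _) (closure_minimal (fun x hx => ?_)
    (isClosed_tsupport f))
  by_contra hxf
  exact hx (h x hxf)

lemma pd_eq_zero {f : Rn n → ℝ} {x : Rn n} (hx : x ∉ tsupport f) (i : Fin n) : pd i f x = 0 :=
  image_eq_zero_of_notMem_tsupport fun h => hx (tsupport_pd_subset f i h)

lemma hasCompactSupport_gradSq {f : Rn n → ℝ} (hf : HasCompactSupport f) :
    HasCompactSupport (gradSq f) :=
  hasCompactSupport_of_zero hf fun x hx => by simp [gradSq, pd_eq_zero hx]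

lemma pd_mul {f g : Rn n → ℝ} {x : Rn n} (hf : DifferentiableAt ℝ f x)
    (hg : DifferentiableAt ℝ g x) (i : Fin n) :
    pd i (fun x => f x * g x) x = f x * pd i g x + pd i f x * g x :=
  pd_smul hf hg i

lemma pd_sub {f g : Rn n → ℝ} {x : Rn n} (hf : DifferentiableAt ℝ f x)
    (hg : DifferentiableAt ℝ g x) (i : Fin n) :
    pd i (fun x => f x - g x) x = pd i f x - pd i g x := by
  rw [pd, fderiv_fun_sub hf hg]
  rfl

lemma pd_sum {ι : Type*} {s : Finset ι} {f : ι → Rn n → ℝ} {x : Rn n}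
    (hf : ∀ j ∈ s, DifferentiableAt ℝ (f j) x) (i : Fin n) :
    pd i (fun x => ∑ j ∈ s, f j x) x = ∑ j ∈ s, pd i (f j) x := by
  rw [pd, fderiv_fun_sum hf]
  simp [pd]

lemma pd_coord (i j : Fin n) (x : Rn n) : pd i (fun x => x j) x = if i = j then 1 else 0 := by
  have h : HasFDerivAt (fun x : Rn n => x j) (EuclideanSpace.proj (𝕜 := ℝ) j) x :=
    (EuclideanSpace.proj (𝕜 := ℝ) j).hasFDerivAt
  rw [pd, h.fderiv]
  simp [EuclideanSpace.basisFun_apply, eq_comm]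

lemma pd_comm {f : Rn n → ℝ} (hf : ContDiff ℝ (⊤ : ℕ∞) f) (i j : Fin n) (x : Rn n) :
    pd i (pd j f) x = pd j (pd i f) x := by
  have h1 : ∀ i j : Fin n, pd i (pd j f) x = fderiv ℝ (fderiv ℝ f) x
      (EuclideanSpace.basisFun (Fin n) ℝ i) (EuclideanSpace.basisFun (Fin n) ℝ j) := by
    intro i j
    have hd : DifferentiableAt ℝ (fderiv ℝ f) x :=
      (hf.fderiv_right (m := (⊤ : ℕ∞)) (by simp)).differentiable (by simp) x
    have h2 := hd.hasFDerivAt.clm_apply (hasFDerivAt_const (EuclideanSpace.basisFun (Fin n) ℝ j) x)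
    rw [pd, show pd j f = fun y => fderiv ℝ f y (EuclideanSpace.basisFun (Fin n) ℝ j) from rfl,
      h2.fderiv]
    simp
  have hs : IsSymmSndFDerivAt ℝ f x :=
    hf.contDiffAt.isSymmSndFDerivAt (by
      rw [minSmoothness_of_isRCLikeNormedField]
      exact WithTop.coe_le_coe.2 (le_top : (2 : ℕ∞) ≤ ⊤))
  rw [h1, h1, hs]

/-- The divergence of the vector field `2 (x·∇f) ∇f - |∇f|² x`. -/
lemma div_rellich_field {f : Rn n → ℝ} (hf : ContDiff ℝ (⊤ : ℕ∞) f) (x : Rn n) :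
    ∑ i, pd i (fun x => 2 * (euler f x * pd i f x) - x i * gradSq f x) x
      = 2 * euler f x * lap f x + (2 - n) * gradSq f x := by
  have d1 : ∀ i, DifferentiableAt ℝ (pd i f) x := fun i =>
    (contDiff_pd hf i).differentiable (by simp) x
  have d2 := (contDiff_euler hf).differentiable (by simp) x
  have d3 := (contDiff_gradSq hf).differentiable (by simp) x
  have d4 : ∀ i, DifferentiableAt ℝ (fun x : Rn n => x i) x := fun i =>
    (contDiff_coord i).differentiable (by simp) x
  have hE : ∀ i, pd i (euler f) x = pd i f x + ∑ j, x j * pd j (pd i f) x := by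
    intro i
    rw [show euler f = fun x => ∑ j, x j * pd j f x from rfl,
      pd_sum (fun j _ => (d4 j).fun_mul (d1 j))]
    simp only [pd_mul (d4 _) (d1 _), pd_coord, Finset.sum_add_distrib, pd_comm hf i]
    simp [add_comm]
  have hN : ∀ i, pd i (gradSq f) x = 2 * ∑ j, pd j f x * pd j (pd i f) x := by
    intro i
    rw [show gradSq f = fun x => ∑ j, pd j f x * pd j f x from by
        ext y; simp [gradSq, sq], pd_sum (fun j _ => (d1 j).fun_mul (d1 j)), Finset.mul_sum]
    refine Finset.sum_congr rfl fun j _ => ?_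
    rw [pd_mul (d1 j) (d1 j), pd_comm hf i j]
    ring
  have hG : ∀ i, pd i (fun x => 2 * (euler f x * pd i f x) - x i * gradSq f x) x
      = 2 * euler f x * pd i (pd i f) x + 2 * pd i f x ^ 2
        + 2 * ((∑ j, x j * pd j (pd i f) x) * pd i f x)
        - 2 * (x i * ∑ j, pd j f x * pd j (pd i f) x) - gradSq f x := by
    intro i
    have hc : pd i (fun _ : Rn n => (2 : ℝ)) x = 0 := by simp [pd]
    rw [pd_sub ((d2.fun_mul (d1 i)).const_mul 2) ((d4 i).fun_mul d3), pd_mul (d4 i) d3,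
      pd_mul (differentiableAt_const 2) (d2.fun_mul (d1 i)), pd_mul d2 (d1 i), hE, hN, pd_coord,
      hc, if_pos rfl]
    ring
  have hswap : ∑ i, (∑ j, x j * pd j (pd i f) x) * pd i f x
      = ∑ i, x i * ∑ j, pd j f x * pd j (pd i f) x := by
    simp only [Finset.sum_mul, Finset.mul_sum]
    rw [Finset.sum_comm]
    refine Finset.sum_congr rfl fun i _ => Finset.sum_congr rfl fun j _ => ?_
    rw [pd_comm hf i j]
    ring
  simp only [hG, Finset.sum_sub_distrib, Finset.sum_add_distrib, ← Finset.mul_sum]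
  rw [hswap]
  simp only [Finset.sum_const, Finset.card_univ, Fintype.card_fin, nsmul_eq_mul]
  rw [lap, gradSq]
  ring

/-- The divergence of the vector field `f ∇f`. -/
lemma div_mul_grad {f : Rn n → ℝ} (hf : ContDiff ℝ (⊤ : ℕ∞) f) (x : Rn n) :
    ∑ i, pd i (fun x => f x * pd i f x) x = gradSq f x + f x * lap f x := by
  have d1 : ∀ i, DifferentiableAt ℝ (pd i f) x := fun i =>
    (contDiff_pd hf i).differentiable (by simp) x
  have d0 : DifferentiableAt ℝ f x := hf.differentiable (by simp) x
  simp only [pd_mul d0 (d1 _), Finset.sum_add_distrib, lap, gradSq, Finset.mul_sum]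
  rw [add_comm]
  congr 1
  exact Finset.sum_congr rfl fun i _ => by ring

/-- Integration by parts of a radial function against the divergence of a test vector field. -/
lemma integral_radial_div (hn : 0 < n) {B B' : ℝ → ℝ}
    (hB : ∀ r, 0 ≤ r → HasDerivAt B (B' r) r) (hB' : ContinuousOn B' (Ici 0))
    {G : Fin n → Rn n → ℝ} (hG : ∀ i, ContDiff ℝ (⊤ : ℕ∞) (G i))
    (hGc : ∀ i, HasCompactSupport (G i)) :
    (Integrable fun x => B' ‖x‖ / ‖x‖ * ∑ i, x i * G i x) ∧
    (Integrable fun x => B ‖x‖ * ∑ i, pd i (G i) x) ∧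
    ∫ x, B ‖x‖ * ∑ i, pd i (G i) x = - ∫ x, B' ‖x‖ / ‖x‖ * ∑ i, x i * G i x := by
  have hBc : ContinuousOn B (Ici 0) := fun r hr => (hB r hr).continuousAt.continuousWithinAt
  have e1 : (fun x : Rn n => B' ‖x‖ / ‖x‖ * ∑ i, x i * G i x)
      = fun x => ∑ i, B' ‖x‖ * (x i / ‖x‖) * G i x := by
    ext x
    rw [Finset.mul_sum]
    exact Finset.sum_congr rfl fun i _ => by ring
  have e2 : (fun x : Rn n => B ‖x‖ * ∑ i, pd i (G i) x)
      = fun x => ∑ i, B ‖x‖ * pd i (G i) x := by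
    ext x
    rw [Finset.mul_sum]
  have i1 : ∀ i ∈ Finset.univ, Integrable fun x => B' ‖x‖ * (x i / ‖x‖) * G i x := fun i _ =>
    integrable_radial_coord_mul hB' (hG i).continuous (hGc i) i
  have i2 : ∀ i ∈ Finset.univ, Integrable fun x => B ‖x‖ * pd i (G i) x := fun i _ =>
    integrable_radial_mul hBc (contDiff_pd (hG i) i).continuous (hasCompactSupport_pd (hGc i) i)
  rw [e1, e2]
  refine ⟨integrable_finsetSum _ i1, integrable_finsetSum _ i2, ?_⟩
  rw [integral_finsetSum _ i1, integral_finsetSum _ i2, ← Finset.sum_neg_distrib]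
  refine Finset.sum_congr rfl fun i _ => ?_
  rw [integral_radial_deriv_mul hn hB hB' (hG i) (hGc i) i, neg_neg]

/-- The Rellich–Morawetz identity: the Laplacian paired with the radial multiplier
`2 b (r) x·∇f + c (r) f`. -/
lemma multiplier_identity (hn : 0 < n) {b b' c c' : ℝ → ℝ}
    (hb : ∀ r, 0 ≤ r → HasDerivAt b (b' r) r) (hb' : ContinuousOn b' (Ici 0))
    (hc : ∀ r, 0 ≤ r → HasDerivAt c (c' r) r) (hc' : ContinuousOn c' (Ici 0))
    {f : Rn n → ℝ} (hf : ContDiff ℝ (⊤ : ℕ∞) f) (hfc : HasCompactSupport f) :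
    (Integrable fun x => ((2 - n) * b ‖x‖ + c ‖x‖) * gradSq f x
      + b' ‖x‖ / ‖x‖ * (2 * euler f x ^ 2 - ‖x‖ ^ 2 * gradSq f x)
      + c' ‖x‖ / ‖x‖ * (f x * euler f x)) ∧
    (Integrable fun x => -lap f x * (2 * b ‖x‖ * euler f x + c ‖x‖ * f x)) ∧
    ∫ x, -lap f x * (2 * b ‖x‖ * euler f x + c ‖x‖ * f x)
      = ∫ x, (((2 - n) * b ‖x‖ + c ‖x‖) * gradSq f x
      + b' ‖x‖ / ‖x‖ * (2 * euler f x ^ 2 - ‖x‖ ^ 2 * gradSq f x)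
      + c' ‖x‖ / ‖x‖ * (f x * euler f x)) := by
  have hbc : ContinuousOn b (Ici 0) := fun r hr => (hb r hr).continuousAt.continuousWithinAt
  have hcc : ContinuousOn c (Ici 0) := fun r hr => (hc r hr).continuousAt.continuousWithinAt
  have sE := contDiff_euler hf
  have sN := contDiff_gradSq hf
  obtain ⟨i1, i2, I1⟩ := integral_radial_div hn hb hb'
    (G := fun i x => 2 * (euler f x * pd i f x) - x i * gradSq f x)
    (fun i => (contDiff_const.mul (sE.mul (contDiff_pd hf i))).sub ((contDiff_coord i).mul sN))
    (fun i => hasCompactSupport_of_zero hfc fun x hx => by simp [gradSq, pd_eq_zero hx])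
  obtain ⟨j1, j2, J1⟩ := integral_radial_div hn hc hc'
    (G := fun i x => f x * pd i f x)
    (fun i => hf.mul (contDiff_pd hf i))
    (fun i => hasCompactSupport_of_zero hfc fun x hx => by simp [pd_eq_zero hx])
  simp only [div_rellich_field hf] at i2 I1
  simp only [div_mul_grad hf] at j2 J1
  have e1 : ∀ x : Rn n, ∑ i, x i * (2 * (euler f x * pd i f x) - x i * gradSq f x)
      = 2 * euler f x ^ 2 - ‖x‖ ^ 2 * gradSq f x := by
    intro x
    rw [EuclideanSpace.norm_sq_eq, Finset.sum_mul]
    have : 2 * euler f x ^ 2 = ∑ i, 2 * (euler f x * (x i * pd i f x)) := by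
      rw [← Finset.mul_sum, ← Finset.mul_sum, sq]
      rfl
    rw [this, ← Finset.sum_sub_distrib]
    refine Finset.sum_congr rfl fun i _ => ?_
    rw [Real.norm_eq_abs, sq_abs]
    ring
  have e2 : ∀ x : Rn n, ∑ i, x i * (f x * pd i f x) = f x * euler f x := by
    intro x
    rw [euler, Finset.mul_sum]
    exact Finset.sum_congr rfl fun i _ => by ring
  simp only [e1] at i1 I1
  simp only [e2] at j1 J1
  have k1 := integrable_radial_mul hbc sN.continuous (hasCompactSupport_gradSq hfc)
  have k2 := integrable_radial_mul hcc sN.continuous (hasCompactSupport_gradSq hfc)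
  have E1 : (fun x => ((2 - n) * b ‖x‖ + c ‖x‖) * gradSq f x
      + b' ‖x‖ / ‖x‖ * (2 * euler f x ^ 2 - ‖x‖ ^ 2 * gradSq f x)
      + c' ‖x‖ / ‖x‖ * (f x * euler f x))
      = fun x => ((((2 - n) * (b ‖x‖ * gradSq f x)) + c ‖x‖ * gradSq f x)
      + b' ‖x‖ / ‖x‖ * (2 * euler f x ^ 2 - ‖x‖ ^ 2 * gradSq f x))
      + c' ‖x‖ / ‖x‖ * (f x * euler f x) := by
    ext x; ring
  have E2 : (fun x => -lap f x * (2 * b ‖x‖ * euler f x + c ‖x‖ * f x))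
      = fun x => ((((2 - n) * (b ‖x‖ * gradSq f x)) + c ‖x‖ * gradSq f x)
        - b ‖x‖ * (2 * euler f x * lap f x + (2 - n) * gradSq f x))
        - c ‖x‖ * (gradSq f x + f x * lap f x) := by
    ext x; ring
  rw [E1, E2]
  have k12 : Integrable fun x => (2 - n) * (b ‖x‖ * gradSq f x) + c ‖x‖ * gradSq f x :=
    (k1.const_mul (2 - n : ℝ)).add k2
  have k3 : Integrable fun x => (2 - n) * (b ‖x‖ * gradSq f x) + c ‖x‖ * gradSq f x
      + b' ‖x‖ / ‖x‖ * (2 * euler f x ^ 2 - ‖x‖ ^ 2 * gradSq f x) := k12.add i1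
  have k4 : Integrable fun x => (2 - n) * (b ‖x‖ * gradSq f x) + c ‖x‖ * gradSq f x
      - b ‖x‖ * (2 * euler f x * lap f x + (2 - n) * gradSq f x) := k12.sub i2
  refine ⟨k3.add j1, k4.sub j2, ?_⟩
  rw [integral_add k3 j1, integral_add k12 i1, integral_sub k4 j2, integral_sub k12 i2, I1, J1]
  ring

/-- Green's identity `∫ |∇f|² = - ∫ f Δf`. -/
lemma integral_gradSq (hn : 0 < n) {f : Rn n → ℝ} (hf : ContDiff ℝ (⊤ : ℕ∞) f)
    (hfc : HasCompactSupport f) : ∫ x, gradSq f x = ∫ x, -lap f x * f x := by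
  have h := (multiplier_identity hn (b := fun _ => 0) (b' := fun _ => 0) (c := fun _ => 1)
    (c' := fun _ => 0) (fun r _ => hasDerivAt_const r 0) continuousOn_const
    (fun r _ => hasDerivAt_const r 1) continuousOn_const hf hfc).2.2
  simp only [mul_zero, zero_mul, zero_add, one_mul, zero_div, add_zero] at h
  exact h.symm

end Multiplier

end SemiclassicalResolvent

/-! ### Pointwise positivity of the conjugated commutator -/

namespace SemiclassicalResolvent

/-- The algebraic identity behind the Carleman estimate. Here `N` stands for `|∇f|²`, `fr` for
`∂ᵣ f`, `p = φ'/h`, `M = μ/r`, `n = 2k + 1`, and `t = ∂ᵣ f + (p + k/r) f` is the radial derivative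
of the conjugated function. The last summand of the left-hand side is the expression whose integral
is controlled by integrating by parts along rays. -/
lemma carleman_identity {h E VL VS r e p p' k M μ' N f fr D : ℝ} (hr : r ≠ 0) :
    h ^ 2 * (((2 - (2 * k + 1)) * (e * M) + e * (2 * p * (r * M) + 2 * k * M)) * N
      + e * (2 * p * M + (μ' - M) / r) / r * (2 * (r * fr) ^ 2 - r ^ 2 * N)
      + e * (2 * p * (2 * p * (r * M) + 2 * k * M) + 2 * p' * (r * M) + 2 * p * μ'
        + 2 * k * ((μ' - M) / r)) / r * (f * (r * fr)))
      + (VL + VS - E) * f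
        * (2 * (e * M) * (r * fr) + e * (2 * p * (r * M) + 2 * k * M) * f)
      + (2 * (h ^ 2 * (e * (r * M * (k / r ^ 2 + 2 * p * (p + k / r)))) + E * (e * (r * M))
          - e * (r * M) * VL) * (f * fr)
        + (h ^ 2 * (e * (2 * p * (r * M * (k / r ^ 2 + 2 * p * (p + k / r)))
            + μ' * (k / r ^ 2 + 2 * p * (p + k / r))
            + r * M * (-2 * k / r ^ 3 + 2 * p' * (p + k / r) + 2 * p * (p' - k / r ^ 2))
            + 2 * k * (r * M * (k / r ^ 2 + 2 * p * (p + k / r))) / r))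
          + (E - VL) * (e * (2 * p * (r * M) + μ' + 2 * k * M)) - e * (r * M) * D) * f ^ 2)
    = e * ((2 * M - μ') * h ^ 2 * (N - fr ^ 2)
        + (h ^ 2 * μ' + 4 * h * (h * p) * (r * M)) * (fr + (p + k / r) * f) ^ 2
        + 2 * h * (r * M) * (h * p') * f * (fr + (p + k / r) * f)
        + 2 * VS * (r * M) * f * (fr + (p + k / r) * f)
        + ((h * p) ^ 2 * μ' + 2 * (r * M) * (h * p) * (h * p') + (E - VL) * μ' - r * M * D) * f ^ 2
        + h ^ 2 * (k ^ 2 - k) * (2 * M - μ') / r ^ 2 * f ^ 2) := by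
  field_simp
  ring

/-- Completing squares: the terms of first order in `t` are absorbed by the two quadratic terms.
The short-range term can be absorbed in two ways, used in different regions. -/
lemma carleman_absorb {h E VS φ₁ φ₂ μ μ' f t w G Z : ℝ} (hh : 0 < h) (hφ : 0 < φ₁)
    (hμ : 0 ≤ μ) (hμ' : 0 < μ')
    (hZ : E / 4 * μ' + h * φ₂ ^ 2 * μ / (2 * φ₁) + VS ^ 2 * μ / (2 * h * φ₁) ≤ Z ∨
      E / 4 * μ' + h * φ₂ ^ 2 * μ / (2 * φ₁) + 2 * VS ^ 2 * μ ^ 2 / (h ^ 2 * μ') ≤ Z) :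
    E / 4 * μ' * f ^ 2 - 2 * μ ^ 2 * w ^ 2 / (h ^ 2 * μ') * G ^ 2 + 2 * w * G * μ * t
      ≤ (h ^ 2 * μ' + 4 * h * φ₁ * μ) * t ^ 2 + 2 * h * μ * φ₂ * f * t + 2 * VS * μ * f * t
        + Z * f ^ 2 := by
  have q1 : 0 ≤ 2 * h * φ₁ * μ * t ^ 2 + 2 * h * μ * φ₂ * f * t
      + h * φ₂ ^ 2 * μ / (2 * φ₁) * f ^ 2 := by
    have : 2 * h * φ₁ * μ * t ^ 2 + 2 * h * μ * φ₂ * f * t + h * φ₂ ^ 2 * μ / (2 * φ₁) * f ^ 2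
        = h * μ / (2 * φ₁) * (2 * φ₁ * t + φ₂ * f) ^ 2 := by
      field_simp
      ring
    rw [this]
    positivity
  have q3 : 0 ≤ h ^ 2 * μ' / 2 * t ^ 2 - 2 * w * G * μ * t
      + 2 * μ ^ 2 * w ^ 2 / (h ^ 2 * μ') * G ^ 2 := by
    have : h ^ 2 * μ' / 2 * t ^ 2 - 2 * w * G * μ * t + 2 * μ ^ 2 * w ^ 2 / (h ^ 2 * μ') * G ^ 2
        = 1 / (2 * h ^ 2 * μ') * (h ^ 2 * μ' * t - 2 * w * G * μ) ^ 2 := by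
      field_simp
      ring
    rw [this]
    positivity
  rcases hZ with hZ | hZ
  · have q2 : 0 ≤ 2 * h * φ₁ * μ * t ^ 2 + 2 * VS * μ * f * t
        + VS ^ 2 * μ / (2 * h * φ₁) * f ^ 2 := by
      have : 2 * h * φ₁ * μ * t ^ 2 + 2 * VS * μ * f * t + VS ^ 2 * μ / (2 * h * φ₁) * f ^ 2
          = μ / (2 * h * φ₁) * (2 * h * φ₁ * t + VS * f) ^ 2 := by
        field_simp
        ring
      rw [this]
      positivity
    have q4 : 0 ≤ h ^ 2 * μ' / 2 * t ^ 2 := by positivity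
    have q5 := mul_le_mul_of_nonneg_right hZ (sq_nonneg f)
    linarith
  · have q2 : 0 ≤ h ^ 2 * μ' / 2 * t ^ 2 + 2 * VS * μ * f * t
        + 2 * VS ^ 2 * μ ^ 2 / (h ^ 2 * μ') * f ^ 2 := by
      have : h ^ 2 * μ' / 2 * t ^ 2 + 2 * VS * μ * f * t
          + 2 * VS ^ 2 * μ ^ 2 / (h ^ 2 * μ') * f ^ 2
          = 1 / (2 * h ^ 2 * μ') * (h ^ 2 * μ' * t + 2 * VS * μ * f) ^ 2 := by
        field_simp
        ring
      rw [this]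
      positivity
    have q4 : 0 ≤ 2 * h * φ₁ * μ * t ^ 2 := by positivity
    have q5 := mul_le_mul_of_nonneg_right hZ (sq_nonneg f)
    linarith

/-- The quotient `μ/μ'` for the weight `μ = ν (q² - 1)`, `μ' = (2ν/q) (q² + y)/(1 + y)`. -/
lemma weight_quotient {q y : ℝ} (hq : 1 ≤ q) (hy : 0 ≤ y) :
    0 ≤ q * (q ^ 2 - 1) * (1 + y) / (2 * (q ^ 2 + y)) ∧
    q * (q ^ 2 - 1) * (1 + y) / (2 * (q ^ 2 + y)) ≤ q * (1 + y) / 2 := by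
  have hq2 : 1 ≤ q ^ 2 := by nlinarith
  constructor
  · have : 0 ≤ q ^ 2 - 1 := by linarith
    positivity
  · rw [div_le_div_iff₀ (by positivity) (by norm_num)]
    have : 0 ≤ q * (1 + y) := by positivity
    nlinarith [mul_nonneg this (by linarith : (0 : ℝ) ≤ y + 1)]

/-- Lower bound for `(μ φ'²)' / μ' = φ₁² + 2 φ₁ φ₂ P`, where `φ₁ = φ'` and `φ₂ = φ''`. -/
lemma deriv_weight_phase_lower {q y a η κ P φ₁ φ₂ : ℝ} (hq : 1 ≤ q) (hy : 0 ≤ y) (hκ : 0 < κ)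
    (ha0 : 0 ≤ a) (ha1 : a ≤ 1) (haη : a ≤ q * η) (hyq : y ≤ q * η)
    (hP : P = q * (q ^ 2 - 1) * (1 + y) / (2 * (q ^ 2 + y)))
    (hφpos : 0 < φ₁) (hφle : φ₁ ≤ κ / q) (hφ₂ : φ₂ = -φ₁ * ((1 + a) / q)) :
    φ₁ ^ 2 / q ^ 2 - 3 * κ ^ 2 * η ≤ φ₁ ^ 2 + 2 * φ₁ * φ₂ * P := by
  have hq0 : 0 < q := by linarith
  have hq2 : 1 ≤ q ^ 2 := by nlinarith
  have hη0 : 0 ≤ η := by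
    by_contra hneg
    nlinarith
  have e1 : 2 * φ₁ * φ₂ * P = -φ₁ ^ 2 * ((1 + a) * (1 + y) * ((q ^ 2 - 1) / (q ^ 2 + y))) := by
    have h0 : q ^ 2 + y ≠ 0 := by positivity
    have h1 : P * 2 * (q ^ 2 + y) = q * (q ^ 2 - 1) * (1 + y) := by
      rw [hP]; field_simp
    have h2 : φ₂ * q = -φ₁ * (1 + a) := by
      rw [hφ₂]; field_simp
    rw [← mul_div_assoc, ← mul_div_assoc, eq_div_iff h0]
    apply mul_left_cancel₀ hq0.ne'
    linear_combination (φ₁ * φ₂ * q) * h1 + (φ₁ * q * (q ^ 2 - 1) * (1 + y)) * h2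
  have e2 : (q ^ 2 - 1) / (q ^ 2 + y) ≤ 1 - 1 / q ^ 2 := by
    rw [show 1 - 1 / q ^ 2 = (q ^ 2 - 1) / q ^ 2 by field_simp]
    have : 0 ≤ q ^ 2 - 1 := by linarith
    gcongr
    linarith
  have e3 : (1 + a) * (1 + y) * ((q ^ 2 - 1) / (q ^ 2 + y)) ≤ 1 - 1 / q ^ 2 + 3 * (q * η) := by
    have i1 : 0 ≤ (1 + a) * (1 + y) := by positivity
    have i2 : 0 ≤ 1 / q ^ 2 := by positivity
    have i3 : 0 ≤ a + y + a * y := by positivity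
    calc _ ≤ (1 + a) * (1 + y) * (1 - 1 / q ^ 2) := by gcongr
      _ = 1 - 1 / q ^ 2 + (a + y + a * y) * (1 - 1 / q ^ 2) := by ring
      _ ≤ 1 - 1 / q ^ 2 + (a + y + a * y) * 1 := by
        gcongr
        linarith
      _ ≤ _ := by
        have : a * y ≤ 1 * (q * η) := by gcongr
        linarith
  have e4 : φ₁ ^ 2 * (3 * (q * η)) ≤ 3 * κ ^ 2 * η := by
    calc φ₁ ^ 2 * (3 * (q * η)) ≤ (κ / q) ^ 2 * (3 * (q * η)) := by gcongr
      _ = 3 * κ ^ 2 * η / q := by field_simp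
      _ ≤ 3 * κ ^ 2 * η := div_le_self (by positivity) hq
  have e5 := mul_le_mul_of_nonneg_left e3 (sq_nonneg φ₁)
  rw [e1]
  have e6 : φ₁ ^ 2 * (1 - 1 / q ^ 2 + 3 * (q * η))
      = φ₁ ^ 2 - φ₁ ^ 2 / q ^ 2 + φ₁ ^ 2 * (3 * (q * η)) := by ring
  rw [e6] at e5
  linarith

/-- The main lower bound `(μ φ'²)' + (E - V_L) μ' - μ D ≥ (E/4) μ' + …` after division by `μ'`,
with `P = μ/μ'`. Near the origin, where `E - V_L` may be negative, the positive term
`φ'² / q²` of `(μ φ'²)' / μ'` is used; it also absorbs the short-range potential for `q ≤ A`. -/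
lemma carleman_positivity {h E VL VS q y η κ A C₃ C₄ K pm P φ₁ φ₂ D : ℝ}
    (hh : 0 < h) (hE : 0 < E) (hq : 1 ≤ q) (hy : 0 ≤ y) (hκ : 0 < κ) (hA : 1 ≤ A)
    (hC₃ : 0 ≤ C₃) (hK : 1 ≤ K)
    (hη1 : η ≤ 1) (hAη : 1 / A ≤ η) (hyq : y ≤ q * η) (hyA : q ≤ A → y ≤ 1)
    (hP : P = q * (q ^ 2 - 1) * (1 + y) / (2 * (q ^ 2 + y)))
    (hφ₁ : φ₁ = κ * (1 / q - 1 / (q + A))) (hφ₂ : φ₂ = -κ * (1 / q ^ 2 - 1 / (q + A) ^ 2))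
    (hD : D = C₃ / q ^ 3) (hVS : |VS| ≤ C₄ / q ^ 3) (hVL : VL ≤ pm) (hVLK : K ≤ q → VL ≤ E / 4)
    (hC₃K : C₃ / K ≤ E / 8) (hKA : K ≤ A) (hKκ : pm + C₃ ≤ κ ^ 2 / (8 * K ^ 4))
    (hκh : 8 * C₄ ^ 2 ≤ h * κ ^ 3)
    (hsmall : 3 * κ ^ 2 * η + 2 * h * κ + 2 * C₄ ^ 2 / (A ^ 2 * h ^ 2) ≤ E / 8) :
    0 < φ₁ ∧
    (E / 4 + h * φ₂ ^ 2 * P / (2 * φ₁) + VS ^ 2 * P / (2 * h * φ₁)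
        ≤ φ₁ ^ 2 + 2 * φ₁ * φ₂ * P + (E - VL) - P * D ∨
      E / 4 + h * φ₂ ^ 2 * P / (2 * φ₁) + 2 * VS ^ 2 * P ^ 2 / h ^ 2
        ≤ φ₁ ^ 2 + 2 * φ₁ * φ₂ * P + (E - VL) - P * D) := by
  have hq0 : 0 < q := by linarith
  have hA0 : 0 < A := by linarith
  have hq2 : 1 ≤ q ^ 2 := by nlinarith
  have hη0 : 0 < η := lt_of_lt_of_le (by positivity) hAη
  have hφ₁' : φ₁ = κ * A / (q * (q + A)) := by
    rw [hφ₁]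
    field_simp
    ring
  have hφpos : 0 < φ₁ := by rw [hφ₁']; positivity
  have hφle : φ₁ ≤ κ / q := by
    rw [hφ₁', div_le_div_iff₀ (by positivity) hq0]
    have : 0 ≤ κ * q * q := by positivity
    linarith
  have hφge : q ≤ A → κ / (2 * q) ≤ φ₁ := by
    intro hqA
    rw [hφ₁', div_le_div_iff₀ (by positivity) (by positivity)]
    have : 0 ≤ κ * q * (A - q) := mul_nonneg (by positivity) (by linarith)
    linarith
  obtain ⟨a, ha⟩ : ∃ a, a = q / (q + A) := ⟨_, rfl⟩
  have ha0 : 0 ≤ a := by rw [ha]; positivity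
  have ha1 : a ≤ 1 := by rw [ha, div_le_one (by positivity)]; linarith
  have haη : a ≤ q * η := by
    calc a ≤ q / A := by rw [ha]; gcongr; linarith
      _ = q * (1 / A) := by ring
      _ ≤ q * η := by gcongr
  have hφ₂' : φ₂ = -φ₁ * ((1 + a) / q) := by
    rw [hφ₂, hφ₁, ha]
    field_simp
    ring
  obtain ⟨hP0, hPle⟩ := weight_quotient hq hy
  rw [← hP] at hP0 hPle
  have hyq' : 1 + y ≤ 2 * q := by
    have : q * η ≤ q * 1 := by gcongr
    linarith
  have hPq : P ≤ q ^ 2 := by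
    calc P ≤ q * (1 + y) / 2 := hPle
      _ ≤ q * (2 * q) / 2 := by gcongr
      _ = q ^ 2 := by ring
  have m1 : φ₁ ^ 2 / q ^ 2 - 3 * κ ^ 2 * η ≤ φ₁ ^ 2 + 2 * φ₁ * φ₂ * P :=
    deriv_weight_phase_lower hq hy hκ ha0 ha1 haη hyq hP hφpos hφle hφ₂'
  -- the remaining error terms
  have m2 : P * D ≤ C₃ / q := by
    rw [hD]
    calc P * (C₃ / q ^ 3) ≤ q ^ 2 * (C₃ / q ^ 3) := by gcongr
      _ = C₃ / q := by field_simp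
  have m3 : h * φ₂ ^ 2 * P / (2 * φ₁) ≤ 2 * h * κ := by
    have e1 : h * φ₂ ^ 2 * P / (2 * φ₁) = h * φ₁ * ((1 + a) / q) ^ 2 * P / 2 := by
      rw [hφ₂']
      field_simp
    rw [e1]
    calc h * φ₁ * ((1 + a) / q) ^ 2 * P / 2 ≤ h * (κ / q) * (2 / q) ^ 2 * q ^ 2 / 2 := by
          gcongr
          linarith
      _ = 2 * h * κ / q := by field_simp
      _ ≤ 2 * h * κ := div_le_self (by positivity) hq
  have hVS2 : VS ^ 2 ≤ (C₄ / q ^ 3) ^ 2 := sq_le_sq' (by linarith [neg_abs_le VS])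
    (le_trans (le_abs_self VS) hVS)
  have hpos3 : 0 ≤ 2 * C₄ ^ 2 / (A ^ 2 * h ^ 2) := by positivity
  -- the region near the origin against the region where `V_L` is small
  have m4 : q ≤ A → 3 * E / 8 ≤ φ₁ ^ 2 / (2 * q ^ 2) + E - VL - C₃ / q - E / 8 := by
    intro hqA
    rcases le_total K q with hKq | hqK
    · have e1 := hVLK hKq
      have e2 : C₃ / q ≤ C₃ / K := by gcongr
      have e3 : 0 ≤ φ₁ ^ 2 / (2 * q ^ 2) := by positivity
      linarith
    · have e1 := hφge hqA
      have e2 : C₃ / q ≤ C₃ := div_le_self hC₃ hq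
      have e3 : κ ^ 2 / (8 * K ^ 4) ≤ φ₁ ^ 2 / (2 * q ^ 2) := by
        calc κ ^ 2 / (8 * K ^ 4) ≤ κ ^ 2 / (8 * q ^ 4) := by gcongr
          _ = (κ / (2 * q)) ^ 2 / (2 * q ^ 2) := by field_simp; ring
          _ ≤ _ := by gcongr
      linarith
  refine ⟨hφpos, ?_⟩
  rcases le_total q A with hqA | hAq
  · left
    have e1 := hφge hqA
    have e2 : P ≤ q := by
      calc P ≤ q * (1 + y) / 2 := hPle
        _ ≤ q * (1 + 1) / 2 := by gcongr; exact hyA hqA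
        _ = q := by ring
    have e3 : VS ^ 2 * P / (2 * h * φ₁) ≤ φ₁ ^ 2 / (2 * q ^ 2) := by
      rw [div_le_div_iff₀ (by positivity) (by positivity)]
      have e4 : (κ / (2 * q)) ^ 3 ≤ φ₁ ^ 3 := by gcongr
      have e5 : C₄ ^ 2 / q ^ 3 ≤ h * φ₁ ^ 3 := by
        calc C₄ ^ 2 / q ^ 3 = 8 * C₄ ^ 2 / (8 * q ^ 3) := by field_simp
          _ ≤ h * κ ^ 3 / (8 * q ^ 3) := by gcongr
          _ = h * (κ / (2 * q)) ^ 3 := by field_simp; ring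
          _ ≤ _ := by gcongr
      calc VS ^ 2 * P * (2 * q ^ 2) ≤ (C₄ / q ^ 3) ^ 2 * q * (2 * q ^ 2) := by gcongr
        _ = 2 * (C₄ ^ 2 / q ^ 3) := by field_simp
        _ ≤ 2 * (h * φ₁ ^ 3) := by gcongr
        _ = _ := by ring
    have e6 := m4 hqA
    have e7 : φ₁ ^ 2 / q ^ 2 = φ₁ ^ 2 / (2 * q ^ 2) + φ₁ ^ 2 / (2 * q ^ 2) := by field_simp; ring
    linarith
  · right
    have e1 : 2 * VS ^ 2 * P ^ 2 / h ^ 2 ≤ 2 * C₄ ^ 2 / (A ^ 2 * h ^ 2) := by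
      have e2 : VS ^ 2 * P ^ 2 ≤ C₄ ^ 2 / A ^ 2 := by
        calc VS ^ 2 * P ^ 2 ≤ (C₄ / q ^ 3) ^ 2 * (q ^ 2) ^ 2 := by gcongr
          _ = C₄ ^ 2 / q ^ 2 := by field_simp
          _ ≤ C₄ ^ 2 / A ^ 2 := by gcongr
      calc 2 * VS ^ 2 * P ^ 2 / h ^ 2 = 2 * (VS ^ 2 * P ^ 2) / h ^ 2 := by ring
        _ ≤ 2 * (C₄ ^ 2 / A ^ 2) / h ^ 2 := by gcongr
        _ = _ := by field_simp
    have e2 := hVLK (hKA.trans hAq)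
    have e3 : C₃ / q ≤ C₃ / K := by gcongr; exact hKA.trans hAq
    have e4 : 0 ≤ φ₁ ^ 2 / q ^ 2 := by positivity
    linarith

end SemiclassicalResolvent

/-! ### The radial weight and the phase -/

namespace SemiclassicalResolvent

/-- The radial weight `μ(r) = r M(r)`, where `M = (1 + (q/A)^ε)^{-2/ε} (r + 2)` and `q = 1 + r`:
it behaves like `q² - 1` for `q ≤ A` and is bounded, with `μ' ≳ q^{-1-ε}`, at infinity. The function
`M` itself is smooth up to `r = 0`, with derivative `dM`. -/
lemma exists_weight {A ε : ℝ} (hA : 1 ≤ A) (hε : 0 < ε) (hε1 : ε ≤ 1) :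
    ∃ M dM : ℝ → ℝ, (∀ r, 0 ≤ r → HasDerivAt M (dM r) r) ∧ ContinuousOn dM (Ici 0) ∧
      ∀ r, 0 ≤ r → ∃ y m : ℝ, 0 ≤ y ∧ y ≤ (1 + r) * A ^ (-ε) ∧ (1 + r ≤ A → y ≤ 1) ∧ 0 < m ∧
        r * dM r = m - M r ∧
        r * M r = (1 + r) * ((1 + r) ^ 2 - 1) * (1 + y) / (2 * ((1 + r) ^ 2 + y)) * m ∧
        m ≤ 2 * M r ∧ 0 ≤ M r ∧ r * M r ≤ A ^ 2 ∧ M r ≤ 2 * A ^ 2 ∧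
        2 ^ (-(2 / ε)) * (1 + r) ^ (-(1 + ε)) ≤ m := by
  have hA0 : 0 < A := by linarith
  let Y : ℝ → ℝ := fun r => ((1 + r) / A) ^ ε
  let N : ℝ → ℝ := fun r => (1 + Y r) ^ (-(2 / ε))
  have hY0 : ∀ r, 0 ≤ r → 0 < Y r := fun r hr => by positivity
  have hYc : ContinuousOn Y (Ici 0) := by
    refine ContinuousOn.rpow_const (by fun_prop) fun r hr => Or.inr hε.le
  have hNc : ContinuousOn N (Ici 0) :=
    ContinuousOn.rpow_const (continuousOn_const.add hYc) fun r hr =>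
      Or.inl (by have := hY0 r hr; positivity)
  have hYd : ∀ r, 0 ≤ r → HasDerivAt Y (ε * Y r / (1 + r)) r := by
    intro r hr
    have h1 : HasDerivAt (fun r : ℝ => (1 + r) / A) (1 / A) r :=
      ((hasDerivAt_id r).const_add 1).div_const A
    have h2 := h1.rpow_const (p := ε) (Or.inl (by positivity))
    convert h2 using 1
    rw [Real.rpow_sub_one (by positivity)]
    simp only [Y]
    field_simp
  have hNd : ∀ r, 0 ≤ r → HasDerivAt N (-(2 / (1 + r)) * (Y r / (1 + Y r)) * N r) r := by
    intro r hr
    have h0 := hY0 r hr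
    have h2 := ((hYd r hr).const_add 1).rpow_const (p := -(2 / ε)) (Or.inl (by positivity))
    convert h2 using 1
    rw [Real.rpow_sub_one (by positivity)]
    simp only [N]
    field_simp
  refine ⟨fun r => N r * (r + 2),
    fun r => -(2 / (1 + r)) * (Y r / (1 + Y r)) * N r * (r + 2) + N r, ?_, ?_, ?_⟩
  · intro r hr
    have := (hNd r hr).fun_mul ((hasDerivAt_id r).add_const 2)
    simpa using this
  · have h1 : ∀ r ∈ Ici (0 : ℝ), 1 + r ≠ 0 := fun r hr => by
      have : (0 : ℝ) ≤ r := hr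
      positivity
    have h2 : ∀ r ∈ Ici (0 : ℝ), 1 + Y r ≠ 0 := fun r hr => by
      have := hY0 r hr
      positivity
    fun_prop (disch := assumption)
  · intro r hr
    obtain ⟨q, hq⟩ : ∃ q, q = 1 + r := ⟨_, rfl⟩
    obtain ⟨y, hy⟩ : ∃ y, y = Y r := ⟨_, rfl⟩
    obtain ⟨ν, hν⟩ : ∃ ν, ν = N r := ⟨_, rfl⟩
    have hq1 : 1 ≤ q := by linarith
    have hq0 : 0 < q := by linarith
    have hy0 : 0 < y := hy ▸ hY0 r hr
    have hyq : y = q ^ ε * A ^ (-ε) := by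
      rw [hy, hq]
      simp only [Y]
      rw [Real.div_rpow (by positivity) hA0.le, Real.rpow_neg hA0.le, div_eq_mul_inv]
    have hνy : ν = (1 + y) ^ (-(2 / ε)) := by rw [hν, hy]
    have hν0 : 0 < ν := by rw [hνy]; positivity
    have hr' : r = q - 1 := by linarith
    have hyε : y ^ (2 / ε) = q ^ 2 / A ^ 2 := by
      rw [hyq, Real.mul_rpow (by positivity) (by positivity), ← Real.rpow_mul hq0.le,
        ← Real.rpow_mul hA0.le, show ε * (2 / ε) = (2 : ℕ) by field_simp; norm_num,
        show -ε * (2 / ε) = -(2 : ℕ) by field_simp; norm_num, Real.rpow_neg hA0.le,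
        Real.rpow_natCast, Real.rpow_natCast, div_eq_mul_inv]
    have hνq : ν * q ^ 2 ≤ A ^ 2 := by
      rw [hνy, Real.rpow_neg (by positivity), inv_mul_le_iff₀ (by positivity)]
      have : y ^ (2 / ε) ≤ (1 + y) ^ (2 / ε) := by gcongr; linarith
      rw [hyε, div_le_iff₀ (by positivity)] at this
      exact this
    beta_reduce
    rw [← hν, ← hy, ← hq]
    refine ⟨y, 2 * ν / q * ((q ^ 2 + y) / (1 + y)), hy0.le, ?_, ?_, by positivity, ?_, ?_, ?_, ?_,
      ?_, ?_, ?_⟩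
    · rw [hyq]
      gcongr
      calc q ^ ε ≤ q ^ (1 : ℝ) := Real.rpow_le_rpow_of_exponent_le hq1 hε1
        _ = q := Real.rpow_one q
    · intro hqA
      rw [hy]
      refine Real.rpow_le_one (by positivity) ?_ hε.le
      rw [← hq]
      exact (div_le_one hA0).2 hqA
    · rw [hr']
      field_simp
      ring
    · rw [hr']
      field_simp
      ring
    · have : 2 * ν / q * ((q ^ 2 + y) / (1 + y)) = 2 * ν * ((q ^ 2 + y) / (q * (1 + y))) := by
        field_simp
      rw [this, ← mul_assoc, hr']
      gcongr
      rw [div_le_iff₀ (by positivity)]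
      have h1 : 0 ≤ y * (q ^ 2 - 1) := mul_nonneg hy0.le (by nlinarith)
      have h2 : 0 ≤ q * y := by positivity
      nlinarith
    · positivity
    · have : r * (ν * (r + 2)) = ν * q ^ 2 - ν := by rw [hr']; ring
      rw [this]
      linarith
    · have : ν * (r + 2) ≤ 2 * (ν * q ^ 2) := by
        have h3 : r + 2 ≤ 2 * q ^ 2 := by nlinarith
        calc ν * (r + 2) ≤ ν * (2 * q ^ 2) := by gcongr
          _ = _ := by ring
      linarith
    · rcases le_total y 1 with hy1 | hy1
      · have h1 : (2 : ℝ) ^ (-(2 / ε)) ≤ ν := by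
          rw [hνy]
          refine Real.rpow_le_rpow_of_nonpos (by positivity) (by linarith) ?_
          rw [neg_nonpos]
          positivity
        have h2 : q ^ (-(1 + ε)) ≤ 1 / q := by
          rw [one_div, ← Real.rpow_neg_one]
          exact Real.rpow_le_rpow_of_exponent_le hq1 (by linarith)
        have h3 : 1 ≤ (q ^ 2 + y) / (1 + y) := by
          rw [one_le_div (by positivity)]
          nlinarith
        calc 2 ^ (-(2 / ε)) * q ^ (-(1 + ε)) ≤ ν * (1 / q) := by gcongr
          _ = ν / q * 1 := by ring
          _ ≤ 2 * ν / q * ((q ^ 2 + y) / (1 + y)) := by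
            gcongr
            linarith
      · have h1 : (2 : ℝ) ^ (-(2 / ε)) * (A ^ 2 / q ^ 2) ≤ ν := by
          calc (2 : ℝ) ^ (-(2 / ε)) * (A ^ 2 / q ^ 2) = (2 * y) ^ (-(2 / ε)) := by
                rw [Real.mul_rpow (by norm_num) hy0.le, Real.rpow_neg hy0.le, hyε, inv_div]
            _ ≤ ν := by
                rw [hνy]
                refine Real.rpow_le_rpow_of_nonpos (by positivity) (by linarith) ?_
                rw [neg_nonpos]
                positivity
        have h2 : q ^ 2 / (2 * q ^ ε) ≤ (q ^ 2 + y) / (1 + y) := by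
          have e1 : y ≤ q ^ ε := by
            rw [hyq]
            refine mul_le_of_le_one_right (by positivity) ?_
            exact Real.rpow_le_one_of_one_le_of_nonpos hA (by linarith)
          have e2 : 1 ≤ q ^ ε := Real.one_le_rpow hq1 hε.le
          have e3 : q ^ 2 ≤ q ^ 2 + y := by linarith
          have e4 : 1 + y ≤ 2 * q ^ ε := by linarith
          gcongr
        have h3 : q ^ (-(1 + ε)) = 1 / (q * q ^ ε) := by
          rw [Real.rpow_neg hq0.le, Real.rpow_add hq0, Real.rpow_one, one_div]
        have h4 : 1 ≤ A ^ 2 := one_le_pow₀ hA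
        rw [h3]
        calc 2 ^ (-(2 / ε)) * (1 / (q * q ^ ε)) ≤ 2 ^ (-(2 / ε)) * (A ^ 2 / (q * q ^ ε)) := by
              gcongr
          _ = 2 * (2 ^ (-(2 / ε)) * (A ^ 2 / q ^ 2)) / q * (q ^ 2 / (2 * q ^ ε)) := by
              field_simp
          _ ≤ 2 * ν / q * ((q ^ 2 + y) / (1 + y)) := by gcongr

/-- The phase `φ = κ (log q - log (q + A) + log (1 + A))`, `q = 1 + r`, entering through
`p = φ'/h`, its derivative `p'`, and the exponential weight `e = exp (2φ/h)`. -/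
lemma exists_phase {A κ h : ℝ} (hA : 1 ≤ A) (hκ : 0 < κ) (hh : 0 < h) :
    ∃ p p' e : ℝ → ℝ, (∀ r, 0 ≤ r → HasDerivAt p (p' r) r) ∧ ContinuousOn p' (Ici 0) ∧
      (∀ r, 0 ≤ r → HasDerivAt e (2 * p r * e r) r) ∧
      ∀ r, 0 ≤ r → h * p r = κ * (1 / (1 + r) - 1 / (1 + r + A)) ∧
        h * p' r = -κ * (1 / (1 + r) ^ 2 - 1 / (1 + r + A) ^ 2) ∧
        1 ≤ e r ∧ e r ≤ Real.exp (2 * κ / h * Real.log (1 + A)) := by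
  refine ⟨fun r => κ / h * (1 / (1 + r) - 1 / (1 + r + A)),
    fun r => -(κ / h) * (1 / (1 + r) ^ 2 - 1 / (1 + r + A) ^ 2),
    fun r => Real.exp (2 * κ / h * (Real.log (1 + r) - Real.log (1 + r + A) + Real.log (1 + A))),
    ?_, ?_, ?_, ?_⟩
  · intro r hr
    have h1 : HasDerivAt (fun r : ℝ => 1 / (1 + r)) (-1 / (1 + r) ^ 2) r := by
      simpa using ((hasDerivAt_id r).const_add 1).fun_inv (by simp; positivity)
    have h2 : HasDerivAt (fun r : ℝ => 1 / (1 + r + A)) (-1 / (1 + r + A) ^ 2) r := by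
      simpa using (((hasDerivAt_id r).const_add 1).add_const A).fun_inv (by simp; positivity)
    exact ((h1.fun_sub h2).const_mul (κ / h)).congr_deriv (by ring)
  · have h1 : ∀ r ∈ Ici (0 : ℝ), (1 + r) ^ 2 ≠ 0 := fun r hr => by
      have : (0 : ℝ) ≤ r := hr
      positivity
    have h2 : ∀ r ∈ Ici (0 : ℝ), (1 + r + A) ^ 2 ≠ 0 := fun r hr => by
      have : (0 : ℝ) ≤ r := hr
      positivity
    fun_prop (disch := assumption)
  · intro r hr
    have h1 : HasDerivAt (fun r : ℝ => Real.log (1 + r)) (1 / (1 + r)) r :=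
      ((hasDerivAt_id r).const_add 1).log (by simp; positivity)
    have h2 : HasDerivAt (fun r : ℝ => Real.log (1 + r + A)) (1 / (1 + r + A)) r :=
      (((hasDerivAt_id r).const_add 1).add_const A).log (by simp; positivity)
    convert (((h1.fun_sub h2).add_const (Real.log (1 + A))).const_mul (2 * κ / h)).exp using 1
    ring
  · intro r hr
    have h1 : 0 ≤ Real.log (1 + r) - Real.log (1 + r + A) + Real.log (1 + A) := by
      have : Real.log (1 + r + A) ≤ Real.log ((1 + r) * (1 + A)) :=
        Real.log_le_log (by positivity) (by nlinarith)
      rw [Real.log_mul (by positivity) (by positivity)] at this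
      linarith
    have h2 : Real.log (1 + r) ≤ Real.log (1 + r + A) :=
      Real.log_le_log (by positivity) (by linarith)
    refine ⟨by field_simp, by field_simp, ?_, ?_⟩
    · rw [Real.one_le_exp_iff]
      positivity
    · rw [Real.exp_le_exp]
      gcongr
      linarith

end SemiclassicalResolvent

/-! ### Integration along rays -/

namespace SemiclassicalResolvent

variable {n : ℕ}

lemma integral_subtype_volumeIoiPow (g : ℝ → ℝ) (m : ℕ) :
    ∫ r : Ioi (0 : ℝ), g r ∂(Measure.volumeIoiPow m) = ∫ r in Ioi (0 : ℝ), r ^ m * g r := by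
  simp only [Measure.volumeIoiPow, ENNReal.ofReal]
  rw [integral_withDensity_eq_integral_smul (measurable_subtype_coe.pow_const _).real_toNNReal,
    integral_subtype_comap measurableSet_Ioi fun a ↦ Real.toNNReal (a ^ m) • g a,
    setIntegral_congr_fun measurableSet_Ioi fun x hx ↦ ?_]
  rw [NNReal.smul_def, Real.coe_toNNReal _ (pow_nonneg hx.out.le _), smul_eq_mul]

lemma integrable_subtype_volumeIoiPow {g : ℝ → ℝ} {m : ℕ} :
    Integrable (fun r : Ioi (0 : ℝ) => g r) (Measure.volumeIoiPow m) ↔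
      IntegrableOn (fun r => r ^ m * g r) (Ioi 0) := by
  rw [integrableOn_iff_comap_subtypeVal measurableSet_Ioi, Function.comp_def,
    Measure.volumeIoiPow,
    integrable_withDensity_iff_integrable_smul' (by fun_prop) (by simp), integrable_congr]
  refine .of_forall ?_
  rintro ⟨x, hx : 0 < x⟩
  simp (disch := positivity) [ENNReal.toReal_ofReal]

/-- A function on `ℝⁿ` whose integrals along almost all rays, with the polar density `r^{n-1}`,
are nonpositive has a nonpositive integral. -/
lemma integral_nonpos_of_rays (hn : 0 < n) {F : Rn n → ℝ} (hF : Integrable F)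
    (h : ∀ᵐ ω : Metric.sphere (0 : Rn n) 1 ∂(volume : Measure (Rn n)).toSphere,
      IntegrableOn (fun r : ℝ => r ^ (n - 1) * F (r • (ω : Rn n))) (Ioi 0) →
      ∫ r in Ioi (0 : ℝ), r ^ (n - 1) * F (r • (ω : Rn n)) ≤ 0) :
    ∫ x, F x ≤ 0 := by
  have : Nonempty (Fin n) := ⟨⟨0, hn⟩⟩
  have hdim : Module.finrank ℝ (Rn n) = n := by simp
  have hmp := (volume : Measure (Rn n)).measurePreserving_homeomorphUnitSphereProd
  have hemb := (homeomorphUnitSphereProd (Rn n)).measurableEmbedding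
  rw [hdim] at hmp
  let G : Metric.sphere (0 : Rn n) 1 × Ioi (0 : ℝ) → ℝ := fun z => F ((z.2 : ℝ) • (z.1 : Rn n))
  have hG : ∀ x : ({(0 : Rn n)}ᶜ : Set (Rn n)), G (homeomorphUnitSphereProd (Rn n) x) = F x := by
    intro x
    have hx : ‖(x : Rn n)‖ ≠ 0 := norm_ne_zero_iff.2 x.2
    simp [G, smul_smul, hx]
  have hFi : Integrable (fun x : ({(0 : Rn n)}ᶜ : Set (Rn n)) => F x)
      ((volume : Measure (Rn n)).comap (↑)) := by
    have := hF.integrableOn (s := {(0 : Rn n)}ᶜ)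
    rwa [integrableOn_iff_comap_subtypeVal (measurableSet_singleton _).compl] at this
  have hGi : Integrable G ((volume : Measure (Rn n)).toSphere.prod (Measure.volumeIoiPow (n - 1))) := by
    rw [← hmp.integrable_comp_emb hemb]
    refine hFi.congr (Eventually.of_forall fun x => ?_)
    exact (hG x).symm
  have e1 : ∫ x, F x = ∫ z, G z ∂((volume : Measure (Rn n)).toSphere.prod
      (Measure.volumeIoiPow (n - 1))) := by
    rw [← hmp.integral_comp hemb]
    simp only [hG]
    rw [integral_subtype_comap (measurableSet_singleton _).compl, restrict_compl_singleton]
  rw [e1, integral_prod _ hGi]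
  refine integral_nonpos_of_ae ?_
  filter_upwards [h, hGi.prod_right_ae] with ω h1 h2
  have h3 := (integrable_subtype_volumeIoiPow (g := fun r => F (r • (ω : Rn n)))).1 h2
  exact (integral_subtype_volumeIoiPow (fun r => F (r • (ω : Rn n))) (n - 1)).trans_le (h1 h3)

/-- A property of almost every point can be checked on almost every ray. -/
lemma ae_of_ae_ray (hn : 0 < n) {P : Rn n → Prop}
    (h : ∀ᵐ ω : Metric.sphere (0 : Rn n) 1 ∂(volume : Measure (Rn n)).toSphere,
      ∀ r : ℝ, 0 < r → P (r • (ω : Rn n))) : ∀ᵐ x : Rn n, P x := by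
  have : Nonempty (Fin n) := ⟨⟨0, hn⟩⟩
  have hmp := (volume : Measure (Rn n)).measurePreserving_homeomorphUnitSphereProd
  have h1 : ∀ᵐ z : Metric.sphere (0 : Rn n) 1 × Ioi (0 : ℝ) ∂((volume : Measure (Rn n)).toSphere.prod
      (Measure.volumeIoiPow (Module.finrank ℝ (Rn n) - 1))), ∀ r : ℝ, 0 < r → P (r • (z.1 : Rn n)) :=
    Measure.quasiMeasurePreserving_fst.ae h
  have h2 := hmp.quasiMeasurePreserving.ae h1
  have h3 : ∀ᵐ x : ({(0 : Rn n)}ᶜ : Set (Rn n)) ∂(volume : Measure (Rn n)).comap (↑), P x := by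
    filter_upwards [h2] with x hx
    have hx0 : ‖(x : Rn n)‖ ≠ 0 := norm_ne_zero_iff.2 x.2
    have := hx ‖(x : Rn n)‖ (norm_pos_iff.2 x.2)
    simpa [smul_smul, hx0] using this
  rwa [← ae_restrict_iff_subtype (measurableSet_singleton _).compl, restrict_compl_singleton] at h3

/-- The one-dimensional inequality along a ray: `g = (T r^{m} - N W r^{m+1}) F²` vanishes at both
ends, and `W` only needs an upper bound on its right derivative since `N ≥ 0`. -/
lemma ray_flux_nonpos {m : ℕ} (hm : m ≠ 0) {R : ℝ} (hR : 0 ≤ R)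
    {T T' N N' F F' W D : ℝ → ℝ}
    (hT : ∀ r, 0 ≤ r → HasDerivAt T (T' r) r) (hN : ∀ r, 0 ≤ r → HasDerivAt N (N' r) r)
    (hN0 : ∀ r, 0 ≤ r → 0 ≤ N r)
    (hF : ∀ r, 0 ≤ r → HasDerivAt F (F' r) r) (hFR : F R = 0)
    (hW : ContinuousOn W (Ici 0))
    (hWd : ∀ r, 0 < r → ∃ d, d ≤ D r ∧ HasDerivWithinAt W d (Ioi r) r)
    (hi : IntegrableOn (fun r => r ^ (m + 1) * (2 * (T r / r - N r * W r) * F r * F' r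
      + (T' r / r - T r / r ^ 2 + (m + 1) * T r / r ^ 2 - N' r * W r - N r * D r
        - (m + 1) * N r * W r / r) * F r ^ 2)) (Icc 0 R)) :
    ∫ r in (0)..R, r ^ (m + 1) * (2 * (T r / r - N r * W r) * F r * F' r
      + (T' r / r - T r / r ^ 2 + (m + 1) * T r / r ^ 2 - N' r * W r - N r * D r
        - (m + 1) * N r * W r / r) * F r ^ 2) ≤ 0 := by
  choose! d hd1 hd2 using hWd
  have hc : ∀ {u u' : ℝ → ℝ}, (∀ r, 0 ≤ r → HasDerivAt u (u' r) r) → ContinuousOn u (Icc 0 R) :=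
    fun h r hr => (h r hr.1).continuousAt.continuousWithinAt
  have key := intervalIntegral.integral_le_sub_of_hasDeriv_right_of_le
    (g := fun r => (T r * r ^ m - N r * W r * r ^ (m + 1)) * F r ^ 2)
    (g' := fun r => ((T' r * r ^ m + T r * (m * r ^ (m - 1)))
      - ((N' r * W r + N r * d r) * r ^ (m + 1) + N r * W r * ((m + 1 : ℕ) * r ^ m))) * F r ^ 2
      + (T r * r ^ m - N r * W r * r ^ (m + 1)) * (2 * F r * F' r)) hR ?_ ?_ hi ?_
  · refine key.trans_eq ?_
    simp [hFR, hm]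
  · have := hW.mono ((Icc_subset_Ici_self : Icc 0 R ⊆ Ici 0))
    have h1 := hc hT
    have h2 := hc hN
    have h3 := hc hF
    fun_prop
  · intro r hr
    have h1 := (hT r hr.1.le).hasDerivWithinAt (s := Ioi r)
    have h2 := (hN r hr.1.le).hasDerivWithinAt (s := Ioi r)
    have h3 := (hF r hr.1.le).hasDerivWithinAt (s := Ioi r)
    have h4 := fun k : ℕ => (hasDerivAt_pow k r).hasDerivWithinAt (s := Ioi r)
    have h5 := ((h1.fun_mul (h4 m)).fun_sub ((h2.fun_mul (hd2 r hr.1)).fun_mul (h4 (m + 1)))).fun_mul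
      (h3.fun_pow 2)
    refine h5.congr_deriv ?_
    simp
  · intro r hr
    have hr0 : 0 < r := hr.1
    have e1 : r ^ m = r * r ^ (m - 1) := by
      rw [← pow_succ', Nat.sub_add_cancel (Nat.one_le_iff_ne_zero.2 hm)]
    have e2 : N r * d r * r ^ (m + 1) * F r ^ 2 ≤ N r * D r * r ^ (m + 1) * F r ^ 2 := by
      have := hN0 r hr0.le
      have := hd1 r hr0
      gcongr
    have e3 : r ^ (m + 1) * (2 * (T r / r - N r * W r) * F r * F' r
      + (T' r / r - T r / r ^ 2 + (m + 1) * T r / r ^ 2 - N' r * W r - N r * D r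
        - (m + 1) * N r * W r / r) * F r ^ 2)
      = ((T' r * r ^ m + T r * (m * r ^ (m - 1)))
      - ((N' r * W r + N r * D r) * r ^ (m + 1) + N r * W r * ((m + 1 : ℕ) * r ^ m))) * F r ^ 2
      + (T r * r ^ m - N r * W r * r ^ (m + 1)) * (2 * F r * F' r) := by
      rw [pow_succ r m, e1]
      push_cast
      field_simp
      ring
    rw [e3]
    linarith

lemma integrable_norm_inv_sq_mul (hn : 3 ≤ n) {g : Rn n → ℝ} (hg : Continuous g)
    (hgc : HasCompactSupport g) : Integrable fun x => (‖x‖ ^ 2)⁻¹ * g x := by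
  have : Nonempty (Fin n) := ⟨⟨0, by lia⟩⟩
  obtain ⟨R, hR⟩ := hgc.isCompact.isBounded.subset_ball (0 : Rn n)
  have h1 : IntegrableOn (fun x : Rn n => (‖x‖ ^ 2)⁻¹) (Metric.ball 0 R) := by
    rw [integrableOn_fun_norm_addHaar (volume : Measure (Rn n)) (f := fun r => (r ^ 2)⁻¹)]
    have h2 : IntegrableOn (fun r : ℝ => r ^ (n - 3)) (Ioo 0 R) :=
      ((continuous_pow (n - 3)).continuousOn.integrableOn_Icc).mono_set Ioo_subset_Icc_self
    refine h2.congr_fun (fun r hr => ?_) measurableSet_Ioo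
    have hr0 : r ≠ 0 := hr.1.ne'
    simp only [finrank_euclideanSpace, Fintype.card_fin, smul_eq_mul]
    rw [show n - 1 = n - 3 + 2 by lia, pow_add, mul_assoc, mul_inv_cancel₀ (pow_ne_zero 2 hr0),
      mul_one]
  obtain ⟨C, hC⟩ := hgc.exists_bound_of_continuous hg
  have h2 : IntegrableOn (fun x : Rn n => (‖x‖ ^ 2)⁻¹ * g x) (Metric.ball 0 R) :=
    h1.mul_bdd (c := C) hg.aestronglyMeasurable (Eventually.of_forall hC)
  rwa [integrableOn_iff_integrable_of_support_subset] at h2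
  intro x hx
  refine hR (subset_tsupport g ?_)
  exact right_ne_zero_of_mul hx

/-- Integration by parts along rays of `∂ᵣ (S f²)`, where `S = T/r - N W`, `T`, `N` are smooth
radial functions and the rough function `W` satisfies `∂ᵣ W ≤ D` on almost every ray. -/
lemma radial_flux_nonpos (hn : 3 ≤ n) {T T' N N' D : ℝ → ℝ}
    (hT : ∀ r, 0 ≤ r → HasDerivAt T (T' r) r) (hT' : ContinuousOn T' (Ici 0))
    (hN : ∀ r, 0 ≤ r → HasDerivAt N (N' r) r) (hN' : ContinuousOn N' (Ici 0))
    (hN0 : ∀ r, 0 ≤ r → 0 ≤ N r) (hD : ContinuousOn D (Ici 0))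
    {W : Rn n → ℝ} (hWm : AEStronglyMeasurable W volume) {B : ℝ} (hWB : ∀ᵐ x, |W x| ≤ B)
    (hW : ∀ᵐ ω : Metric.sphere (0 : Rn n) 1 ∂(volume : Measure (Rn n)).toSphere,
      ContinuousOn (fun r : ℝ => W (r • (ω : Rn n))) (Ici 0) ∧
      ∀ r : ℝ, 0 < r → ∃ d, d ≤ D r ∧
        HasDerivWithinAt (fun r : ℝ => W (r • (ω : Rn n))) d (Ioi r) r)
    {f : Rn n → ℝ} (hf : ContDiff ℝ (⊤ : ℕ∞) f) (hfc : HasCompactSupport f) :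
    (Integrable fun x : Rn n => 2 * (T ‖x‖ / ‖x‖ - N ‖x‖ * W x) * f x * (euler f x / ‖x‖)
      + (T' ‖x‖ / ‖x‖ - T ‖x‖ / ‖x‖ ^ 2 + (n - 1) * T ‖x‖ / ‖x‖ ^ 2 - N' ‖x‖ * W x
        - N ‖x‖ * D ‖x‖ - (n - 1) * N ‖x‖ * W x / ‖x‖) * f x ^ 2) ∧
    ∫ x : Rn n, (2 * (T ‖x‖ / ‖x‖ - N ‖x‖ * W x) * f x * (euler f x / ‖x‖)
      + (T' ‖x‖ / ‖x‖ - T ‖x‖ / ‖x‖ ^ 2 + (n - 1) * T ‖x‖ / ‖x‖ ^ 2 - N' ‖x‖ * W x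
        - N ‖x‖ * D ‖x‖ - (n - 1) * N ‖x‖ * W x / ‖x‖) * f x ^ 2) ≤ 0 := by
  have : Nonempty (Fin n) := ⟨⟨0, by lia⟩⟩
  have cT : Continuous fun x : Rn n => T ‖x‖ :=
    continuous_comp_norm fun r hr => (hT r hr).continuousAt.continuousWithinAt
  have cN : Continuous fun x : Rn n => N ‖x‖ :=
    continuous_comp_norm fun r hr => (hN r hr).continuousAt.continuousWithinAt
  have cT' : Continuous fun x : Rn n => T' ‖x‖ := continuous_comp_norm hT'
  have cN' : Continuous fun x : Rn n => N' ‖x‖ := continuous_comp_norm hN'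
  have cD : Continuous fun x : Rn n => D ‖x‖ := continuous_comp_norm hD
  have cE := (contDiff_euler hf).continuous
  have cf := hf.continuous
  have hi : Integrable fun x : Rn n => 2 * (T ‖x‖ / ‖x‖ - N ‖x‖ * W x) * f x * (euler f x / ‖x‖)
      + (T' ‖x‖ / ‖x‖ - T ‖x‖ / ‖x‖ ^ 2 + (n - 1) * T ‖x‖ / ‖x‖ ^ 2 - N' ‖x‖ * W x
        - N ‖x‖ * D ‖x‖ - (n - 1) * N ‖x‖ * W x / ‖x‖) * f x ^ 2 := by
    have i1 : Integrable fun x : Rn n => (‖x‖ ^ 2)⁻¹ * (2 * T ‖x‖ * f x * euler f x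
        + (‖x‖ * T' ‖x‖ + (n - 2) * T ‖x‖ - ‖x‖ ^ 2 * N ‖x‖ * D ‖x‖) * f x ^ 2) :=
      integrable_norm_inv_sq_mul hn
        ((((continuous_const.mul cT).mul cf).mul cE).add ((((continuous_norm.mul cT').add
          (continuous_const.mul cT)).sub (((continuous_norm.pow 2).mul cN).mul cD)).mul (cf.pow 2)))
        (hasCompactSupport_of_zero hfc fun x hx => by
        simp [image_eq_zero_of_notMem_tsupport hx])
    have i2 : Integrable fun x : Rn n => (‖x‖ ^ 2)⁻¹ * (-2 * ‖x‖ * N ‖x‖ * f x * euler f x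
        - (‖x‖ ^ 2 * N' ‖x‖ + (n - 1) * ‖x‖ * N ‖x‖) * f x ^ 2) :=
      integrable_norm_inv_sq_mul hn
        (((((continuous_const.mul continuous_norm).mul cN).mul cf).mul cE).sub
          ((((continuous_norm.pow 2).mul cN').add
            ((continuous_const.mul continuous_norm).mul cN)).mul (cf.pow 2)))
        (hasCompactSupport_of_zero hfc fun x hx => by
        simp [image_eq_zero_of_notMem_tsupport hx])
    refine (i1.add (i2.bdd_mul (c := B) hWm hWB)).congr ?_
    filter_upwards [compl_mem_ae_iff.2 (measure_singleton (0 : Rn n))] with x hx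
    have hx0 : ‖x‖ ≠ 0 := norm_ne_zero_iff.2 hx
    simp only [Pi.add_apply]
    field_simp
    ring
  refine ⟨hi, integral_nonpos_of_rays (by lia) hi ?_⟩
  obtain ⟨R, hR0, hR⟩ : ∃ R : ℝ, 0 < R ∧ ∀ x : Rn n, R ≤ ‖x‖ → x ∉ tsupport f := by
    obtain ⟨R, hR⟩ := hfc.isCompact.isBounded.subset_ball (0 : Rn n)
    refine ⟨|R| + 1, by positivity, fun x hx hx' => ?_⟩
    have := hR hx'
    rw [mem_ball_zero_iff] at this
    linarith [le_abs_self R]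
  filter_upwards [hW] with ω hω hint
  have hωn : ‖(ω : Rn n)‖ = 1 := by simp
  have hnorm : ∀ r : ℝ, 0 ≤ r → ‖r • (ω : Rn n)‖ = r := fun r hr => by
    rw [norm_smul, hωn, mul_one, Real.norm_of_nonneg hr]
  obtain ⟨m, rfl⟩ : ∃ m, n = m + 2 := ⟨n - 2, by lia⟩
  have e1 : ∀ r ∈ Ioi (0 : ℝ), r ^ (m + 2 - 1) * (2 * (T ‖r • (ω : Rn (m + 2))‖ /
      ‖r • (ω : Rn (m + 2))‖ - N ‖r • (ω : Rn (m + 2))‖ * W (r • ω)) * f (r • ω) *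
        (euler f (r • ω) / ‖r • (ω : Rn (m + 2))‖)
      + (T' ‖r • (ω : Rn (m + 2))‖ / ‖r • (ω : Rn (m + 2))‖
        - T ‖r • (ω : Rn (m + 2))‖ / ‖r • (ω : Rn (m + 2))‖ ^ 2
        + (((m + 2 : ℕ) : ℝ) - 1) * T ‖r • (ω : Rn (m + 2))‖ / ‖r • (ω : Rn (m + 2))‖ ^ 2
        - N' ‖r • (ω : Rn (m + 2))‖ * W (r • ω)
        - N ‖r • (ω : Rn (m + 2))‖ * D ‖r • (ω : Rn (m + 2))‖
        - (((m + 2 : ℕ) : ℝ) - 1) * N ‖r • (ω : Rn (m + 2))‖ * W (r • ω)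
          / ‖r • (ω : Rn (m + 2))‖) * f (r • ω) ^ 2)
      = r ^ (m + 1) * (2 * (T r / r - N r * W (r • ω)) * f (r • ω) * fderiv ℝ f (r • ω) ω
      + (T' r / r - T r / r ^ 2 + (m + 1) * T r / r ^ 2 - N' r * W (r • ω) - N r * D r
        - (m + 1) * N r * W (r • ω) / r) * f (r • ω) ^ 2) := by
    intro r hr
    have hr0 : r ≠ 0 := (mem_Ioi.1 hr).ne'
    have h1 : (((m + 2 : ℕ) : ℝ) - 1) = m + 1 := by push_cast; ring
    have h2 : euler f (r • (ω : Rn (m + 2))) / r = fderiv ℝ f (r • ω) ω := by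
      rw [euler_eq_fderiv, map_smul, smul_eq_mul, mul_div_cancel_left₀ _ hr0]
    rw [hnorm r (mem_Ioi.1 hr).le, h1, h2, show m + 2 - 1 = m + 1 by lia]
  rw [integrableOn_congr_fun e1 measurableSet_Ioi] at hint
  rw [setIntegral_congr_fun measurableSet_Ioi e1]
  have e2 := ray_flux_nonpos (m := m) (by lia) hR0.le (W := fun r => W (r • (ω : Rn (m + 2))))
    (F := fun r => f (r • (ω : Rn (m + 2)))) (F' := fun r => fderiv ℝ f (r • ω) ω) hT hN hN0
    (fun r _ => ?_) (image_eq_zero_of_notMem_tsupport (hR _ (hnorm R hR0.le).ge)) hω.1 hω.2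
    (by
      rw [integrableOn_Icc_iff_integrableOn_Ioc]
      exact hint.mono_set Ioc_subset_Ioi_self)
  · rw [intervalIntegral.integral_of_le hR0.le] at e2
    refine (setIntegral_eq_of_subset_of_forall_sdiff_eq_zero measurableSet_Ioi
      Ioc_subset_Ioi_self fun r hr => ?_).trans_le e2
    have hr1 : R ≤ r := by
      by_contra hlt
      exact hr.2 ⟨hr.1, (not_le.1 hlt).le⟩
    have : f (r • (ω : Rn (m + 2))) = 0 :=
      image_eq_zero_of_notMem_tsupport (hR _ ((hnorm r (mem_Ioi.1 hr.1).le).symm ▸ hr1))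
    simp [this]
  · have h1 : HasDerivAt (fun r : ℝ => r • (ω : Rn (m + 2))) (ω : Rn (m + 2)) r := by
      simpa using (hasDerivAt_id r).smul_const (ω : Rn (m + 2))
    exact ((hf.differentiable (by simp)) _).hasFDerivAt.comp_hasDerivAt r h1

end SemiclassicalResolvent

/-! ### The Carleman estimate for test functions -/

namespace SemiclassicalResolvent

/-- The relations between the parameters under which the Carleman estimate holds. The phase has
strength `κ` and is cut off at radius `A`, the weight decays like `q^{-1-ε}`; the constants `C₃`,
`C₄`, `pm` bound the radial derivative of the long-range part, the short-range part and the positive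
part of the long-range part, which is small beyond radius `K`. -/
structure CarlemanParams (h E ε κ A C₃ C₄ K pm : ℝ) : Prop where
  h_pos : 0 < h
  E_pos : 0 < E
  ε_pos : 0 < ε
  ε_le : ε ≤ 1
  κ_pos : 0 < κ
  one_le_A : 1 ≤ A
  C₃_nonneg : 0 ≤ C₃
  one_le_K : 1 ≤ K
  C₃_div : C₃ / K ≤ E / 8
  K_le : K ≤ A
  pm_le : pm + C₃ ≤ κ ^ 2 / (8 * K ^ 4)
  short : 8 * C₄ ^ 2 ≤ h * κ ^ 3
  small : 3 * κ ^ 2 * A ^ (-ε) + 2 * h * κ + 2 * C₄ ^ 2 / (A ^ 2 * h ^ 2) ≤ E / 8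

/-- `carleman_identity` in the form in which the two integral identities provide its terms, with
`T = e M τ`, `τ = h² (k + 2 p r (p r + k)) + E r²`, in place of `r S`. -/
lemma carleman_identity_flux {h E VL VS r e p p' k M dM N f fr D : ℝ} (hr : r ≠ 0) :
    h ^ 2 * (((2 - (2 * k + 1)) * (e * M) + e * (2 * p * (r * M) + 2 * k * M)) * N
        + e * (2 * p * M + dM) / r * (2 * (r * fr) ^ 2 - r ^ 2 * N)
        + e * (2 * p * (2 * p * (r * M) + 2 * k * M) + 2 * p' * (r * M) + 2 * p * (M + r * dM)
          + 2 * k * dM) / r * (f * (r * fr)))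
      + (VL + VS - E) * f
        * (2 * (e * M) * (r * fr) + e * (2 * p * (r * M) + 2 * k * M) * f)
      + (2 * (e * (M * (h ^ 2 * (k + 2 * p * r * (p * r + k)) + E * r ^ 2)) / r
          - e * (r * M) * VL) * f * fr
        + (e * (2 * p * (M * (h ^ 2 * (k + 2 * p * r * (p * r + k)) + E * r ^ 2))
            + dM * (h ^ 2 * (k + 2 * p * r * (p * r + k)) + E * r ^ 2)
            + M * (h ^ 2 * (2 * (p' * r + p) * (p * r + k) + 2 * p * r * (p' * r + p))
              + 2 * E * r)) / r
          - e * (M * (h ^ 2 * (k + 2 * p * r * (p * r + k)) + E * r ^ 2)) / r ^ 2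
          + 2 * k * (e * (M * (h ^ 2 * (k + 2 * p * r * (p * r + k)) + E * r ^ 2))) / r ^ 2
          - e * (2 * p * (r * M) + (M + r * dM)) * VL - e * (r * M) * D
          - 2 * k * (e * (r * M)) * VL / r) * f ^ 2)
    = e * ((2 * M - (M + r * dM)) * h ^ 2 * (N - fr ^ 2)
        + (h ^ 2 * (M + r * dM) + 4 * h * (h * p) * (r * M)) * (fr + (p + k / r) * f) ^ 2
        + 2 * h * (r * M) * (h * p') * f * (fr + (p + k / r) * f)
        + 2 * VS * (r * M) * f * (fr + (p + k / r) * f)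
        + ((h * p) ^ 2 * (M + r * dM) + 2 * (r * M) * (h * p) * (h * p')
          + (E - VL) * (M + r * dM) - r * M * D) * f ^ 2
        + h ^ 2 * (k ^ 2 - k) * (2 * M - (M + r * dM)) / r ^ 2 * f ^ 2) := by
  rw [← carleman_identity hr]
  have h0 : (M + r * dM - M) / r = dM := by field_simp; ring
  rw [h0]
  have h1 : e * (M * (h ^ 2 * (k + 2 * p * r * (p * r + k)) + E * r ^ 2)) / r
      = h ^ 2 * (e * (r * M * (k / r ^ 2 + 2 * p * (p + k / r)))) + E * (e * (r * M)) := by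
    field_simp
  have h2 : e * (2 * p * (M * (h ^ 2 * (k + 2 * p * r * (p * r + k)) + E * r ^ 2))
            + dM * (h ^ 2 * (k + 2 * p * r * (p * r + k)) + E * r ^ 2)
            + M * (h ^ 2 * (2 * (p' * r + p) * (p * r + k) + 2 * p * r * (p' * r + p))
              + 2 * E * r)) / r
          - e * (M * (h ^ 2 * (k + 2 * p * r * (p * r + k)) + E * r ^ 2)) / r ^ 2
          + 2 * k * (e * (M * (h ^ 2 * (k + 2 * p * r * (p * r + k)) + E * r ^ 2))) / r ^ 2
      = h ^ 2 * (e * (2 * p * (r * M * (k / r ^ 2 + 2 * p * (p + k / r)))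
            + (M + r * dM) * (k / r ^ 2 + 2 * p * (p + k / r))
            + r * M * (-2 * k / r ^ 3 + 2 * p' * (p + k / r) + 2 * p * (p' - k / r ^ 2))
            + 2 * k * (r * M * (k / r ^ 2 + 2 * p * (p + k / r))) / r))
        + E * (e * (2 * p * (r * M) + (M + r * dM) + 2 * k * M)) := by
    field_simp
    ring
  have h3 : 2 * k * (e * (r * M)) * VL / r = VL * (e * (2 * k * M)) := by
    field_simp
  rw [h1, h2, h3]
  ring

/-- The pointwise lower bound for the conjugated commutator, tested against `w G`. -/
lemma carleman_lower {h E ε κ A C₃ C₄ K pm k VL VS r y e em p p' M m N f fr w G c : ℝ}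
    (H : CarlemanParams h E ε κ A C₃ C₄ K pm) (hr : 0 < r) (hk : 1 ≤ k) (hy0 : 0 ≤ y)
    (hyq : y ≤ (1 + r) * A ^ (-ε)) (hyA : 1 + r ≤ A → y ≤ 1) (hm0 : 0 < m)
    (hP : r * M = (1 + r) * ((1 + r) ^ 2 - 1) * (1 + y) / (2 * ((1 + r) ^ 2 + y)) * m)
    (hm2 : m ≤ 2 * M) (hM0 : 0 ≤ M) (hμA : r * M ≤ A ^ 2) (hc : 0 < c) (hcm : c * w ^ 2 ≤ m)
    (hp : h * p = κ * (1 / (1 + r) - 1 / (1 + r + A)))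
    (hp' : h * p' = -κ * (1 / (1 + r) ^ 2 - 1 / (1 + r + A) ^ 2)) (he1 : 1 ≤ e) (hem : e ≤ em)
    (hVS : |VS| ≤ C₄ / (1 + r) ^ 3) (hVL : VL ≤ pm) (hVLK : K ≤ 1 + r → VL ≤ E / 4)
    (hfrN : fr ^ 2 ≤ N) :
    E / 4 * c * (w ^ 2 * f ^ 2) - 2 * em * A ^ 4 / (c * h ^ 2) * G ^ 2
        + e * (2 * w * G * (r * M) * (fr + (p + k / r) * f))
      ≤ e * ((2 * M - m) * h ^ 2 * (N - fr ^ 2)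
        + (h ^ 2 * m + 4 * h * (h * p) * (r * M)) * (fr + (p + k / r) * f) ^ 2
        + 2 * h * (r * M) * (h * p') * f * (fr + (p + k / r) * f)
        + 2 * VS * (r * M) * f * (fr + (p + k / r) * f)
        + ((h * p) ^ 2 * m + 2 * (r * M) * (h * p) * (h * p') + (E - VL) * m
          - r * M * (C₃ / (1 + r) ^ 3)) * f ^ 2
        + h ^ 2 * (k ^ 2 - k) * (2 * M - m) / r ^ 2 * f ^ 2) := by
  have hh := H.h_pos
  have hA0 : 0 < A := by linarith [H.one_le_A]
  have hPm : (1 + r) * ((1 + r) ^ 2 - 1) * (1 + y) / (2 * ((1 + r) ^ 2 + y)) = r * M / m := by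
    rw [hP]; field_simp
  obtain ⟨hφ, hpos⟩ := carleman_positivity (VL := VL) (VS := VS) (D := C₃ / (1 + r) ^ 3)
    (P := r * M / m) (η := A ^ (-ε)) hh H.E_pos (by linarith : 1 ≤ 1 + r)
    hy0 H.κ_pos H.one_le_A H.C₃_nonneg H.one_le_K
    (Real.rpow_le_one_of_one_le_of_nonpos H.one_le_A (by linarith [H.ε_pos]))
    (by
      rw [one_div, ← Real.rpow_neg_one]
      exact Real.rpow_le_rpow_of_exponent_le H.one_le_A (by linarith [H.ε_le]))
    hyq hyA hPm.symm hp hp' rfl hVS hVL hVLK H.C₃_div H.K_le H.pm_le H.short H.small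
  obtain ⟨D, hD⟩ : ∃ D, D = C₃ / (1 + r) ^ 3 := ⟨_, rfl⟩
  rw [← hD] at hpos ⊢
  have hμ : 0 ≤ r * M := by positivity
  obtain ⟨φ₁, hφ₁⟩ : ∃ φ₁, φ₁ = h * p := ⟨_, rfl⟩
  obtain ⟨φ₂, hφ₂⟩ : ∃ φ₂, φ₂ = h * p' := ⟨_, rfl⟩
  obtain ⟨t, ht⟩ : ∃ t, t = fr + (p + k / r) * f := ⟨_, rfl⟩
  obtain ⟨μ, hμr⟩ : ∃ μ, μ = r * M := ⟨_, rfl⟩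
  rw [← hφ₁] at hφ hpos ⊢
  rw [← hφ₂] at hpos ⊢
  rw [← hμr] at hpos hμ hμA ⊢
  rw [← ht]
  have hZ : E / 4 * m + h * φ₂ ^ 2 * μ / (2 * φ₁) + VS ^ 2 * μ / (2 * h * φ₁)
        ≤ φ₁ ^ 2 * m + 2 * μ * φ₁ * φ₂ + (E - VL) * m - μ * D ∨
      E / 4 * m + h * φ₂ ^ 2 * μ / (2 * φ₁) + 2 * VS ^ 2 * μ ^ 2 / (h ^ 2 * m)
        ≤ φ₁ ^ 2 * m + 2 * μ * φ₁ * φ₂ + (E - VL) * m - μ * D := by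
    have e0 : μ / m * m = μ := by field_simp
    have e1 : (φ₁ ^ 2 + 2 * φ₁ * φ₂ * (μ / m) + (E - VL) - μ / m * D) * m
        = φ₁ ^ 2 * m + 2 * μ * φ₁ * φ₂ + (E - VL) * m - μ * D := by
      linear_combination (2 * φ₁ * φ₂ - D) * e0
    rw [← e1]
    refine hpos.imp (fun h1 => ?_) (fun h1 => ?_)
    · refine le_trans (le_of_eq ?_) (mul_le_mul_of_nonneg_right h1 hm0.le)
      field_simp
    · refine le_trans (le_of_eq ?_) (mul_le_mul_of_nonneg_right h1 hm0.le)
      field_simp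
  have key := carleman_absorb (t := t) (f := f) (w := w) (G := G) hh hφ hμ hm0 hZ
  have he0 : 0 ≤ e := by linarith
  have hem0 : 0 < em := by linarith
  have b1 : 0 ≤ (2 * M - m) * h ^ 2 * (N - fr ^ 2) :=
    mul_nonneg (mul_nonneg (by linarith) (by positivity)) (by linarith)
  have b2 : 0 ≤ h ^ 2 * (k ^ 2 - k) * (2 * M - m) / r ^ 2 * f ^ 2 := by
    have e1 : 0 ≤ k ^ 2 - k := by nlinarith
    have e2 : 0 ≤ 2 * M - m := by linarith
    positivity
  have b3 : E / 4 * c * (w ^ 2 * f ^ 2) ≤ e * (E / 4 * m * f ^ 2) := by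
    have hE := H.E_pos
    calc E / 4 * c * (w ^ 2 * f ^ 2) = 1 * (E / 4 * (c * w ^ 2) * f ^ 2) := by ring
      _ ≤ e * (E / 4 * m * f ^ 2) := by gcongr
  have b4 : e * (2 * μ ^ 2 * w ^ 2 / (h ^ 2 * m) * G ^ 2)
      ≤ 2 * em * A ^ 4 / (c * h ^ 2) * G ^ 2 := by
    have e1 : w ^ 2 / m ≤ 1 / c := by
      rw [div_le_div_iff₀ hm0 hc]
      linarith
    calc e * (2 * μ ^ 2 * w ^ 2 / (h ^ 2 * m) * G ^ 2)
        = 2 * e * μ ^ 2 * (w ^ 2 / m) / h ^ 2 * G ^ 2 := by field_simp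
      _ ≤ 2 * em * (A ^ 2) ^ 2 * (1 / c) / h ^ 2 * G ^ 2 := by gcongr
      _ = _ := by field_simp
  have b5 := mul_le_mul_of_nonneg_left key he0
  have b6 := mul_nonneg he0 b1
  have b7 := mul_nonneg he0 b2
  linarith

end SemiclassicalResolvent

namespace SemiclassicalResolvent

/-- A splitting `V = W + U` of the potential into a long-range part `W`, bounded above and with
radial derivative bounded above along almost every ray up to the origin, and a short-range part
`U`. -/
structure SplitPotential {n : ℕ} (E C₃ C₄ K pm : ℝ) (W U : Rn n → ℝ) : Prop where
  meas_long : AEStronglyMeasurable W volume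
  bdd_long : ∃ B, ∀ᵐ x, |W x| ≤ B
  ray_long : ∀ᵐ ω : Metric.sphere (0 : Rn n) 1 ∂(volume : Measure (Rn n)).toSphere,
    ContinuousOn (fun r : ℝ => W (r • (ω : Rn n))) (Ici 0) ∧
    ∀ r : ℝ, 0 < r → ∃ d, d ≤ C₃ / (1 + r) ^ 3 ∧
      HasDerivWithinAt (fun r : ℝ => W (r • (ω : Rn n))) d (Ioi r) r
  le_long : ∀ᵐ x, W x ≤ pm
  le_long_far : ∀ᵐ x : Rn n, K ≤ 1 + ‖x‖ → W x ≤ E / 4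
  meas_short : AEStronglyMeasurable U volume
  bdd_short : ∀ᵐ x, |U x| ≤ C₄ / (1 + ‖x‖) ^ 3

/-- The multiplier is bounded by the gradient and the function itself. -/
lemma multiplier_sq_le {h κ A n r e em p M N f Df : ℝ} (hh : 0 < h) (hκ : 0 < κ) (hA : 1 ≤ A)
    (hn : 3 ≤ n) (hr : 0 ≤ r) (hM0 : 0 ≤ M) (hμA : r * M ≤ A ^ 2) (hMA : M ≤ 2 * A ^ 2)
    (hp : h * p = κ * (1 / (1 + r) - 1 / (1 + r + A))) (he1 : 1 ≤ e) (hem : e ≤ em)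
    (hN : Df ^ 2 ≤ r ^ 2 * N) (hN0 : 0 ≤ N) :
    (2 * (e * M) * Df + e * (2 * p * (r * M) + (n - 1) * M) * f) ^ 2
      ≤ 8 * em ^ 2 * A ^ 4 * (κ / h + n) ^ 2 * (N + f ^ 2) := by
  have he0 : 0 < e := by linarith
  have hem0 : 0 < em := by linarith
  have hp0 : 0 ≤ p := by
    have : 0 ≤ h * p := by
      rw [hp]
      have : 1 / (1 + r + A) ≤ 1 / (1 + r) :=
        one_div_le_one_div_of_le (by positivity) (by linarith)
      exact mul_nonneg hκ.le (by linarith)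
    exact nonneg_of_mul_nonneg_right this hh
  have hpκ : p ≤ κ / h := by
    rw [le_div_iff₀ hh, mul_comm, hp]
    have h1 : 1 / (1 + r) ≤ 1 := by
      rw [div_le_one (by positivity)]
      linarith
    have h2 : 0 ≤ 1 / (1 + r + A) := by positivity
    exact mul_le_of_le_one_right hκ.le (by linarith)
  have hκh : 0 < κ / h := by positivity
  obtain ⟨B, hB⟩ : ∃ B, B = κ / h + n := ⟨_, rfl⟩
  have hB1 : 1 ≤ B := by linarith
  have h1 : (2 * (e * M) * Df) ^ 2 ≤ 4 * em ^ 2 * A ^ 4 * B ^ 2 * N := by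
    calc (2 * (e * M) * Df) ^ 2 = 4 * e ^ 2 * M ^ 2 * Df ^ 2 := by ring
      _ ≤ 4 * e ^ 2 * M ^ 2 * (r ^ 2 * N) := by gcongr
      _ = 4 * e ^ 2 * (r * M) ^ 2 * N := by ring
      _ ≤ 4 * em ^ 2 * (A ^ 2) ^ 2 * N := by gcongr
      _ = 4 * em ^ 2 * A ^ 4 * 1 ^ 2 * N := by ring
      _ ≤ 4 * em ^ 2 * A ^ 4 * B ^ 2 * N := by gcongr
  have h2 : e * (2 * p * (r * M) + (n - 1) * M) ≤ 2 * em * A ^ 2 * B := by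
    have hn1 : 0 ≤ n - 1 := by linarith
    calc e * (2 * p * (r * M) + (n - 1) * M)
        ≤ em * (2 * (κ / h) * A ^ 2 + (n - 1) * (2 * A ^ 2)) := by gcongr
      _ = 2 * em * A ^ 2 * (κ / h + n - 1) := by ring
      _ ≤ 2 * em * A ^ 2 * B := by
        gcongr
        linarith
  have h3 : 0 ≤ e * (2 * p * (r * M) + (n - 1) * M) := by
    have hn1 : 0 ≤ n - 1 := by linarith
    positivity
  have h4 : (e * (2 * p * (r * M) + (n - 1) * M) * f) ^ 2 ≤ 4 * em ^ 2 * A ^ 4 * B ^ 2 * f ^ 2 := by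
    calc (e * (2 * p * (r * M) + (n - 1) * M) * f) ^ 2
        = (e * (2 * p * (r * M) + (n - 1) * M)) ^ 2 * f ^ 2 := by ring
      _ ≤ (2 * em * A ^ 2 * B) ^ 2 * f ^ 2 := by gcongr
      _ = _ := by ring
  rw [← hB]
  have h5 := add_sq_le (a := 2 * (e * M) * Df)
    (b := e * (2 * p * (r * M) + (n - 1) * M) * f)
  linarith

variable {n : ℕ}

/-- The weight `(1 + |x|)^{-(1+ε)/2}` as a function. -/
noncomputable def weightFun (n : ℕ) (ε : ℝ) (x : Rn n) : ℝ := (‖x‖ + 1) ^ (-((1 + ε) / 2))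

lemma continuous_weightFun (ε : ℝ) : Continuous (weightFun n ε) :=
  Continuous.rpow_const (by fun_prop) fun x => Or.inl (by positivity)

lemma weightFun_nonneg (ε : ℝ) (x : Rn n) : 0 ≤ weightFun n ε x := by
  unfold weightFun
  positivity

lemma weightFun_le_one {ε : ℝ} (hε : 0 < ε) (x : Rn n) : weightFun n ε x ≤ 1 :=
  Real.rpow_le_one_of_one_le_of_nonpos (by simp) (by linarith)

lemma weightFun_sq (ε : ℝ) (x : Rn n) : weightFun n ε x ^ 2 = (1 + ‖x‖) ^ (-(1 + ε)) := by
  rw [weightFun, ← Real.rpow_natCast, ← Real.rpow_mul (by positivity), add_comm 1 ‖x‖]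
  congr 1
  push_cast
  ring

lemma memLp_mul_of_bounded {g F : Rn n → ℝ} (hF : MemLp F 2 volume)
    (hg : AEStronglyMeasurable g volume) {C : ℝ} (hC : ∀ᵐ x, ‖g x‖ ≤ C) :
    MemLp (fun x => g x * F x) 2 volume := by
  refine hF.of_le_mul (c := C) (hg.mul hF.1) ?_
  filter_upwards [hC] with x hx
  rw [norm_mul]
  gcongr

/-- The Carleman estimate for a real test function `f`, compared with an arbitrary source `w G`:
the residual `ρ = (-h²Δ + V - E) f - w G` is paired with the multiplier and costs a factor `1/θ`. -/
theorem carleman_test (hn : 3 ≤ n) {h E ε κ A C₃ C₄ K pm : ℝ}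
    (H : CarlemanParams h E ε κ A C₃ C₄ K pm) {W U : Rn n → ℝ}
    (HV : SplitPotential E C₃ C₄ K pm W U)
    {f : Rn n → ℝ} (hf : ContDiff ℝ (⊤ : ℕ∞) f) (hfc : HasCompactSupport f)
    {G : Rn n → ℝ} (hG : MemLp G 2 volume) {em c : ℝ} (hc : c = 2 ^ (-(2 / ε)))
    (hem : em = Real.exp (2 * κ / h * Real.log (1 + A))) {θ : ℝ} (hθ : 0 < θ) :
    E / 4 * c * ∫ x, (weightFun n ε x * f x) ^ 2
      ≤ 2 * em * A ^ 4 / (c * h ^ 2) * (∫ x, G x ^ 2)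
        + 1 / (2 * θ)
          * (∫ x, (-h ^ 2 * lap f x + (W x + U x - E) * f x - weightFun n ε x * G x) ^ 2)
        + θ / 2 * (8 * em ^ 2 * A ^ 4 * (κ / h + n) ^ 2)
          * ((∫ x, lap f x ^ 2) + 2 * ∫ x, f x ^ 2) := by
  have hh := H.h_pos
  have hc0 : 0 < c := by rw [hc]; positivity
  obtain ⟨M, dM, hM, hdMc, hMprop⟩ := exists_weight H.one_le_A H.ε_pos H.ε_le
  obtain ⟨p, p', e, hp, hp'c, he, heprop⟩ := exists_phase (h := h) H.one_le_A H.κ_pos hh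
  obtain ⟨B, hB⟩ := HV.bdd_long
  have : Nonempty (Fin n) := ⟨⟨0, by lia⟩⟩
  have hn3 : (3 : ℝ) ≤ n := by exact_mod_cast hn
  have cM : ContinuousOn M (Ici 0) := fun r hr => (hM r hr).continuousAt.continuousWithinAt
  have cp : ContinuousOn p (Ici 0) := fun r hr => (hp r hr).continuousAt.continuousWithinAt
  have ce : ContinuousOn e (Ici 0) := fun r hr => (he r hr).continuousAt.continuousWithinAt
  -- the multiplier coefficients
  have hb : ∀ r, 0 ≤ r → HasDerivAt (fun r => e r * M r) (e r * (2 * p r * M r + dM r)) r :=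
    fun r hr => ((he r hr).fun_mul (hM r hr)).congr_deriv (by ring)
  have hc1 : ∀ r, 0 ≤ r → HasDerivAt (fun r => e r * (2 * p r * (r * M r) + (n - 1) * M r))
      (e r * (2 * p r * (2 * p r * (r * M r) + (n - 1) * M r) + 2 * p' r * (r * M r)
        + 2 * p r * (M r + r * dM r) + (n - 1) * dM r)) r := fun r hr =>
    ((he r hr).fun_mul ((((hp r hr).const_mul 2).fun_mul ((hasDerivAt_id' r).fun_mul (hM r hr))).fun_add
      ((hM r hr).const_mul ((n : ℝ) - 1)))).congr_deriv (by ring)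
  obtain ⟨i1, i2, I1⟩ := multiplier_identity (by lia) hb (by fun_prop) hc1 (by fun_prop) hf hfc
  -- the flux coefficients
  have hT : ∀ r, 0 ≤ r → HasDerivAt (fun r => e r * (M r * (h ^ 2 * (((n : ℝ) - 1) / 2
        + 2 * p r * r * (p r * r + ((n : ℝ) - 1) / 2)) + E * r ^ 2)))
      (e r * (2 * p r * (M r * (h ^ 2 * (((n : ℝ) - 1) / 2
          + 2 * p r * r * (p r * r + ((n : ℝ) - 1) / 2)) + E * r ^ 2))
        + dM r * (h ^ 2 * (((n : ℝ) - 1) / 2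
          + 2 * p r * r * (p r * r + ((n : ℝ) - 1) / 2)) + E * r ^ 2)
        + M r * (h ^ 2 * (2 * (p' r * r + p r) * (p r * r + ((n : ℝ) - 1) / 2)
          + 2 * p r * r * (p' r * r + p r)) + 2 * E * r))) r := by
    intro r hr
    have h1 := (hp r hr).fun_mul (hasDerivAt_id' r)
    have h2 := (((hp r hr).const_mul 2).fun_mul (hasDerivAt_id' r)).fun_mul
      (h1.add_const (((n : ℝ) - 1) / 2))
    have h3 := ((h2.const_add (((n : ℝ) - 1) / 2)).const_mul (h ^ 2)).fun_add
      ((hasDerivAt_pow 2 r).const_mul E)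
    refine ((he r hr).fun_mul ((hM r hr).fun_mul h3)).congr_deriv ?_
    push_cast
    ring
  have hN : ∀ r, 0 ≤ r → HasDerivAt (fun r => e r * (r * M r))
      (e r * (2 * p r * (r * M r) + (M r + r * dM r))) r := fun r hr =>
    ((he r hr).fun_mul ((hasDerivAt_id' r).fun_mul (hM r hr))).congr_deriv (by ring)
  have hN0 : ∀ r, 0 ≤ r → 0 ≤ e r * (r * M r) := by
    intro r hr
    obtain ⟨-, -, -, -, -, -, -, -, -, h1, -⟩ := hMprop r hr
    have h2 := (heprop r hr).2.2.1
    positivity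
  have hD : ContinuousOn (fun r : ℝ => C₃ / (1 + r) ^ 3) (Ici 0) := by
    have h1 : ∀ r ∈ Ici (0 : ℝ), (1 + r) ^ 3 ≠ 0 := fun r hr => by
      have : (0 : ℝ) ≤ r := hr
      positivity
    fun_prop (disch := assumption)
  obtain ⟨i4, I4⟩ := radial_flux_nonpos hn hT (by fun_prop) hN (by fun_prop) hN0 hD HV.meas_long hB
    HV.ray_long hf hfc
  -- names for the three integrands
  obtain ⟨w, hw⟩ : ∃ w : Rn n → ℝ, w = weightFun n ε := ⟨_, rfl⟩
  rw [← hw]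
  obtain ⟨Y, hY⟩ : ∃ Y : Rn n → ℝ, ∀ x, Y x = 2 * (e ‖x‖ * M ‖x‖) * euler f x
      + e ‖x‖ * (2 * p ‖x‖ * (‖x‖ * M ‖x‖) + (n - 1) * M ‖x‖) * f x := ⟨_, fun _ => rfl⟩
  simp only [← hY] at i2 I1
  obtain ⟨A₁, hA₁⟩ : ∃ A₁ : Rn n → ℝ, ∀ x, A₁ x = ((2 - n) * (e ‖x‖ * M ‖x‖)
      + e ‖x‖ * (2 * p ‖x‖ * (‖x‖ * M ‖x‖) + (n - 1) * M ‖x‖)) * gradSq f x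
      + e ‖x‖ * (2 * p ‖x‖ * M ‖x‖ + dM ‖x‖) / ‖x‖ * (2 * euler f x ^ 2 - ‖x‖ ^ 2 * gradSq f x)
      + e ‖x‖ * (2 * p ‖x‖ * (2 * p ‖x‖ * (‖x‖ * M ‖x‖) + (n - 1) * M ‖x‖)
        + 2 * p' ‖x‖ * (‖x‖ * M ‖x‖) + 2 * p ‖x‖ * (M ‖x‖ + ‖x‖ * dM ‖x‖) + (n - 1) * dM ‖x‖) / ‖x‖
        * (f x * euler f x) := ⟨_, fun _ => rfl⟩
  simp only [← hA₁] at i1 I1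
  generalize hJ : (fun x : Rn n => 2 * _ * f x * (euler f x / ‖x‖) + _ * f x ^ 2) = J at i4 I4
  replace hJ := fun x => (congrFun hJ x).symm
  beta_reduce at hJ
  -- regularity of the terms
  have cw : Continuous w := hw ▸ continuous_weightFun ε
  have cf := hf.continuous
  have cY : Continuous Y := by
    have h1 : ContinuousOn (fun r => 2 * (e r * M r)) (Ici 0) := by fun_prop
    have h2 : ContinuousOn (fun r => e r * (2 * p r * (r * M r) + (n - 1) * M r)) (Ici 0) := by
      fun_prop
    rw [funext hY]
    exact ((continuous_comp_norm h1).mul (contDiff_euler hf).continuous).add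
      ((continuous_comp_norm h2).mul cf)
  have sY : HasCompactSupport Y := hasCompactSupport_of_zero hfc fun x hx => by
    rw [hY]
    simp [euler, pd_eq_zero hx, image_eq_zero_of_notMem_tsupport hx]
  have mf : MemLp f 2 volume := cf.memLp_of_hasCompactSupport hfc
  have mY : MemLp Y 2 volume := cY.memLp_of_hasCompactSupport sY
  have ml : MemLp (lap f) 2 volume :=
    (contDiff_lap hf).continuous.memLp_of_hasCompactSupport (hasCompactSupport_lap hfc)
  have hw1 : ∀ x, ‖w x‖ ≤ 1 := fun x => by
    rw [hw, Real.norm_of_nonneg (weightFun_nonneg ε x)]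
    exact weightFun_le_one H.ε_pos x
  have mwG : MemLp (fun x => w x * G x) 2 volume :=
    memLp_mul_of_bounded hG cw.aestronglyMeasurable (Eventually.of_forall hw1)
  have mwf : MemLp (fun x => w x * f x) 2 volume :=
    memLp_mul_of_bounded mf cw.aestronglyMeasurable (Eventually.of_forall hw1)
  have mPf : MemLp (fun x => (W x + U x - E) * f x) 2 volume := by
    refine memLp_mul_of_bounded (C := B + |C₄| + |E|) mf
      ((HV.meas_long.add HV.meas_short).sub aestronglyMeasurable_const) ?_
    filter_upwards [hB, HV.bdd_short] with x h1 h2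
    have h3 : C₄ / (1 + ‖x‖) ^ 3 ≤ |C₄| := by
      refine (div_le_div_of_nonneg_right (le_abs_self C₄) (by positivity)).trans ?_
      exact div_le_self (abs_nonneg _) (one_le_pow₀ (by simp))
    rw [Real.norm_eq_abs]
    have h4 := abs_sub (W x + U x) E
    have h5 := abs_add_le (W x) (U x)
    linarith
  have mQ : MemLp (fun x => (W x + U x - E) * f x - w x * G x) 2 volume := mPf.sub mwG
  have i3 : Integrable fun x => ((W x + U x - E) * f x - w x * G x) * Y x := mQ.integrable_mul mY
  obtain ⟨ρ, hρ⟩ : ∃ ρ : Rn n → ℝ, ∀ x, ρ x = -h ^ 2 * lap f x + (W x + U x - E) * f x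
      - w x * G x := ⟨_, fun _ => rfl⟩
  simp only [← hρ]
  have mρ : MemLp ρ 2 volume := by
    refine ((ml.const_mul (-h ^ 2)).add mQ).ae_eq (Eventually.of_forall fun x => ?_)
    rw [hρ]
    simp only [Pi.add_apply]
    ring
  have iρ : Integrable fun x => ρ x ^ 2 := mρ.integrable_sq
  have iG : Integrable fun x => G x ^ 2 := hG.integrable_sq
  have iwf : Integrable fun x => (w x * f x) ^ 2 := mwf.integrable_sq
  have il : Integrable fun x => lap f x ^ 2 := ml.integrable_sq
  have iff : Integrable fun x => f x ^ 2 := mf.integrable_sq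
  have iN : Integrable (gradSq f) :=
    (contDiff_gradSq hf).continuous.integrable_of_hasCompactSupport (hasCompactSupport_gradSq hfc)
  -- the Carleman lower bound
  have lower : E / 4 * c * ∫ x, (w x * f x) ^ 2 ≤ 2 * em * A ^ 4 / (c * h ^ 2) * (∫ x, G x ^ 2)
      + ∫ x, ρ x * Y x := by
    have e1 : ∫ x, ρ x * Y x = h ^ 2 * (∫ x, A₁ x)
        + ∫ x, ((W x + U x - E) * f x - w x * G x) * Y x := by
      rw [← I1, ← integral_const_mul, ← integral_add (i2.const_mul _) i3]
      refine integral_congr_ae (Eventually.of_forall fun x => ?_)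
      simp only [hρ]
      ring
    have i5 : Integrable fun x => E / 4 * c * (w x * f x) ^ 2
        - 2 * em * A ^ 4 / (c * h ^ 2) * G x ^ 2 := (iwf.const_mul _).sub (iG.const_mul _)
    have i6 : Integrable fun x => h ^ 2 * A₁ x
        + ((W x + U x - E) * f x - w x * G x) * Y x := (i1.const_mul _).add i3
    have e2 : ∫ x, (E / 4 * c * (w x * f x) ^ 2 - 2 * em * A ^ 4 / (c * h ^ 2) * G x ^ 2)
        ≤ ∫ x, (h ^ 2 * A₁ x + ((W x + U x - E) * f x - w x * G x) * Y x + J x) := by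
      refine integral_mono_ae i5 (i6.add i4) ?_
      filter_upwards [compl_mem_ae_iff.2 (measure_singleton (0 : Rn n)), HV.le_long, HV.le_long_far,
        HV.bdd_short] with x hx h1 h2 h3
      have hr : 0 < ‖x‖ := norm_pos_iff.2 hx
      obtain ⟨y, m, k1, k2, k3, k4, k5, k6, k7, k8, k9, -, k10⟩ := hMprop ‖x‖ hr.le
      obtain ⟨l1, l2, l3, l4⟩ := heprop ‖x‖ hr.le
      obtain rfl : m = M ‖x‖ + ‖x‖ * dM ‖x‖ := by linarith
      have hE : ‖x‖ * (euler f x / ‖x‖) = euler f x := by field_simp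
      have hk : 2 * (((n : ℝ) - 1) / 2) = n - 1 := by ring
      have hfr : (euler f x / ‖x‖) ^ 2 ≤ gradSq f x := by
        rw [div_pow, div_le_iff₀ (by positivity), mul_comm]
        exact euler_sq_le f x
      have hid := carleman_identity_flux (h := h) (E := E) (VL := W x) (VS := U x) (e := e ‖x‖)
        (p := p ‖x‖) (p' := p' ‖x‖) (k := ((n : ℝ) - 1) / 2) (M := M ‖x‖) (dM := dM ‖x‖)
        (N := gradSq f x) (f := f x) (fr := euler f x / ‖x‖) (D := C₃ / (1 + ‖x‖) ^ 3) hr.ne'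
      have low := carleman_lower (k := ((n : ℝ) - 1) / 2) (f := f x) (w := w x) (G := G x) H hr
        (by linarith) k1 k2 k3 k4 k6 k7 k8 k9 hc0 (by rw [hw, weightFun_sq, hc]; exact k10) l1 l2 l3
        (hem ▸ l4) h3 h1 h2 hfr
      rw [← hid, hE, hk] at low
      have hwY : w x * G x * Y x = e ‖x‖ * (2 * w x * G x * (‖x‖ * M ‖x‖)
          * (euler f x / ‖x‖ + (p ‖x‖ + ((n : ℝ) - 1) / 2 / ‖x‖) * f x)) := by
        rw [hY]
        field_simp
      rw [← hwY] at low
      rw [sub_mul, hA₁, hJ]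
      rw [hY] at low ⊢
      linear_combination low
    rw [integral_sub (iwf.const_mul _) (iG.const_mul _), integral_const_mul, integral_const_mul,
      integral_add i6 i4, integral_add (i1.const_mul _) i3, integral_const_mul, ← e1] at e2
    linarith
  -- the residual
  have hYsq : ∀ x, Y x ^ 2 ≤ 8 * em ^ 2 * A ^ 4 * (κ / h + n) ^ 2 * (gradSq f x + f x ^ 2) := by
    intro x
    rw [hY]
    obtain ⟨-, -, -, -, -, -, -, -, -, h1, h2, h3, -⟩ := hMprop ‖x‖ (norm_nonneg x)
    obtain ⟨h4, -, h5, h6⟩ := heprop ‖x‖ (norm_nonneg x)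
    exact multiplier_sq_le hh H.κ_pos H.one_le_A hn3 (norm_nonneg x) h1 h2 h3 h4 h5
      (hem ▸ h6) (euler_sq_le f x) (gradSq_nonneg f x)
  have upper : ∫ x, ρ x * Y x ≤ 1 / (2 * θ) * (∫ x, ρ x ^ 2)
      + θ / 2 * (8 * em ^ 2 * A ^ 4 * (κ / h + n) ^ 2)
          * ((∫ x, lap f x ^ 2) + 2 * ∫ x, f x ^ 2) := by
    have e1 : ∫ x, gradSq f x ≤ ∫ x, (lap f x ^ 2 + f x ^ 2) := by
      rw [integral_gradSq (by lia) hf hfc]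
      refine integral_mono (ml.neg.integrable_mul mf) (il.add iff) fun x => ?_
      nlinarith [sq_nonneg (lap f x + f x), sq_nonneg (lap f x), sq_nonneg (f x)]
    rw [integral_add il iff] at e1
    have iNf : Integrable fun x => gradSq f x + f x ^ 2 := iN.add iff
    have e2 : ∫ x, ρ x * Y x ≤ ∫ x, (1 / (2 * θ) * ρ x ^ 2
        + θ / 2 * (8 * em ^ 2 * A ^ 4 * (κ / h + n) ^ 2) * (gradSq f x + f x ^ 2)) := by
      refine integral_mono (mρ.integrable_mul mY)
        ((iρ.const_mul _).add (iNf.const_mul _)) fun x => ?_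
      have e3 : ρ x * Y x ≤ 1 / (2 * θ) * ρ x ^ 2 + θ / 2 * Y x ^ 2 := by
        have : 0 ≤ 1 / (2 * θ) * (ρ x - θ * Y x) ^ 2 := by positivity
        have e4 : 1 / (2 * θ) * (ρ x - θ * Y x) ^ 2
            = 1 / (2 * θ) * ρ x ^ 2 - ρ x * Y x + θ / 2 * Y x ^ 2 := by
          field_simp
          ring
        linarith
      have e5 := mul_le_mul_of_nonneg_left (hYsq x) (by positivity : 0 ≤ θ / 2)
      linarith
    rw [integral_add (iρ.const_mul _) (iNf.const_mul _), integral_const_mul,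
      integral_const_mul, integral_add iN iff] at e2
    have e3 : (∫ x, gradSq f x) + ∫ x, f x ^ 2 ≤ (∫ x, lap f x ^ 2) + 2 * ∫ x, f x ^ 2 := by
      linarith
    have e4 := mul_le_mul_of_nonneg_left e3
      (by positivity : 0 ≤ θ / 2 * (8 * em ^ 2 * A ^ 4 * (κ / h + n) ^ 2))
    linarith
  linarith

end SemiclassicalResolvent

/-! ### The estimate on `H²` and the weighted resolvent bound -/

namespace SemiclassicalResolvent

variable {n : ℕ}

lemma lap_clm_comp (L : ℂ →L[ℝ] ℝ) {F : Rn n → ℂ} (hF : ContDiff ℝ (⊤ : ℕ∞) F) (x : Rn n) :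
    lap (fun x => L (F x)) x = L (lap F x) := by
  have h : ∀ {g : Rn n → ℂ}, ContDiff ℝ (⊤ : ℕ∞) g → ∀ i,
      pd i (fun x => L (g x)) = fun x => L (pd i g x) := by
    intro g hg i
    ext x
    have h1 := L.hasFDerivAt.comp x ((hg.differentiable (by simp)) x).hasFDerivAt
    exact congrArg (fun T => T (EuclideanSpace.basisFun (Fin n) ℝ i)) h1.fderiv
  simp only [lap, h hF, h (contDiff_pd hF _), map_sum]

lemma norm_sq_eq_integral (g : L2 n) :
    ‖g‖ ^ 2 = (∫ x, Complex.reCLM (g x) ^ 2) + ∫ x, Complex.imCLM (g x) ^ 2 := by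
  have hg : MemLp g 2 volume := Lp.memLp g
  have h1 : Integrable fun x => Complex.reCLM (g x) ^ 2 :=
    (Complex.reCLM.comp_memLp' hg).integrable_sq
  have h2 : Integrable fun x => Complex.imCLM (g x) ^ 2 :=
    (Complex.imCLM.comp_memLp' hg).integrable_sq
  have h3 := L2.integrable_inner (𝕜 := ℂ) g g
  have h4 : (‖g‖ ^ 2 : ℝ) = (inner ℂ g g).re := by
    rw [inner_self_eq_norm_sq_to_K]
    norm_cast
  rw [h4, L2.inner_def, ← integral_add h1 h2, ← Complex.reCLM_apply,
    ← Complex.reCLM.integral_comp_comm h3]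
  refine integral_congr_ae (Eventually.of_forall fun x => ?_)
  simp only [Complex.reCLM_apply, Complex.imCLM_apply, inner_self_eq_norm_sq_to_K]
  change (((‖g x‖ : ℝ) : ℂ) ^ 2).re = _
  rw [← Complex.ofReal_pow, Complex.ofReal_re, Complex.sq_norm, Complex.normSq_apply]
  ring

lemma norm_mulOp_apply_le {φ : Rn n → ℝ} (hφ : MemLp φ ∞ (volume : Measure (Rn n))) {C : ℝ}
    (hC : ∀ x, |φ x| ≤ C) (u : L2 n) : ‖mulOp φ hφ u‖ ≤ C * ‖u‖ := by
  refine Lp.norm_le_mul_norm_of_ae_le_mul ?_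
  filter_upwards [mulOp_ae φ hφ u] with x hx
  rw [hx, norm_mul, Complex.norm_real]
  gcongr
  exact hC x

lemma norm_weight_apply_le {s : ℝ} (hs : 0 ≤ s) (u : L2 n) : ‖weight n s hs u‖ ≤ ‖u‖ := by
  have := norm_mulOp_apply_le (memLp_weight n hs) (C := 1) (fun x => ?_) u
  · rwa [one_mul] at this
  · rw [abs_of_nonneg (by positivity)]
    exact Real.rpow_le_one_of_one_le_of_nonpos (by simp) (by linarith)

lemma weight_comp {a b : ℝ} (ha : 0 ≤ a) (hb : 0 ≤ b) (hab : 0 ≤ a + b) :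
    weight n a ha ∘L weight n b hb = weight n (a + b) hab := by
  refine ContinuousLinearMap.ext fun u => Lp.ext ?_
  filter_upwards [mulOp_ae _ (memLp_weight n ha) (weight n b hb u), mulOp_ae _ (memLp_weight n hb) u,
    mulOp_ae _ (memLp_weight n hab) u] with x h1 h2 h3
  rw [ContinuousLinearMap.comp_apply]
  refine h1.trans (Eq.trans ?_ h3.symm)
  refine (congrArg _ h2).trans ?_
  rw [← mul_assoc, ← Complex.ofReal_mul, ← Real.rpow_add (by positivity)]
  congr 3
  ring

lemma weight_injective {s : ℝ} (hs : 0 ≤ s) : Function.Injective (weight n s hs) := by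
  rw [injective_iff_map_eq_zero]
  intro u hu
  refine Lp.ext ?_
  have h0 : weight n s hs u =ᵐ[volume] 0 := by
    rw [hu]
    exact Lp.coeFn_zero _ _ _
  filter_upwards [mulOp_ae _ (memLp_weight n hs) u, h0, Lp.coeFn_zero ℂ 2 volume] with x h1 h2 h3
  rw [h3]
  have h4 := h1.symm.trans h2
  have h5 : ((‖x‖ + 1) ^ (-s) : ℝ) ≠ 0 := by positivity
  simpa [h5] using h4

lemma inner_weight {s : ℝ} (hs : 0 ≤ s) (u v : L2 n) :
    inner ℂ u (weight n s hs v) = inner ℂ (weight n s hs u) v := by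
  rw [L2.inner_def, L2.inner_def]
  refine integral_congr_ae ?_
  filter_upwards [mulOp_ae _ (memLp_weight n hs) u, mulOp_ae _ (memLp_weight n hs) v] with x h1 h2
  refine (congrArg (inner ℂ (u x)) h2).trans (Eq.trans ?_ (congrArg (inner ℂ · (v x)) h1).symm)
  simp [RCLike.inner_apply]
  ring

/-- The Carleman estimate for `u ∈ H²`, in operator form. -/
theorem carleman_sobolev (hn : 3 ≤ n) {h E ε κ A C₃ C₄ K pm : ℝ}
    (H : CarlemanParams h E ε κ A C₃ C₄ K pm) {V W U : Rn n → ℝ}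
    (HV : SplitPotential E C₃ C₄ K pm W U) (hV : MemLp V ∞ (volume : Measure (Rn n)))
    (hWU : ∀ x, V x = W x + U x) {em c : ℝ} (hc : c = 2 ^ (-(2 / ε)))
    (hem : em = Real.exp (2 * κ / h * Real.log (1 + A))) {θ : ℝ} (hθ : 0 < θ)
    (hs : 0 ≤ (1 + ε) / 2) (G : L2 n) (u : sobolevH2 n) :
    E / 4 * c * ‖weight n ((1 + ε) / 2) hs u‖ ^ 2
      ≤ 2 * em * A ^ 4 / (c * h ^ 2) * ‖G‖ ^ 2
        + 1 / (2 * θ) * ‖(-(h : ℂ) ^ 2) • laplacian n u + mulOp V hV u - (E : ℂ) • (u : L2 n)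
          - weight n ((1 + ε) / 2) hs G‖ ^ 2
        + θ / 2 * (8 * em ^ 2 * A ^ 4 * (κ / h + n) ^ 2)
          * (‖laplacian n u‖ ^ 2 + 2 * ‖(u : L2 n)‖ ^ 2) := by
  refine closed_induction_test (p := fun z => E / 4 * c * ‖weight n ((1 + ε) / 2) hs z.1‖ ^ 2
      ≤ 2 * em * A ^ 4 / (c * h ^ 2) * ‖G‖ ^ 2
        + 1 / (2 * θ) * ‖(-(h : ℂ) ^ 2) • z.2 + mulOp V hV z.1 - (E : ℂ) • z.1
          - weight n ((1 + ε) / 2) hs G‖ ^ 2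
        + θ / 2 * (8 * em ^ 2 * A ^ 4 * (κ / h + n) ^ 2)
          * (‖z.2‖ ^ 2 + 2 * ‖z.1‖ ^ 2)) ?_ (fun F hF => ?_) u
  · exact isClosed_le (by fun_prop) (by fun_prop)
  obtain ⟨u, hu⟩ : ∃ u : L2 n, u = F.toLp 2 volume := ⟨_, rfl⟩
  obtain ⟨v, hv⟩ : ∃ v : L2 n, v = (Δ F : 𝓢(Rn n, ℂ)).toLp 2 volume := ⟨_, rfl⟩
  simp only [← hu, ← hv]
  have hFs : ContDiff ℝ (⊤ : ℕ∞) F := F.smooth _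
  have hua : ∀ᵐ x, u x = F x := hu ▸ F.coeFn_toLp 2 volume
  have hva : ∀ᵐ x, v x = lap F x := by
    rw [hv, ← schwartz_laplacian_eq_lap]
    exact (Δ F : 𝓢(Rn n, ℂ)).coeFn_toLp 2 volume
  obtain ⟨ρ, hρ⟩ : ∃ ρ : L2 n, ρ = (-(h : ℂ) ^ 2) • v + mulOp V hV u - (E : ℂ) • u
      - weight n ((1 + ε) / 2) hs G := ⟨_, rfl⟩
  have hwG : ∀ᵐ x, weight n ((1 + ε) / 2) hs G x = (weightFun n ε x : ℂ) * G x :=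
    mulOp_ae _ (memLp_weight n hs) G
  have hwu : ∀ᵐ x, weight n ((1 + ε) / 2) hs u x = (weightFun n ε x : ℂ) * u x :=
    mulOp_ae _ (memLp_weight n hs) u
  have hρa : ∀ᵐ x, ρ x = ((-h ^ 2 : ℝ) : ℂ) * lap F x + ((V x - E : ℝ) : ℂ) * F x
      - (weightFun n ε x : ℂ) * G x := by
    rw [hρ]
    filter_upwards [hua, hva, hwG, mulOp_ae V hV u,
      Lp.coeFn_sub ((-(h : ℂ) ^ 2) • v + mulOp V hV u - (E : ℂ) • u) (weight n ((1 + ε) / 2) hs G),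
      Lp.coeFn_sub ((-(h : ℂ) ^ 2) • v + mulOp V hV u) ((E : ℂ) • u),
      Lp.coeFn_add ((-(h : ℂ) ^ 2) • v) (mulOp V hV u), Lp.coeFn_smul (-(h : ℂ) ^ 2) v,
      Lp.coeFn_smul (E : ℂ) u] with x h1 h2 h3 h4 h5 h6 h7 h8 h9
    rw [h5, Pi.sub_apply, h6, Pi.sub_apply, h7, Pi.add_apply, h8, h9, Pi.smul_apply, Pi.smul_apply,
      h3, h4, h1, h2]
    push_cast
    simp only [smul_eq_mul]
    ring
  rw [← hρ]
  -- the estimate for the real and the imaginary part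
  have part : ∀ L : ℂ →L[ℝ] ℝ, E / 4 * c * (∫ x, L (weight n ((1 + ε) / 2) hs u x) ^ 2)
      ≤ 2 * em * A ^ 4 / (c * h ^ 2) * (∫ x, L (G x) ^ 2) + 1 / (2 * θ) * (∫ x, L (ρ x) ^ 2)
        + θ / 2 * (8 * em ^ 2 * A ^ 4 * (κ / h + n) ^ 2)
          * ((∫ x, L (v x) ^ 2) + 2 * ∫ x, L (u x) ^ 2) := by
    intro L
    have hL : ∀ (a : ℝ) (z : ℂ), L ((a : ℂ) * z) = a * L z := fun a z => by
      rw [← Complex.real_smul, map_smul, smul_eq_mul]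
    have key := carleman_test hn H HV (f := fun x => L (F x)) (G := fun x => L (G x))
      (L.contDiff.comp hFs) (hF.comp_left (g := L) (map_zero L)) (L.comp_memLp' (Lp.memLp G)) hc hem hθ
    have e1 : ∫ x, L (weight n ((1 + ε) / 2) hs u x) ^ 2
        = ∫ x, (weightFun n ε x * L (F x)) ^ 2 := by
      refine integral_congr_ae ?_
      filter_upwards [hua, hwu] with x h1 h2
      rw [h2, hL, h1]
    have e2 : ∫ x, L (ρ x) ^ 2 = ∫ x, (-h ^ 2 * lap (fun x => L (F x)) x
        + (W x + U x - E) * L (F x) - weightFun n ε x * L (G x)) ^ 2 := by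
      refine integral_congr_ae ?_
      filter_upwards [hρa] with x h1
      rw [h1, map_sub, map_add, hL, hL, hL, lap_clm_comp L hFs, hWU]
    have e3 : ∫ x, L (v x) ^ 2 = ∫ x, lap (fun x => L (F x)) x ^ 2 := by
      refine integral_congr_ae ?_
      filter_upwards [hva] with x h1
      rw [h1, lap_clm_comp L hFs]
    have e4 : ∫ x, L (u x) ^ 2 = ∫ x, L (F x) ^ 2 := by
      refine integral_congr_ae ?_
      filter_upwards [hua] with x h1
      rw [h1]
    rw [e1, e2, e3, e4]
    exact key
  have h1 := part Complex.reCLM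
  have h2 := part Complex.imCLM
  simp only [norm_sq_eq_integral]
  linarith

/-- If `a > g`, the quadratic inequality becomes linear. -/
lemma le_of_quadratic_le {c X a g : ℝ} (hc : 0 < c) (hX : 0 ≤ X) (hg : 0 ≤ g)
    (h : c * a ^ 2 ≤ X * (g ^ 2 + a * g)) : a ≤ (1 + 2 / c * X) * g := by
  have h1 : 0 ≤ 2 / c * X * g := by positivity
  rcases le_total a g with hag | hga
  · linarith
  · have hg2 : g ^ 2 ≤ a * g := by
      rw [sq]
      gcongr
    have e1 : c * a * a ≤ 2 * X * g * a := by
      have : X * (g ^ 2 + a * g) ≤ X * (a * g + a * g) := by gcongr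
      linarith
    rcases eq_or_lt_of_le (hg.trans hga) with h0 | hapos
    · rw [← h0]
      linarith
    · have e2 := le_of_mul_le_mul_right e1 hapos
      have e3 : a ≤ 2 / c * X * g := by
        rw [div_mul_eq_mul_div, div_mul_eq_mul_div, le_div_iff₀ hc]
        linarith
      linarith

/-- The weighted resolvent bound for the critical weight. -/
theorem norm_weighted_resolvent_le (hn : 3 ≤ n) {h E ε κ A C₃ C₄ K pm : ℝ}
    (H : CarlemanParams h E ε κ A C₃ C₄ K pm) {V W U : Rn n → ℝ}
    (HV : SplitPotential E C₃ C₄ K pm W U) (hV : MemLp V ∞ (volume : Measure (Rn n)))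
    (hWU : ∀ x, V x = W x + U x) {em c : ℝ} (hc : c = 2 ^ (-(2 / ε)))
    (hem : em = Real.exp (2 * κ / h * Real.log (1 + A))) {θ : ℝ} (hθ : 0 < θ) (hθ1 : θ < 1)
    {σ : ℝ} (hσ : σ = 1 ∨ σ = -1) {R : L2 n →L[ℂ] L2 n}
    (hR : IsResolvent (schrodinger h V hV) ((E : ℂ) - σ * θ * Complex.I) R)
    (hs : 0 ≤ (1 + ε) / 2) :
    ‖weight n ((1 + ε) / 2) hs ∘L R ∘L weight n ((1 + ε) / 2) hs‖
      ≤ 1 + 2 / (E / 4 * c) * (2 * em * A ^ 4 / (c * h ^ 2) + 1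
        + 8 * em ^ 2 * A ^ 4 * (κ / h + n) ^ 2 * (1 + (1 + (‖mulOp V hV‖ + E + 1) ^ 2) / h ^ 4)) := by
  obtain ⟨w, hw⟩ : ∃ w, w = weight n ((1 + ε) / 2) hs := ⟨_, rfl⟩
  rw [← hw]
  have hh := H.h_pos
  have hE := H.E_pos
  have hκ := H.κ_pos
  have hA0 : 0 < A := by linarith [H.one_le_A]
  have hc0 : 0 < c := by rw [hc]; positivity
  have hem0 : 0 < em := by rw [hem]; positivity
  obtain ⟨Q, hQ⟩ : ∃ Q, Q = ‖mulOp V hV‖ + E + 1 := ⟨_, rfl⟩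
  obtain ⟨K₂, hK₂⟩ : ∃ K₂, K₂ = 8 * em ^ 2 * A ^ 4 * (κ / h + n) ^ 2 := ⟨_, rfl⟩
  obtain ⟨K₁, hK₁⟩ : ∃ K₁, K₁ = 2 * em * A ^ 4 / (c * h ^ 2) := ⟨_, rfl⟩
  rw [← hQ, ← hK₁, ← hK₂]
  have hK₂0 : 0 ≤ K₂ := by rw [hK₂]; positivity
  have hK₁0 : 0 ≤ K₁ := by rw [hK₁]; positivity
  have hQ0 : 0 ≤ Q := by rw [hQ]; positivity
  obtain ⟨X, hX⟩ : ∃ X, X = K₁ + 1 + K₂ * (1 + (1 + Q ^ 2) / h ^ 4) := ⟨_, rfl⟩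
  rw [← hX]
  have hX0 : 0 ≤ X := by rw [hX]; positivity
  refine ContinuousLinearMap.opNorm_le_bound _ (by positivity) fun G => ?_
  simp only [ContinuousLinearMap.comp_apply]
  obtain ⟨u, hu⟩ : ∃ u : sobolevH2 n, (u : L2 n) = R (w G) := ⟨⟨R (w G), hR.mem_domain _⟩, rfl⟩
  rw [← hu]
  have hwG : ‖w G‖ ≤ ‖G‖ := hw ▸ norm_weight_apply_le hs G
  -- the equation `(P - E) u - w G = -iσθ u`
  have heq : (-(h : ℂ) ^ 2) • laplacian n u + mulOp V hV u - ((E : ℂ) - σ * θ * Complex.I) • (u : L2 n)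
      = w G := by
    have h1 := hR.right_inv (w G)
    have h2 : (⟨R (w G), hR.mem_domain _⟩ : (schrodinger h V hV).domain) = u := Subtype.ext hu.symm
    rw [h2, schrodinger_apply, ← hu] at h1
    exact h1
  have hσ1 : ‖(σ : ℂ)‖ = 1 := by
    rcases hσ with rfl | rfl <;> simp
  have hres : ‖(-(h : ℂ) ^ 2) • laplacian n u + mulOp V hV u - (E : ℂ) • (u : L2 n) - w G‖
      = θ * ‖(u : L2 n)‖ := by
    have : (-(h : ℂ) ^ 2) • laplacian n u + mulOp V hV u - (E : ℂ) • (u : L2 n) - w G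
        = -((σ * θ * Complex.I : ℂ) • (u : L2 n)) := by
      rw [← heq]
      module
    rw [this, norm_neg, norm_smul, norm_mul, norm_mul, hσ1, Complex.norm_I, Complex.norm_real,
      Real.norm_of_nonneg hθ.le]
    ring
  have hlap : h ^ 2 * ‖laplacian n u‖ ≤ ‖G‖ + Q * ‖(u : L2 n)‖ := by
    have e1 : ((h : ℂ) ^ 2) • laplacian n u = (mulOp V hV u
        - ((E : ℂ) - σ * θ * Complex.I) • (u : L2 n)) - w G := by
      rw [← heq]
      module
    have e2 : ‖((h : ℂ) ^ 2) • laplacian n u‖ = h ^ 2 * ‖laplacian n u‖ := by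
      rw [norm_smul, norm_pow, Complex.norm_real, Real.norm_of_nonneg hh.le]
    have e3 : ‖(E : ℂ) - σ * θ * Complex.I‖ ≤ E + 1 := by
      refine (norm_sub_le _ _).trans ?_
      rw [norm_mul, norm_mul, hσ1, Complex.norm_I, Complex.norm_real, Complex.norm_real,
        Real.norm_of_nonneg hθ.le, Real.norm_of_nonneg hE.le]
      linarith
    have e4 := (mulOp V hV).le_opNorm u
    rw [← e2, e1]
    calc _ ≤ ‖mulOp V hV u‖ + ‖((E : ℂ) - σ * θ * Complex.I) • (u : L2 n)‖ + ‖w G‖ :=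
          (norm_sub_le _ _).trans (add_le_add_left (norm_sub_le _ _) _)
      _ ≤ ‖mulOp V hV‖ * ‖(u : L2 n)‖ + (E + 1) * ‖(u : L2 n)‖ + ‖G‖ := by
          rw [norm_smul]
          gcongr
      _ = ‖G‖ + Q * ‖(u : L2 n)‖ := by rw [hQ]; ring
  have him : θ * ‖(u : L2 n)‖ ^ 2 ≤ ‖w u‖ * ‖G‖ := by
    have h1 := hR.im_inner (isSymm_schrodinger h V hV) (w G)
    have h2 : |((E : ℂ) - σ * θ * Complex.I).im| = θ := by
      rcases hσ with rfl | rfl <;> simp [abs_of_pos hθ]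
    rw [h2, ← hu] at h1
    rw [h1, hw, inner_weight]
    exact (Complex.abs_im_le_norm _).trans (norm_inner_le_norm _ _)
  have main := carleman_sobolev hn H HV hV hWU hc hem hθ hs G u
  rw [← hw, hres, ← hK₁, ← hK₂] at main
  obtain ⟨a, ha⟩ : ∃ a, a = ‖w u‖ := ⟨_, rfl⟩
  obtain ⟨g, hg⟩ : ∃ g, g = ‖G‖ := ⟨_, rfl⟩
  obtain ⟨b, hb⟩ : ∃ b, b = ‖(u : L2 n)‖ := ⟨_, rfl⟩
  obtain ⟨l, hl⟩ : ∃ l, l = ‖laplacian n u‖ := ⟨_, rfl⟩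
  have ha0 : 0 ≤ a := ha ▸ norm_nonneg _
  have hg0 : 0 ≤ g := hg ▸ norm_nonneg _
  have hl0 : 0 ≤ l := hl ▸ norm_nonneg _
  rw [← ha, ← hg, ← hb, ← hl] at main
  rw [← ha, ← hg, ← hb] at him
  rw [← hg, ← hb, ← hl] at hlap
  rw [← ha, ← hg]
  have hX4 : E / 4 * c * a ^ 2 ≤ X * (g ^ 2 + a * g) := by
    have e1 : θ * l ^ 2 ≤ 2 / h ^ 4 * (g ^ 2 + Q ^ 2 * (a * g)) := by
      rw [div_mul_eq_mul_div, le_div_iff₀ (by positivity)]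
      calc θ * l ^ 2 * h ^ 4 = θ * (h ^ 2 * l) ^ 2 := by ring
        _ ≤ θ * (g + Q * b) ^ 2 := by gcongr
        _ ≤ θ * (2 * (g ^ 2 + (Q * b) ^ 2)) := by gcongr; exact add_sq_le
        _ = 2 * (θ * g ^ 2 + Q ^ 2 * (θ * b ^ 2)) := by ring
        _ ≤ 2 * (1 * g ^ 2 + Q ^ 2 * (a * g)) := by gcongr
        _ = _ := by ring
    have e2 : 1 / (2 * θ) * (θ * b) ^ 2 = θ * b ^ 2 / 2 := by field_simp
    rw [e2] at main
    have e3 : θ / 2 * K₂ * (l ^ 2 + 2 * b ^ 2)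
        ≤ K₂ * (1 / h ^ 4 * (g ^ 2 + Q ^ 2 * (a * g)) + a * g) := by
      calc θ / 2 * K₂ * (l ^ 2 + 2 * b ^ 2) = K₂ * (θ * l ^ 2 / 2 + θ * b ^ 2) := by ring
        _ ≤ K₂ * (2 / h ^ 4 * (g ^ 2 + Q ^ 2 * (a * g)) / 2 + a * g) := by gcongr
        _ = _ := by ring
    have hag : 0 ≤ a * g := mul_nonneg ha0 hg0
    have e4 : K₂ * (1 / h ^ 4 * (g ^ 2 + Q ^ 2 * (a * g)) + a * g)
        ≤ K₂ * (1 + (1 + Q ^ 2) / h ^ 4) * (g ^ 2 + a * g) := by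
      have : K₂ * (1 + (1 + Q ^ 2) / h ^ 4) * (g ^ 2 + a * g)
          = K₂ * (1 / h ^ 4 * (g ^ 2 + Q ^ 2 * (a * g)) + a * g)
            + K₂ * (g ^ 2 + Q ^ 2 / h ^ 4 * g ^ 2 + 1 / h ^ 4 * (a * g)) := by ring
      rw [this]
      have : 0 ≤ K₂ * (g ^ 2 + Q ^ 2 / h ^ 4 * g ^ 2 + 1 / h ^ 4 * (a * g)) := by positivity
      linarith
    have e5 : 0 ≤ K₁ * (a * g) := by positivity
    have e6 : 0 ≤ g ^ 2 := by positivity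
    have e7 : X * (g ^ 2 + a * g) = K₁ * g ^ 2 + K₁ * (a * g) + (g ^ 2 + a * g)
      + K₂ * (1 + (1 + Q ^ 2) / h ^ 4) * (g ^ 2 + a * g) := by rw [hX]; ring
    linarith
  exact le_of_quadratic_le (by positivity) hX0 hg0 hX4

end SemiclassicalResolvent

/-! ### Splitting the potential -/

namespace SemiclassicalResolvent

variable {n : ℕ}

/-- The cutoff `1 - (r₀/r)³` for `r ≥ r₀`, extended by zero. It removes the long-range potential
where nothing is known about it and costs only a short-range error. -/
noncomputable def radialCutoff (r₀ r : ℝ) : ℝ := 1 - (r₀ / max r r₀) ^ 3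

lemma radialCutoff_of_le {r₀ r : ℝ} (hr₀ : 0 < r₀) (hr : r ≤ r₀) : radialCutoff r₀ r = 0 := by
  rw [radialCutoff, max_eq_right hr, div_self hr₀.ne']
  norm_num

lemma radialCutoff_mem {r₀ : ℝ} (hr₀ : 0 < r₀) (r : ℝ) :
    0 ≤ radialCutoff r₀ r ∧ radialCutoff r₀ r ≤ 1 := by
  have h1 : r₀ / max r r₀ ≤ 1 := (div_le_one (lt_max_of_lt_right hr₀)).2 (le_max_right _ _)
  have h2 : 0 ≤ r₀ / max r r₀ := div_nonneg hr₀.le (hr₀.le.trans (le_max_right _ _))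
  have h3 : (r₀ / max r r₀) ^ 3 ≤ 1 := pow_le_one₀ h2 h1
  have h4 : 0 ≤ (r₀ / max r r₀) ^ 3 := by positivity
  constructor <;> rw [radialCutoff] <;> linarith

lemma one_sub_radialCutoff_le {r₀ r : ℝ} (hr₀ : 0 < r₀) (hr : 0 ≤ r) :
    1 - radialCutoff r₀ r ≤ (1 + r₀) ^ 3 / (1 + r) ^ 3 := by
  rw [radialCutoff, sub_sub_cancel, ← div_pow]
  have hm : 0 < max r r₀ := lt_max_of_lt_right hr₀
  refine pow_le_pow_left₀ (by positivity) ?_ 3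
  rw [div_le_div_iff₀ hm (by positivity)]
  have h1 := le_max_left r r₀
  have h2 := le_max_right r r₀
  nlinarith

lemma continuous_radialCutoff {r₀ : ℝ} (hr₀ : 0 < r₀) : Continuous (radialCutoff r₀) := by
  unfold radialCutoff
  have : ∀ r : ℝ, max r r₀ ≠ 0 := fun r => (lt_max_of_lt_right hr₀).ne'
  fun_prop (disch := assumption)

/-- On a ray along which the potential is `C¹` beyond `r₀`, the cut-off potential is continuous up
to the origin and its right derivative is bounded above. -/
lemma radialCutoff_mul_slice {r₀ C₂ β P : ℝ} (hr₀ : 0 < r₀) (hC₂ : 0 < C₂) (hβ : 3 ≤ β)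
    (hP : 0 ≤ P) {v : ℝ → ℝ} (hv : ContDiffOn ℝ 1 v (Ici r₀)) (hvP : ∀ r, r₀ ≤ r → v r ≤ P)
    (hv' : ∀ r, r₀ ≤ r → derivWithin v (Ici r₀) r ≤ C₂ * (r + 1) ^ (-β)) :
    Continuous (fun r => radialCutoff r₀ r * v r) ∧
    ∀ r : ℝ, 0 < r → ∃ d, d ≤ (3 * r₀ ^ 2 * P * ((1 + r₀) / r₀) ^ 3 + C₂) / (1 + r) ^ 3 ∧
      HasDerivWithinAt (fun r => radialCutoff r₀ r * v r) d (Ioi r) r := by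
  have hmax : (fun r => radialCutoff r₀ r * v r) = fun r => radialCutoff r₀ r * v (max r r₀) := by
    ext r
    rcases le_total r r₀ with h | h
    · rw [radialCutoff_of_le hr₀ h, zero_mul, zero_mul]
    · rw [max_eq_left h]
  constructor
  · rw [hmax]
    refine (continuous_radialCutoff hr₀).mul ?_
    exact hv.continuousOn.comp_continuous (by fun_prop) fun r => le_max_right r r₀
  · intro r hr
    rcases lt_or_ge r r₀ with h | h
    · refine ⟨0, by positivity, HasDerivAt.hasDerivWithinAt ?_⟩
      refine (hasDerivAt_const r (0 : ℝ)).congr_of_eventuallyEq ?_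
      filter_upwards [Iio_mem_nhds h] with t ht
      rw [radialCutoff_of_le hr₀ (mem_Iio.1 ht).le, zero_mul]
    · have h1 : HasDerivWithinAt v (derivWithin v (Ici r₀) r) (Ioi r) r :=
        ((hv.differentiableOn (by simp)) r h).hasDerivWithinAt.mono
          fun t ht => h.trans (mem_Ioi.1 ht).le
      have h2 : HasDerivAt (fun t : ℝ => 1 - (r₀ / t) ^ 3) (3 * r₀ ^ 3 / r ^ 4) r := by
        have := ((((hasDerivAt_id' r).fun_inv hr.ne').const_mul r₀).fun_pow 3).const_sub 1
        refine (this.congr_deriv ?_).congr_of_eventuallyEq (Eventually.of_forall fun t => ?_)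
        · rw [show 3 - 1 = 2 from rfl, ← div_eq_mul_inv]
          push_cast
          field_simp
        · simp only [div_eq_mul_inv]
      have h3 := h2.hasDerivWithinAt.fun_mul h1 (s := Ioi r)
      have h4 : ∀ t, r ≤ t → radialCutoff r₀ t * v t = (1 - (r₀ / t) ^ 3) * v t := fun t ht => by
        rw [radialCutoff, max_eq_left (h.trans ht)]
      refine ⟨_, ?_, h3.congr (fun t ht => h4 t (mem_Ioi.1 ht).le) (h4 r le_rfl)⟩
      have k1 : r₀ / r ≤ 1 := (div_le_one hr).2 h
      have k2 : 0 ≤ 1 - (r₀ / r) ^ 3 := sub_nonneg.2 (pow_le_one₀ (by positivity) k1)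
      have k3 : (1 - (r₀ / r) ^ 3) ≤ 1 := by
        have : 0 ≤ (r₀ / r) ^ 3 := by positivity
        linarith
      have k4 : C₂ * (r + 1) ^ (-β) ≤ C₂ / (1 + r) ^ 3 := by
        rw [div_eq_mul_inv]
        gcongr
        calc (r + 1) ^ (-β) ≤ (r + 1) ^ (-(3 : ℕ) : ℝ) := by
              refine Real.rpow_le_rpow_of_exponent_le (by linarith) ?_
              push_cast
              linarith
          _ = ((1 + r) ^ 3)⁻¹ := by
              rw [Real.rpow_neg (by positivity), Real.rpow_natCast, add_comm]
      have k5 : 3 * r₀ ^ 3 / r ^ 4 * v r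
          ≤ 3 * r₀ ^ 2 * P * ((1 + r₀) / r₀) ^ 3 / (1 + r) ^ 3 := by
        have e1 : 1 / r ≤ (1 + r₀) / r₀ / (1 + r) := by
          rw [div_div, div_le_div_iff₀ hr (by positivity)]
          nlinarith
        calc 3 * r₀ ^ 3 / r ^ 4 * v r ≤ 3 * r₀ ^ 3 / r ^ 4 * P := by
              gcongr
              exact hvP r h
          _ = 3 * r₀ ^ 2 * P * (r₀ / r) * (1 / r) ^ 3 := by field_simp
          _ ≤ 3 * r₀ ^ 2 * P * 1 * ((1 + r₀) / r₀ / (1 + r)) ^ 3 := by gcongr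
          _ = _ := by field_simp
      have k6 : (1 - (r₀ / r) ^ 3) * derivWithin v (Ici r₀) r ≤ C₂ / (1 + r) ^ 3 := by
        calc _ ≤ (1 - (r₀ / r) ^ 3) * (C₂ * (r + 1) ^ (-β)) := by
              gcongr
              exact hv' r h
          _ ≤ 1 * (C₂ * (r + 1) ^ (-β)) := by gcongr
          _ ≤ _ := by rwa [one_mul]
      rw [add_div]
      exact add_le_add k5 k6

/-- The hypotheses on the potential provide a splitting to which the Carleman estimate applies. -/
theorem exists_splitPotential (hn : 0 < n) {VL VS : Rn n → ℝ}
    (hV : MemLp (fun x => VL x + VS x) ∞ (volume : Measure (Rn n)))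
    (hVSmeas : AEStronglyMeasurable VS (volume : Measure (Rn n)))
    {r₀ C₁ C₂ δ β : ℝ} (hr₀ : 0 < r₀) (hC₁ : 0 < C₁) (hC₂ : 0 < C₂) (hδ : 3 < δ) (hβ : 3 ≤ β)
    (hVS : ∀ᵐ x : Rn n, |VS x| ≤ C₁ * (‖x‖ + 1) ^ (-δ))
    {p : ℝ → ℝ} (hp_pos : ∀ r, r₀ ≤ r → 0 < p r) (hp_anti : AntitoneOn p (Ici r₀))
    (hp_lim : Tendsto p atTop (𝓝 0))
    (hVL : ∀ᵐ ω : Metric.sphere (0 : Rn n) 1 ∂(volume : Measure (Rn n)).toSphere,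
      ContDiffOn ℝ 1 (fun t : ℝ => VL (t • (ω : Rn n))) (Ici r₀) ∧
      ∀ r, r₀ ≤ r →
        VL (r • (ω : Rn n)) ≤ p r ∧
        derivWithin (fun t : ℝ => VL (t • (ω : Rn n))) (Ici r₀) r
          ≤ C₂ * (r + 1) ^ (-β))
    {E : ℝ} (hE : 0 < E) :
    ∃ (C₃ C₄ K pm : ℝ) (W U : Rn n → ℝ), 0 ≤ C₃ ∧ 1 ≤ K ∧ C₃ / K ≤ E / 8 ∧
      SplitPotential E C₃ C₄ K pm W U ∧ ∀ x, VL x + VS x = W x + U x := by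
  have hP0 : 0 < p r₀ := hp_pos r₀ le_rfl
  obtain ⟨C₃, hC₃⟩ : ∃ C₃, C₃ = 3 * r₀ ^ 2 * p r₀ * ((1 + r₀) / r₀) ^ 3 + C₂ := ⟨_, rfl⟩
  have hC₃0 : 0 < C₃ := by rw [hC₃]; positivity
  obtain ⟨r₁, hr₁⟩ := eventually_atTop.1 (hp_lim.eventually (Iio_mem_nhds (by positivity : 0 < E / 4)))
  have hVS1 : ∀ᵐ x : Rn n, |VS x| ≤ C₁ / (1 + ‖x‖) ^ 3 := by
    filter_upwards [hVS] with x hx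
    refine hx.trans ?_
    rw [div_eq_mul_inv]
    gcongr
    calc (‖x‖ + 1) ^ (-δ) ≤ (‖x‖ + 1) ^ (-(3 : ℕ) : ℝ) := by
          refine Real.rpow_le_rpow_of_exponent_le (by simp) ?_
          push_cast
          linarith
      _ = ((1 + ‖x‖) ^ 3)⁻¹ := by
          rw [Real.rpow_neg (by positivity), Real.rpow_natCast, add_comm]
  obtain ⟨B, hB0, hB⟩ : ∃ B, 0 ≤ B ∧ ∀ᵐ x : Rn n, |VL x| ≤ B := by
    refine ⟨(eLpNormEssSup (fun x => VL x + VS x) volume).toReal + C₁, by positivity, ?_⟩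
    have hfin : eLpNormEssSup (fun x => VL x + VS x) (volume : Measure (Rn n)) ≠ ∞ := by
      have := hV.2
      rw [eLpNorm_exponent_top] at this
      exact this.ne
    filter_upwards [ae_le_eLpNormEssSup (f := fun x => VL x + VS x) (μ := volume), hVS1]
      with x h1 h2
    have h3 : |VL x + VS x| ≤ (eLpNormEssSup (fun x => VL x + VS x) volume).toReal := by
      have := ENNReal.toReal_mono hfin h1
      rwa [toReal_enorm, Real.norm_eq_abs] at this
    have h4 : C₁ / (1 + ‖x‖) ^ 3 ≤ C₁ := div_le_self hC₁.le (one_le_pow₀ (by simp))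
    have h5 : |VL x| ≤ |VL x + VS x| + |VS x| := by
      have := abs_sub (VL x + VS x) (VS x)
      rwa [add_sub_cancel_right] at this
    linarith
  have hray : ∀ {P : Rn n → Prop}, (∀ᵐ ω : Metric.sphere (0 : Rn n) 1
      ∂(volume : Measure (Rn n)).toSphere, ∀ r : ℝ, 0 < r → P (r • (ω : Rn n))) → ∀ᵐ x, P x :=
    fun h => ae_of_ae_ray hn h
  have hnorm : ∀ (ω : Metric.sphere (0 : Rn n) 1) (r : ℝ), 0 ≤ r → ‖r • (ω : Rn n)‖ = r := by
    intro ω r hr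
    rw [norm_smul, Real.norm_of_nonneg hr]
    simp
  have hle : ∀ᵐ x : Rn n, r₀ ≤ ‖x‖ → VL x ≤ p ‖x‖ := by
    refine hray ?_
    filter_upwards [hVL] with ω hω r hr h
    rw [hnorm ω r hr.le] at h ⊢
    exact (hω.2 r h).1
  refine ⟨C₃, (1 + r₀) ^ 3 * B + C₁, max (max 1 (1 + r₁)) (8 * C₃ / E), p r₀,
    fun x => radialCutoff r₀ ‖x‖ * VL x, fun x => VL x + VS x - radialCutoff r₀ ‖x‖ * VL x,
    hC₃0.le, ?_, ?_, ?_, fun x => by ring⟩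
  · exact (le_max_left _ _).trans (le_max_left _ _)
  · rw [div_le_iff₀ (by positivity)]
    calc C₃ = E / 8 * (8 * C₃ / E) := by field_simp
      _ ≤ _ := by gcongr; exact le_max_right _ _
  have hVLmeas : AEStronglyMeasurable VL (volume : Measure (Rn n)) := by
    refine (hV.1.sub hVSmeas).congr (Eventually.of_forall fun x => ?_)
    simp
  have hWmeas : AEStronglyMeasurable (fun x => radialCutoff r₀ ‖x‖ * VL x)
      (volume : Measure (Rn n)) :=
    ((continuous_radialCutoff hr₀).comp continuous_norm).aestronglyMeasurable.mul hVLmeas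
  refine ⟨hWmeas, ⟨B, ?_⟩, ?_, ?_, ?_, hV.1.sub hWmeas, ?_⟩
  · filter_upwards [hB] with x hx
    obtain ⟨h1, h2⟩ := radialCutoff_mem hr₀ ‖x‖
    rw [abs_mul, abs_of_nonneg h1]
    exact (mul_le_of_le_one_left (abs_nonneg _) h2).trans hx
  · filter_upwards [hVL] with ω hω
    obtain ⟨h1, h2⟩ := radialCutoff_mul_slice hr₀ hC₂ hβ hP0.le hω.1
      (fun r hr => (hω.2 r hr).1.trans (hp_anti self_mem_Ici hr hr)) fun r hr => (hω.2 r hr).2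
    rw [← hC₃] at h2
    have h3 : ∀ r, 0 ≤ r → radialCutoff r₀ ‖r • (ω : Rn n)‖ * VL (r • (ω : Rn n))
        = radialCutoff r₀ r * VL (r • (ω : Rn n)) := fun r hr => by rw [hnorm ω r hr]
    refine ⟨h1.continuousOn.congr fun r hr => h3 r hr, fun r hr => ?_⟩
    obtain ⟨d, hd1, hd2⟩ := h2 r hr
    exact ⟨d, hd1, hd2.congr (fun t ht => h3 t (hr.trans (mem_Ioi.1 ht)).le) (h3 r hr.le)⟩
  · filter_upwards [hle] with x hx
    obtain ⟨h1, h2⟩ := radialCutoff_mem hr₀ ‖x‖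
    rcases le_total ‖x‖ r₀ with h | h
    · rw [radialCutoff_of_le hr₀ h, zero_mul]
      exact hP0.le
    · calc radialCutoff r₀ ‖x‖ * VL x ≤ radialCutoff r₀ ‖x‖ * p ‖x‖ := by gcongr; exact hx h
        _ ≤ 1 * p ‖x‖ := by gcongr; exact (hp_pos _ h).le
        _ ≤ p r₀ := by rw [one_mul]; exact hp_anti self_mem_Ici h h
  · filter_upwards [hle] with x hx hK
    obtain ⟨h1, h2⟩ := radialCutoff_mem hr₀ ‖x‖
    rcases le_total ‖x‖ r₀ with h | h
    · rw [radialCutoff_of_le hr₀ h, zero_mul]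
      positivity
    · have h3 : r₁ ≤ ‖x‖ := by
        have := ((le_max_right 1 (1 + r₁)).trans (le_max_left _ _)).trans hK
        linarith
      calc radialCutoff r₀ ‖x‖ * VL x ≤ radialCutoff r₀ ‖x‖ * p ‖x‖ := by gcongr; exact hx h
        _ ≤ 1 * p ‖x‖ := by gcongr; exact (hp_pos _ h).le
        _ ≤ E / 4 := by rw [one_mul]; exact (hr₁ _ h3).le
  · filter_upwards [hB, hVS1] with x h1 h2
    obtain ⟨h3, h4⟩ := radialCutoff_mem hr₀ ‖x‖
    have h5 := one_sub_radialCutoff_le hr₀ (norm_nonneg x)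
    have h6 : VL x + VS x - radialCutoff r₀ ‖x‖ * VL x = (1 - radialCutoff r₀ ‖x‖) * VL x + VS x := by
      ring
    rw [h6, add_div]
    refine (abs_add_le _ _).trans (add_le_add ?_ h2)
    rw [abs_mul, abs_of_nonneg (sub_nonneg.2 h4), mul_div_right_comm]
    gcongr

end SemiclassicalResolvent

/-! ### The choice of parameters -/

namespace SemiclassicalResolvent

variable {n : ℕ}

/-- For small `h`, the parameters `κ ∼ h^{-1/3}` and `A = h^{-M}` are admissible: the short-range
potential forces `h κ³ ≳ 1`, which is the source of the exponent `4/3`. -/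
lemma exists_carlemanParams {E ε C₃ C₄ K pm : ℝ} (hE : 0 < E) (hε : 0 < ε) (hε1 : ε ≤ 1)
    (hC₃ : 0 ≤ C₃) (hK : 1 ≤ K) (hC₃K : C₃ / K ≤ E / 8) :
    ∃ κ₀ M h₁ : ℝ, 0 < κ₀ ∧ 0 < M ∧ 0 < h₁ ∧ ∀ h, 0 < h → h ≤ h₁ →
      CarlemanParams h E ε (κ₀ * h ^ (-(1 / 3) : ℝ)) (h ^ (-M)) C₃ C₄ K pm := by
  obtain ⟨κ₀, hκ₀⟩ : ∃ κ₀, κ₀ = 1 + 8 * C₄ ^ 2 + 8 * K ^ 4 * (|pm| + C₃) := ⟨_, rfl⟩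
  have hK0 : 0 < K := by linarith
  have hκ1 : 1 + 8 * C₄ ^ 2 ≤ κ₀ := by
    have : 0 ≤ 8 * K ^ 4 * (|pm| + C₃) := by positivity
    linarith
  have hκ2 : 8 * K ^ 4 * (|pm| + C₃) ≤ κ₀ := by
    have : 0 ≤ 1 + 8 * C₄ ^ 2 := by positivity
    linarith
  have hκone : 1 ≤ κ₀ := by
    have : 0 ≤ 8 * C₄ ^ 2 := by positivity
    linarith
  have hκ0 : 0 < κ₀ := by linarith
  obtain ⟨S, hS⟩ : ∃ S, S = 3 * κ₀ ^ 2 + 2 * κ₀ + 2 * C₄ ^ 2 := ⟨_, rfl⟩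
  have hS0 : 0 < S := by rw [hS]; positivity
  refine ⟨κ₀, 1 / ε + 2, min (1 / K) ((E / 8 / S) ^ 3), hκ0, by positivity, by positivity, ?_⟩
  intro h hh hle
  have hhK : h ≤ 1 / K := hle.trans (min_le_left _ _)
  have hh1 : h ≤ 1 := hhK.trans ((div_le_one hK0).2 hK)
  have hhS : h ^ (1 / 3 : ℝ) ≤ E / 8 / S := by
    calc h ^ (1 / 3 : ℝ) ≤ ((E / 8 / S) ^ 3) ^ (1 / 3 : ℝ) := by
          gcongr
          exact hle.trans (min_le_right _ _)
      _ = E / 8 / S := by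
          rw [← Real.rpow_natCast, ← Real.rpow_mul (by positivity)]
          norm_num
  have hpow : ∀ a : ℝ, 1 / 3 ≤ a → h ^ a ≤ h ^ (1 / 3 : ℝ) := fun a ha =>
    Real.rpow_le_rpow_of_exponent_ge hh hh1 ha
  have hx : 1 ≤ h ^ (-(1 / 3) : ℝ) :=
    Real.one_le_rpow_of_pos_of_le_one_of_nonpos hh hh1 (by norm_num)
  have hM : 1 ≤ 1 / ε + 2 := by
    have : 0 ≤ 1 / ε := by positivity
    linarith
  refine ⟨hh, hE, hε, hε1, by positivity, ?_, hC₃, hK, hC₃K, ?_, ?_, ?_, ?_⟩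
  · exact Real.one_le_rpow_of_pos_of_le_one_of_nonpos hh hh1 (by linarith)
  · calc K ≤ h⁻¹ := by
          rw [le_inv_comm₀ hK0 hh, ← one_div]
          exact hhK
      _ = h ^ (-1 : ℝ) := (Real.rpow_neg_one h).symm
      _ ≤ _ := Real.rpow_le_rpow_of_exponent_ge hh hh1 (by linarith)
  · rw [le_div_iff₀ (by positivity)]
    calc (pm + C₃) * (8 * K ^ 4) ≤ (|pm| + C₃) * (8 * K ^ 4) := by
          gcongr
          exact le_abs_self pm
      _ = 8 * K ^ 4 * (|pm| + C₃) := by ring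
      _ ≤ κ₀ := hκ2
      _ ≤ κ₀ ^ 2 := le_self_pow₀ hκone (by norm_num)
      _ ≤ (κ₀ * h ^ (-(1 / 3) : ℝ)) ^ 2 := by
          gcongr
          exact le_mul_of_one_le_right hκ0.le hx
  · have e1 : h * (κ₀ * h ^ (-(1 / 3) : ℝ)) ^ 3 = κ₀ ^ 3 := by
      rw [mul_pow, ← Real.rpow_natCast (h ^ (-(1 / 3) : ℝ)), ← Real.rpow_mul hh.le]
      norm_num
      rw [Real.rpow_neg_one]
      field_simp
    rw [e1]
    calc 8 * C₄ ^ 2 ≤ κ₀ := by linarith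
      _ ≤ κ₀ ^ 3 := le_self_pow₀ hκone (by norm_num)
  · have e1 : (κ₀ * h ^ (-(1 / 3) : ℝ)) ^ 2 * (h ^ (-(1 / ε + 2))) ^ (-ε) ≤ κ₀ ^ 2 * h ^ (1 / 3 : ℝ) := by
      rw [mul_pow, mul_assoc, ← Real.rpow_natCast (h ^ (-(1 / 3) : ℝ)), ← Real.rpow_mul hh.le,
        ← Real.rpow_mul hh.le, ← Real.rpow_add hh]
      refine mul_le_mul_of_nonneg_left (hpow _ ?_) (by positivity)
      have : -(1 / ε + 2) * -ε = 1 + 2 * ε := by field_simp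
      rw [this]
      push_cast
      linarith
    have e2 : h * (κ₀ * h ^ (-(1 / 3) : ℝ)) ≤ κ₀ * h ^ (1 / 3 : ℝ) := by
      have : h * (κ₀ * h ^ (-(1 / 3) : ℝ)) = κ₀ * h ^ (1 + -(1 / 3) : ℝ) := by
        rw [Real.rpow_add hh, Real.rpow_one]
        ring
      rw [this]
      refine mul_le_mul_of_nonneg_left (hpow _ ?_) (by positivity)
      norm_num
    have e3 : 2 * C₄ ^ 2 / ((h ^ (-(1 / ε + 2))) ^ 2 * h ^ 2) ≤ 2 * C₄ ^ 2 * h ^ (1 / 3 : ℝ) := by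
      have : ((h ^ (-(1 / ε + 2))) ^ 2 * h ^ 2)⁻¹ = h ^ (2 / ε + 2) := by
        rw [← Real.rpow_natCast, ← Real.rpow_natCast, ← Real.rpow_mul hh.le, ← Real.rpow_add hh,
          ← Real.rpow_neg hh.le]
        congr 1
        push_cast
        ring
      rw [div_eq_mul_inv, this]
      refine mul_le_mul_of_nonneg_left (hpow _ ?_) (by positivity)
      have : 0 ≤ 2 / ε := by positivity
      linarith
    calc _ ≤ S * h ^ (1 / 3 : ℝ) := by rw [hS]; linarith
      _ ≤ S * (E / 8 / S) := by gcongr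
      _ = E / 8 := by field_simp

/-- All factors in the resolvent bound other than the exponential weight are polynomial in `1/h`. -/
lemma log_bound {κ₀ M c d E Q : ℝ} (hκ₀ : 0 < κ₀) (hM : 0 < M) (hc : 0 < c) (hd : 0 ≤ d)
    (hE : 0 < E) :
    ∃ C : ℝ, 0 < C ∧ ∀ h, 0 < h → h ≤ Real.exp (-1) → ∀ em,
      em = Real.exp (2 * (κ₀ * h ^ (-(1 / 3) : ℝ)) / h * Real.log (1 + h ^ (-M))) →
      Real.log (1 + 2 / (E / 4 * c) * (2 * em * (h ^ (-M)) ^ 4 / (c * h ^ 2) + 1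
        + 8 * em ^ 2 * (h ^ (-M)) ^ 4 * (κ₀ * h ^ (-(1 / 3) : ℝ) / h + d) ^ 2
          * (1 + (1 + Q ^ 2) / h ^ 4)))
        ≤ C * h ^ (-(4 / 3) : ℝ) * Real.log h⁻¹ := by
  obtain ⟨C', hC'⟩ : ∃ C', C' = 1 + 2 / (E / 4 * c) * (2 / c + 1
    + 8 * (κ₀ + d) ^ 2 * (2 + Q ^ 2)) := ⟨_, rfl⟩
  have hC'0 : 0 < C' := by rw [hC']; positivity
  refine ⟨4 * κ₀ * (1 + M) + 4 * M + 8 + C', by positivity, ?_⟩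
  intro h hh hle em hem
  obtain ⟨L, hL⟩ : ∃ L, L = Real.log h⁻¹ := ⟨_, rfl⟩
  have hL1 : 1 ≤ L := by
    rw [hL, Real.log_inv, le_neg]
    exact (Real.log_le_iff_le_exp hh).2 hle
  have hh1 : h ≤ 1 := hle.trans (Real.exp_le_one_iff.2 (by norm_num))
  have hlogh : Real.log h = -L := by rw [hL, Real.log_inv, neg_neg]
  obtain ⟨A, hA⟩ : ∃ A, A = h ^ (-M) := ⟨_, rfl⟩
  have hA1 : 1 ≤ A := by
    rw [hA]
    exact Real.one_le_rpow_of_pos_of_le_one_of_nonpos hh hh1 (by linarith)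
  have hlogA : Real.log A = M * L := by
    rw [hA, Real.log_rpow hh, hlogh]
    ring
  obtain ⟨x, hx⟩ : ∃ x : ℝ, x = h ^ (-(4 / 3) : ℝ) := ⟨_, rfl⟩
  have hx1 : 1 ≤ x := by
    rw [hx]
    exact Real.one_le_rpow_of_pos_of_le_one_of_nonpos hh hh1 (by norm_num)
  have hκx : κ₀ * h ^ (-(1 / 3) : ℝ) / h = κ₀ * x := by
    rw [hx, show (-(4 / 3) : ℝ) = -(1 / 3) - 1 by norm_num, Real.rpow_sub_one hh.ne', mul_div_assoc]
  have hlogA1 : Real.log (1 + A) ≤ (1 + M) * L := by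
    have h1 : Real.log (1 + A) ≤ Real.log (2 * A) := Real.log_le_log (by positivity) (by linarith)
    rw [Real.log_mul (by norm_num) (by positivity), hlogA] at h1
    have h2 : Real.log 2 ≤ 1 := by
      have := Real.log_le_sub_one_of_pos (by norm_num : (0 : ℝ) < 2)
      linarith
    linarith
  have hlogA0 : 0 ≤ Real.log (1 + A) := Real.log_nonneg (by linarith)
  rw [← hA, mul_div_assoc, hκx] at hem
  rw [← hA, hκx, ← hx, ← hL]
  have hem1 : 1 ≤ em := by
    rw [hem, Real.one_le_exp_iff]
    positivity
  have hlogem : Real.log em ≤ 2 * (κ₀ * x) * ((1 + M) * L) := by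
    rw [hem, Real.log_exp]
    gcongr
  have hxh : x ≤ 1 / h ^ 2 := by
    rw [hx, one_div, ← Real.rpow_natCast, ← Real.rpow_neg hh.le]
    exact Real.rpow_le_rpow_of_exponent_ge hh hh1 (by norm_num)
  have hinv : ∀ k : ℕ, 1 ≤ 1 / h ^ k := fun k => by
    rw [one_le_div (by positivity)]
    exact pow_le_one₀ hh.le hh1
  have bound : 1 + 2 / (E / 4 * c) * (2 * em * A ^ 4 / (c * h ^ 2) + 1
        + 8 * em ^ 2 * A ^ 4 * (κ₀ * x + d) ^ 2 * (1 + (1 + Q ^ 2) / h ^ 4))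
      ≤ C' * (em ^ 2 * A ^ 4 * (1 / h ^ 8)) := by
    have b0 : 1 ≤ em ^ 2 * A ^ 4 * (1 / h ^ 8) :=
      one_le_mul_of_one_le_of_one_le (one_le_mul_of_one_le_of_one_le (one_le_pow₀ hem1)
        (one_le_pow₀ hA1)) (hinv 8)
    have b1 : 2 * em * A ^ 4 / (c * h ^ 2) ≤ 2 / c * (em ^ 2 * A ^ 4 * (1 / h ^ 8)) := by
      calc 2 * em * A ^ 4 / (c * h ^ 2) = 2 / c * (em * A ^ 4 * (1 / h ^ 2)) := by field_simp
        _ ≤ 2 / c * (em ^ 2 * A ^ 4 * (1 / h ^ 8)) := by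
          have e1 : em ≤ em ^ 2 := le_self_pow₀ hem1 (by norm_num)
          have e2 : h ^ 8 ≤ h ^ 2 := pow_le_pow_of_le_one hh.le hh1 (by norm_num)
          gcongr
    have b2 : (κ₀ * x + d) ^ 2 ≤ (κ₀ + d) ^ 2 * (1 / h ^ 4) := by
      have e1 : κ₀ * x + d ≤ (κ₀ + d) * (1 / h ^ 2) := by
        have e2 : κ₀ * x ≤ κ₀ * (1 / h ^ 2) := by gcongr
        have e3 : d * 1 ≤ d * (1 / h ^ 2) := by
          have := hinv 2
          gcongr
        linarith
      calc (κ₀ * x + d) ^ 2 ≤ ((κ₀ + d) * (1 / h ^ 2)) ^ 2 := by gcongr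
        _ = _ := by ring
    have b3 : 1 + (1 + Q ^ 2) / h ^ 4 ≤ (2 + Q ^ 2) * (1 / h ^ 4) := by
      have := hinv 4
      have e1 : (2 + Q ^ 2) * (1 / h ^ 4) = 1 / h ^ 4 + (1 + Q ^ 2) / h ^ 4 := by ring
      linarith
    have b4 : 8 * em ^ 2 * A ^ 4 * (κ₀ * x + d) ^ 2 * (1 + (1 + Q ^ 2) / h ^ 4)
        ≤ 8 * (κ₀ + d) ^ 2 * (2 + Q ^ 2) * (em ^ 2 * A ^ 4 * (1 / h ^ 8)) := by
      calc _ ≤ 8 * em ^ 2 * A ^ 4 * ((κ₀ + d) ^ 2 * (1 / h ^ 4)) * ((2 + Q ^ 2) * (1 / h ^ 4)) := by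
            gcongr
        _ = _ := by
            rw [show h ^ 8 = h ^ 4 * h ^ 4 by ring]
            field_simp
    have b5 : C' * (em ^ 2 * A ^ 4 * (1 / h ^ 8)) = em ^ 2 * A ^ 4 * (1 / h ^ 8)
        + 2 / (E / 4 * c) * (2 / c * (em ^ 2 * A ^ 4 * (1 / h ^ 8)) + em ^ 2 * A ^ 4 * (1 / h ^ 8)
          + 8 * (κ₀ + d) ^ 2 * (2 + Q ^ 2) * (em ^ 2 * A ^ 4 * (1 / h ^ 8))) := by
      rw [hC']
      ring
    rw [b5]
    gcongr
  have hlog := Real.log_le_log (by positivity) bound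
  refine hlog.trans ?_
  rw [Real.log_mul (by positivity) (by positivity), Real.log_mul (by positivity) (by positivity),
    Real.log_mul (by positivity) (by positivity), Real.log_pow, Real.log_pow, one_div, Real.log_inv,
    Real.log_pow, hlogA, hlogh]
  push_cast
  have t1 : Real.log C' ≤ C' * (x * L) := by
    have e1 := Real.log_le_sub_one_of_pos hC'0
    have e2 : 1 ≤ x * L := one_le_mul_of_one_le_of_one_le hx1 hL1
    have e3 : C' * 1 ≤ C' * (x * L) := by gcongr
    linarith
  have t2 : (4 * M + 8) * L ≤ (4 * M + 8) * (x * L) := by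
    have : 1 * L ≤ x * L := by gcongr
    rw [one_mul] at this
    gcongr
  have t3 : (4 * κ₀ * (1 + M) + 4 * M + 8 + C') * x * L
      = 2 * (2 * (κ₀ * x) * ((1 + M) * L)) + (4 * M + 8) * (x * L) + C' * (x * L) := by ring
  linarith

lemma weighted_resolvent_ne_zero (hn : 0 < n) {P : L2 n →ₗ.[ℂ] L2 n} {z : ℂ}
    {R : L2 n →L[ℂ] L2 n} (hR : IsResolvent P z R) {s : ℝ} (hs : 0 ≤ s) :
    weight n s hs ∘L R ∘L weight n s hs ≠ 0 := by
  intro h0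
  have : Nonempty (Fin n) := ⟨⟨0, hn⟩⟩
  have hRinj : Function.Injective R := by
    rw [injective_iff_map_eq_zero]
    intro f hf
    have h1 := hR.right_inv f
    have h2 : (⟨R f, hR.mem_domain f⟩ : P.domain) = 0 := Subtype.ext hf
    rw [h2, hf, LinearPMap.map_zero, smul_zero, sub_zero] at h1
    exact h1.symm
  have hz : ∀ f : L2 n, f = 0 := fun f => by
    have h1 : weight n s hs (R (weight n s hs f)) = 0 := by
      have := DFunLike.congr_fun h0 f
      simpa using this
    have h2 := (weight_injective hs) (h1.trans (map_zero _).symm)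
    exact weight_injective hs ((hRinj (h2.trans (map_zero _).symm)).trans (map_zero _).symm)
  have h3 := hz (indicatorConstLp 2 (measurableSet_ball (x := (0 : Rn n)) (ε := 1))
    measure_ball_lt_top.ne (1 : ℂ))
  have h4 := congrArg norm h3
  rw [norm_indicatorConstLp (by norm_num) (by norm_num), norm_zero, norm_one, one_mul] at h4
  have h5 : 0 < (volume : Measure (Rn n)).real (Metric.ball 0 1) :=
    ENNReal.toReal_pos (Metric.measure_ball_pos volume _ one_pos).ne' measure_ball_lt_top.ne
  exact (Real.rpow_pos_of_pos h5 _).ne' h4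

lemma norm_comp_comp_le {B S T : L2 n →L[ℂ] L2 n} (h1 : T = B ∘L S) (h2 : T = S ∘L B)
    (hB : ‖B‖ ≤ 1) (R : L2 n →L[ℂ] L2 n) : ‖T ∘L R ∘L T‖ ≤ ‖S ∘L R ∘L S‖ := by
  have e : T ∘L R ∘L T = B ∘L (S ∘L R ∘L S) ∘L B := by
    nth_rw 1 [h1]
    rw [h2]
    simp only [ContinuousLinearMap.comp_assoc]
  rw [e]
  calc ‖B ∘L (S ∘L R ∘L S) ∘L B‖ ≤ ‖B‖ * ‖(S ∘L R ∘L S) ∘L B‖ :=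
        ContinuousLinearMap.opNorm_comp_le _ _
    _ ≤ ‖B‖ * (‖S ∘L R ∘L S‖ * ‖B‖) :=
        mul_le_mul_of_nonneg_left (ContinuousLinearMap.opNorm_comp_le _ _) (norm_nonneg _)
    _ ≤ 1 * (‖S ∘L R ∘L S‖ * 1) := by gcongr
    _ = ‖S ∘L R ∘L S‖ := by ring

/-- Faster decaying weights give a smaller operator. -/
lemma norm_weighted_le {s s' : ℝ} (hs' : 0 ≤ s') (hs : 0 ≤ s) (h : s' ≤ s) (R : L2 n →L[ℂ] L2 n) :
    ‖weight n s hs ∘L R ∘L weight n s hs‖ ≤ ‖weight n s' hs' ∘L R ∘L weight n s' hs'‖ := by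
  have hd : 0 ≤ s - s' := sub_nonneg.2 h
  refine norm_comp_comp_le (B := weight n (s - s') hd) ?_ ?_ ?_ R
  · rw [weight_comp hd hs' (by linarith)]
    simp only [sub_add_cancel]
  · rw [weight_comp hs' hd (by linarith)]
    simp only [add_sub_cancel]
  · refine ContinuousLinearMap.opNorm_le_bound _ zero_le_one fun u => ?_
    rw [one_mul]
    exact norm_weight_apply_le hd u

end SemiclassicalResolvent

theorem theorem1p1 (n : ℕ) (hn : 3 ≤ n)
    (VL VS : Rn n → ℝ)
    (hV : MemLp (fun x => VL x + VS x) ∞ (volume : Measure (Rn n)))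
    (hVSmeas : AEStronglyMeasurable VS (volume : Measure (Rn n)))
    (r₀ C₁ C₂ δ β : ℝ) (hr₀ : 0 < r₀) (hC₁ : 0 < C₁) (hC₂ : 0 < C₂) (hδ : 3 < δ) (hβ : 3 ≤ β)
    (hVS : ∀ᵐ x : Rn n, |VS x| ≤ C₁ * (‖x‖ + 1) ^ (-δ))
    (p : ℝ → ℝ) (hp_pos : ∀ r, r₀ ≤ r → 0 < p r) (hp_anti : AntitoneOn p (Ici r₀))
    (hp_lim : Tendsto p atTop (𝓝 0))
    -- for almost every direction `ω` in the unit sphere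
    (hVL : ∀ᵐ ω : Metric.sphere (0 : Rn n) 1 ∂(volume : Measure (Rn n)).toSphere,
      ContDiffOn ℝ 1 (fun t : ℝ => VL (t • (ω : Rn n))) (Ici r₀) ∧
      ∀ r, r₀ ≤ r →
        VL (r • (ω : Rn n)) ≤ p r ∧
        derivWithin (fun t : ℝ => VL (t • (ω : Rn n))) (Ici r₀) r
          ≤ C₂ * (r + 1) ^ (-β))
    (s : ℝ) (hs : 1 / 2 < s) (E : ℝ) (hE : 0 < E) :
    ∃ C h₀ : ℝ, 0 < C ∧ 0 < h₀ ∧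
      ∀ h : ℝ, 0 < h → h ≤ h₀ → ∀ θ : ℝ, 0 < θ → θ < 1 → ∀ σ : ℝ, (σ = 1 ∨ σ = -1) →
        ∃ R : L2 n →L[ℂ] L2 n,
          -- `R = (P(h) - E + iσθ)⁻¹`
          IsResolvent
            (schrodinger h (fun x => VL x + VS x) hV)
            ((E : ℂ) - σ * θ * Complex.I) R ∧
          0 < ‖weight n s (by linarith) ∘L R ∘L
            weight n s (by linarith)‖ ∧
          Real.log ‖weight n s (by linarith) ∘L R ∘L
            weight n s (by linarith)‖
            ≤ C * h ^ (-(4 / 3) : ℝ) * Real.log h⁻¹ := by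
  obtain ⟨C₃, C₄, K, pm, W, U, hC₃, hK, hC₃K, HV, hWU⟩ := exists_splitPotential (by lia) hV hVSmeas
    hr₀ hC₁ hC₂ hδ hβ hVS hp_pos hp_anti hp_lim hVL hE
  obtain ⟨ε, hε⟩ : ∃ ε, ε = min (2 * s - 1) 1 := ⟨_, rfl⟩
  have hε0 : 0 < ε := by
    rw [hε]
    exact lt_min (by linarith) one_pos
  have hε1 : ε ≤ 1 := hε ▸ min_le_right _ _
  have hεs : (1 + ε) / 2 ≤ s := by
    have : ε ≤ 2 * s - 1 := hε ▸ min_le_left _ _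
    linarith
  obtain ⟨κ₀, M, h₁, hκ₀, hM, hh₁, Hpar⟩ := exists_carlemanParams (C₄ := C₄) (pm := pm) hE hε0 hε1
    hC₃ hK hC₃K
  obtain ⟨C, hC, hlog⟩ := log_bound (Q := ‖mulOp (fun x => VL x + VS x) hV‖ + E + 1) hκ₀ hM
    (by positivity : (0 : ℝ) < 2 ^ (-(2 / ε))) (Nat.cast_nonneg n) hE
  refine ⟨C, min h₁ (Real.exp (-1)), hC, by positivity, ?_⟩
  intro h hh hle θ hθ hθ1 σ hσ
  have him : ((E : ℂ) - σ * θ * Complex.I).im ≠ 0 := by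
    rcases hσ with rfl | rfl <;> simp [hθ.ne']
  obtain ⟨R, hR⟩ := exists_resolvent hh _ hV him
  have hpos := norm_pos_iff.2 (weighted_resolvent_ne_zero (by lia) hR (by linarith : 0 ≤ s))
  refine ⟨R, hR, hpos, ?_⟩
  have hs' : 0 ≤ (1 + ε) / 2 := by positivity
  refine (Real.log_le_log hpos ((norm_weighted_le hs' _ hεs R).trans ?_)).trans
    (hlog h hh (hle.trans (min_le_right _ _)) _ rfl)
  exact norm_weighted_resolvent_le hn (Hpar h hh (hle.trans (min_le_left _ _))) HV hV hWU rfl rfl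
    hθ hθ1 hσ hR hs'
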